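/- Let $p_1=r_1+v_1$ and $p_2=r_2+v_2$ be fixed, with $r_1,r_2,v_1,v_2\ge 1$ and $(r_1,r_2)$ known, and let $(Y_t)_{t\in\mathbb Z}$ be a process of random $p_1\times p_2$ matrices \[Y_t=L\begin{pmatrix}F_t&Z_{12,t}\\ Z_{21,t}&Z_{22,t}\end{pmatrix}R',\qquad L=(L_1,L_2)\in\mathbb R^{p_1\times p_1},\quad R=(R_1,R_2)\in\mathbb R^{p_2\times p_2},\] where $L$ and $R$ have full rank, $L_1\in\mathbb R^{p_1\times r_1}$, $R_1\in\mathbb R^{p_2\times r_2}$, $F_t\in\mathbb R^{r_1\times r_2}$, $Z_{22,t}\in\mathbb R^{v_1\times v_2}$. Put $f_t=\mathrm{vec}(F_t)$ and $z_t=(\mathrm{vec}(Z_{21,t})',\mathrm{vec}(Z_{12,t})',\mathrm{vec}(Z_{22,t})')'$. Assume that $Y_t$ is weakly stationary with mean zero, that $f_t$ and $z_t$ have mean zero and identity covariance matrices, that $(z_t)$ is white noise (that is, $\mathrm{Cov}(z_t,z_s)=0$ for $t\ne s$), and that $f_t$ and $z_s$ are uncorrelated for all $t,s$. Write $L_i=A_iW_i$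 and $R_i=P_iG_i$ ($i=1,2$) with $A_i,P_i$ half-orthonormal ($A_i'A_i=I$, $P_i'P_i=I$) and $W_i,G_i$ square, let $X_t=W_1F_tG_1'$, and let $B_1\in\mathbb R^{p_1\times v_1}$, $B_2\in\mathbb R^{p_1\times r_1}$, $Q_1\in\mathbb R^{p_2\times v_2}$, $Q_2\in\mathbb R^{p_2\times r_2}$ be half-orthonormal with $B_i'A_i=0$ and $Q_i'P_i=0$. For a fixed integer $k_0\ge1$, with $y_{i,t}$ the $i$-th column of $Y_t$ and $\Sigma_{y,ij}(k)=\mathrm{Cov}(y_{i,t},y_{j,t-k})$, let \[M_1=\sum_{k=1}^{k_0}\sum_{i,j=1}^{p_2}\Sigma_{y,ij}(k)\Sigma_{y,ij}(k)',\] and let $M_2$ be the same matrix formed from $Y_t'$ in place of $Y_t$. Assume $\mathrm{rank}(M_1)=r_1$ and $\mathrm{rank}(M_2)=r_2$. Assume moreover that for some $\gamma>2$: (1) the process $(\mathrm{vec}(Y_t),\mathrm{vec}(F_t))$ is $\alpha$-mixing with coefficients satisfying $\sum_{k\ge1}\alpha(k)^{1-2/\gamma}<\infty$, where $\alpha(k)=\sup_i\sup\{|P(A\cap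 B)-P(A)P(B)|: A\in\mathcal F_{-\infty}^i,\,B\in\mathcal F_{i+k}^\infty\}$ and $\mathcal F_i^j$ is generated by the process at the times $i\le t\le j$; (2) there are constants $C_1,C_2$ with $E|f_{i,t}|^{2\gamma}<C_1$ and $E|z_{j,t}|^{2\gamma}<C_2$ for all $i,j,t$. From a sample $Y_1,\dots,Y_n$, with $\bar Y=n^{-1}\sum_{t=1}^nY_t$ and columns $\bar y_i$ of $\bar Y$, put \[\widehat\Sigma_{y,ij}(k)=\frac1n\sum_{t=k+1}^n(y_{i,t}-\bar y_i)(y_{j,t-k}-\bar y_j)',\qquad \widehat M_1=\sum_{k=1}^{k_0}\sum_{i,j=1}^{p_2}\widehat\Sigma_{y,ij}(k)\widehat\Sigma_{y,ij}(k)'.\] Let the columns of $\widehat A_1$ (of $\widehat B_1$) be orthonormal eigenvectors of $\widehat M_1$ for its $r_1$ largest ($v_1$ smallest) eigenvalues, and let $\widehat M_2$, $\widehat P_1\in\mathbb R^{p_2\times r_2}$, $\widehat Q_1\in\mathbb R^{p_2\times v_2}$ be obtained in the same way from the data $Y_t'$. Let \[\widehat\Omega_{y_i}=\frac1n\sum_{t=1}^n(y_{i,t}-\bar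 y_i)\,\mathrm{vec}(Y_t-\bar Y)',\qquad \widehat S_1=\sum_{i=1}^{p_2}[\widehat\Omega_{y_i}(\widehat Q_1\otimes\widehat B_1)][\widehat\Omega_{y_i}(\widehat Q_1\otimes\widehat B_1)]',\] let $\widehat S_2$ be the same construction for $Y_t'$, with the roles of $\widehat B_1$ and $\widehat Q_1$ exchanged, and let the columns of $\widehat B_2\in\mathbb R^{p_1\times r_1}$ and of $\widehat Q_2\in\mathbb R^{p_2\times r_2}$ be orthonormal eigenvectors for the $r_1$ smallest eigenvalues of $\widehat S_1$ and the $r_2$ smallest eigenvalues of $\widehat S_2$. (Ties between eigenvalues may be resolved in any way.) Finally let \[\widehat X_t=(\widehat B_2'\widehat A_1)^{-1}\widehat B_2'\,Y_t\,\widehat Q_2(\widehat P_1'\widehat Q_2)^{-1},\] where the inverse of a singular matrix is read as $0$. For half-orthonormal $p\times r$ matrices $H_1,H_2$ with column spaces $\mathcal M(H_1),\mathcal M(H_2)$ let $D(\mathcal M(H_1),\mathcal M(H_2))=\sqrt{1-\frac1r\mathrm{tr}(H_1H_1'H_2H_2')}$. Then, as $n\to\infty$, each of \[D(\mathcal M(\widehat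 A_1),\mathcal M(A_1)),\quad D(\mathcal M(\widehat B_1),\mathcal M(B_1)),\quad D(\mathcal M(\widehat P_1),\mathcal M(P_1)),\] \[D(\mathcal M(\widehat Q_1),\mathcal M(Q_1)),\quad D(\mathcal M(\widehat B_2),\mathcal M(B_2)),\quad D(\mathcal M(\widehat Q_2),\mathcal M(Q_2))\] is $O_p(n^{-1/2})$, and, in the operator norm, \[\|\widehat A_1\widehat X_t\widehat P_1'-A_1X_tP_1'\|_2=O_p(n^{-1/2})\] for every $t$, which may be fixed or vary with $n$. -/

import Mathlib

open MeasureTheory ProbabilityTheory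

namespace MatrixFactor

open scoped Matrix Kronecker

noncomputable section

/-! ### Matrix notions -/

/-- A half-orthonormal matrix: its columns are orthonormal. -/
def HalfOrthonormal {p r : ℕ} (H : Matrix (Fin p) (Fin r) ℝ) : Prop :=
  Hᵀ * H = 1

/-- The discrepancy `D(M(H₁), M(H₂)) = √(1 - tr(H₁ H₁' H₂ H₂') / r)` between the column spaces of two
half-orthonormal `p × r` matrices. -/
def discrepancy {p r : ℕ} (H₁ H₂ : Matrix (Fin p) (Fin r) ℝ) : ℝ :=
  Real.sqrt (1 - (1 / (r : ℝ)) * (H₁ * H₁ᵀ * H₂ * H₂ᵀ).trace)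

/-- The columns of `V` are orthonormal eigenvectors of `M` corresponding to its `r` largest
eigenvalues: `V` consists of the first `r` columns of an orthogonal matrix of eigenvectors that are
arranged in decreasing order of the eigenvalues. -/
def IsTopEigenvectors {p r : ℕ} (M : Matrix (Fin p) (Fin p) ℝ)
    (V : Matrix (Fin p) (Fin r) ℝ) : Prop :=
  ∃ (Γ : Matrix (Fin p) (Fin p) ℝ) (lam : Fin p → ℝ) (h : r ≤ p),
    Γᵀ * Γ = 1 ∧ M * Γ = Γ * Matrix.diagonal lam ∧ Antitone lam ∧
      V = Γ.submatrix id (Fin.castLE h)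

/-- The columns of `V` are orthonormal eigenvectors of `M` corresponding to its `r` smallest
eigenvalues. -/
def IsBottomEigenvectors {p r : ℕ} (M : Matrix (Fin p) (Fin p) ℝ)
    (V : Matrix (Fin p) (Fin r) ℝ) : Prop :=
  ∃ (Γ : Matrix (Fin p) (Fin p) ℝ) (lam : Fin p → ℝ) (h : r ≤ p),
    Γᵀ * Γ = 1 ∧ M * Γ = Γ * Matrix.diagonal lam ∧ Monotone lam ∧
      V = Γ.submatrix id (Fin.castLE h)

section OperatorNorm

open scoped Matrix.Norms.L2Operator

/-- The operator norm of a real matrix with respect to the Euclidean norms. -/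
def opNorm {p q : ℕ} (H : Matrix (Fin p) (Fin q) ℝ) : ℝ := ‖H‖

end OperatorNorm

/-! ### Probabilistic notions -/

variable {Ω : Type*} [MeasurableSpace Ω]

/-- `X n = O_p(a n)` as `n → ∞`. (For a set that is not measurable, `μ` is the outer measure.) -/
def IsBigOp (μ : Measure Ω) (X : ℕ → Ω → ℝ) (a : ℕ → ℝ) : Prop :=
  ∀ ε : ℝ, 0 < ε → ∃ C : ℝ, 0 < C ∧ ∃ N : ℕ, ∀ n : ℕ, N ≤ n →
    μ {ω | C * a n < |X n ω|} ≤ ENNReal.ofReal ε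

/-- The σ-field generated by the variables `V t`, `t ∈ S`. -/
abbrev sigmaField {E : Type*} [MeasurableSpace E] (V : ℤ → Ω → E) (S : Set ℤ) :
    MeasurableSpace Ω :=
  ⨆ t ∈ S, MeasurableSpace.comap (V t) inferInstance

/-- The α-mixing coefficient at lag `k`: the supremum of `|P(A ∩ B) - P(A) P(B)|` over all times `i`,
events `A` of the past up to `i`, and events `B` of the future from `i + k` on. -/
def mixingCoeff {E : Type*} [MeasurableSpace E] (μ : Measure Ω) (V : ℤ → Ω → E) (k : ℕ) : ℝ :=
  sSup {x : ℝ | ∃ (i : ℤ) (A B : Set Ω),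
    MeasurableSet[sigmaField V (Set.Iic i)] A ∧
    MeasurableSet[sigmaField V (Set.Ici (i + (k : ℤ)))] B ∧
    x = |μ.real (A ∩ B) - μ.real A * μ.real B|}

/-- A weakly stationary vector process with mean zero. -/
structure IsCenteredWeaklyStationary {ι : Type*} (μ : Measure Ω) (V : ℤ → Ω → ι → ℝ) : Prop where
  memLp : ∀ t a, MemLp (fun ω => V t ω a) 2 μ
  mean_zero : ∀ t a, ∫ ω, V t ω a ∂μ = 0
  cov_shift : ∀ (s t h : ℤ) a b,
    cov[fun ω => V (s + h) ω a, fun ω => V (t + h) ω b; μ] =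
      cov[fun ω => V s ω a, fun ω => V t ω b; μ]

/-- A vector process with mean zero and identity covariance matrix at every time. -/
structure IsStandardized {ι : Type*} [DecidableEq ι] (μ : Measure Ω) (V : ℤ → Ω → ι → ℝ) :
    Prop where
  memLp : ∀ t a, MemLp (fun ω => V t ω a) 2 μ
  mean_zero : ∀ t a, ∫ ω, V t ω a ∂μ = 0
  cov_eq : ∀ t a b, cov[fun ω => V t ω a, fun ω => V t ω b; μ] = if a = b then 1 else 0

/-! ### The matrix factor model -/

/-- The vectorized idiosyncratic term `(vec(Z₂₁)', vec(Z₁₂)', vec(Z₂₂)')'`. -/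
def idioVec {r₁ r₂ v₁ v₂ : ℕ} (Z₁₂ : Matrix (Fin r₁) (Fin v₂) ℝ)
    (Z₂₁ : Matrix (Fin v₁) (Fin r₂) ℝ) (Z₂₂ : Matrix (Fin v₁) (Fin v₂) ℝ) :
    (Fin r₂ × Fin v₁) ⊕ ((Fin v₂ × Fin r₁) ⊕ (Fin v₂ × Fin v₁)) → ℝ :=
  Sum.elim Z₂₁.vec (Sum.elim Z₁₂.vec Z₂₂.vec)

/-- The matrix factor model `Y_t = L [F_t, Z₁₂,t; Z₂₁,t, Z₂₂,t] R'` with `L = (L₁, L₂)` and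
`R = (R₁, R₂)`, with its standing conditions. -/
structure Model {p₁ p₂ r₁ r₂ v₁ v₂ : ℕ} (μ : Measure Ω)
    (L₁ : Matrix (Fin p₁) (Fin r₁) ℝ) (L₂ : Matrix (Fin p₁) (Fin v₁) ℝ)
    (R₁ : Matrix (Fin p₂) (Fin r₂) ℝ) (R₂ : Matrix (Fin p₂) (Fin v₂) ℝ)
    (F : ℤ → Ω → Matrix (Fin r₁) (Fin r₂) ℝ) (Z₁₂ : ℤ → Ω → Matrix (Fin r₁) (Fin v₂) ℝ)
    (Z₂₁ : ℤ → Ω → Matrix (Fin v₁) (Fin r₂) ℝ) (Z₂₂ : ℤ → Ω → Matrix (Fin v₁) (Fin v₂) ℝ)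
    (Y : ℤ → Ω → Matrix (Fin p₁) (Fin p₂) ℝ) : Prop where
  dim₁ : r₁ + v₁ = p₁
  dim₂ : r₂ + v₂ = p₂
  -- `L` and `R` are square matrices of full rank
  rank_L : (Matrix.fromCols L₁ L₂).rank = p₁
  rank_R : (Matrix.fromCols R₁ R₂).rank = p₂
  measurable_factor : ∀ t a, Measurable fun ω => (F t ω).vec a
  measurable_noise : ∀ t a, Measurable fun ω => idioVec (Z₁₂ t ω) (Z₂₁ t ω) (Z₂₂ t ω) a
  eq : ∀ t ω, Y t ω = Matrix.fromCols L₁ L₂ *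
    Matrix.fromBlocks (F t ω) (Z₁₂ t ω) (Z₂₁ t ω) (Z₂₂ t ω) * (Matrix.fromCols R₁ R₂)ᵀ
  stationary : IsCenteredWeaklyStationary μ fun t ω => (Y t ω).vec
  factor : IsStandardized μ fun t ω => (F t ω).vec
  noise : IsStandardized μ fun t ω => idioVec (Z₁₂ t ω) (Z₂₁ t ω) (Z₂₂ t ω)
  -- the noise is a white noise
  white : ∀ s t, s ≠ t → ∀ a b,
    cov[fun ω => idioVec (Z₁₂ s ω) (Z₂₁ s ω) (Z₂₂ s ω) a,
      fun ω => idioVec (Z₁₂ t ω) (Z₂₁ t ω) (Z₂₂ t ω) b; μ] = 0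
  -- factors and noise are uncorrelated at all leads and lags
  uncorrelated : ∀ s t a b,
    cov[fun ω => (F s ω).vec a, fun ω => idioVec (Z₁₂ t ω) (Z₂₁ t ω) (Z₂₂ t ω) b; μ] = 0

/-! ### Population and sample moments

For a process of `p × q` matrices `Y_t = (y_{1,t}, …, y_{q,t})`; the moments for the transposed data
are obtained by applying the definitions to `Y_t'`. -/

variable {p q : ℕ}

/-- `Σ_{y,ij}(k) = Cov(y_{i,t}, y_{j,t-k})`, evaluated at `t = 0` (it does not depend on `t` for a
weakly stationary process). -/
def autoCov (μ : Measure Ω) (Y : ℤ → Ω → Matrix (Fin p) (Fin q) ℝ) (i j : Fin q) (k : ℕ) :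
    Matrix (Fin p) (Fin p) ℝ :=
  Matrix.of fun a b => cov[fun ω => Y 0 ω a i, fun ω => Y (-(k : ℤ)) ω b j; μ]

/-- `M = ∑_{k=1}^{k₀} ∑_i ∑_j Σ_{y,ij}(k) Σ_{y,ij}(k)'`. -/
def lagMatrix (μ : Measure Ω) (Y : ℤ → Ω → Matrix (Fin p) (Fin q) ℝ) (k₀ : ℕ) :
    Matrix (Fin p) (Fin p) ℝ :=
  ∑ k ∈ Finset.Icc 1 k₀, ∑ i : Fin q, ∑ j : Fin q, autoCov μ Y i j k * (autoCov μ Y i j k)ᵀ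

/-- The sample mean `n⁻¹ ∑_{t=1}^n Y_t` of a realization `y` of the process. -/
def sampleMean (y : ℤ → Matrix (Fin p) (Fin q) ℝ) (n : ℕ) : Matrix (Fin p) (Fin q) ℝ :=
  (1 / (n : ℝ)) • ∑ t ∈ Finset.Icc 1 n, y (t : ℤ)

/-- The sample autocovariance
`n⁻¹ ∑_{t=k+1}^n (y_{i,t} - ȳ_i) (y_{j,t-k} - ȳ_j)'`. -/
def sampleAutoCov (y : ℤ → Matrix (Fin p) (Fin q) ℝ) (n : ℕ) (i j : Fin q) (k : ℕ) :
    Matrix (Fin p) (Fin p) ℝ :=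
  (1 / (n : ℝ)) • ∑ t ∈ Finset.Icc (k + 1) n,
    Matrix.vecMulVec ((y (t : ℤ) - sampleMean y n).col i)
      ((y ((t : ℤ) - (k : ℤ)) - sampleMean y n).col j)

/-- The sample version of `lagMatrix`. -/
def sampleLagMatrix (y : ℤ → Matrix (Fin p) (Fin q) ℝ) (k₀ n : ℕ) : Matrix (Fin p) (Fin p) ℝ :=
  ∑ k ∈ Finset.Icc 1 k₀, ∑ i : Fin q, ∑ j : Fin q,
    sampleAutoCov y n i j k * (sampleAutoCov y n i j k)ᵀ

/-- The sample version of `Ω_{y_i} = Cov(y_{i,t}, vec(Y_t))`. -/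
def sampleOmega (y : ℤ → Matrix (Fin p) (Fin q) ℝ) (n : ℕ) (i : Fin q) :
    Matrix (Fin p) (Fin q × Fin p) ℝ :=
  (1 / (n : ℝ)) • ∑ t ∈ Finset.Icc 1 n,
    Matrix.vecMulVec ((y (t : ℤ) - sampleMean y n).col i) (y (t : ℤ) - sampleMean y n).vec

/-- `Ŝ = ∑_i [Ω̂_{y_i} (Q ⊗ B)] [Ω̂_{y_i} (Q ⊗ B)]'`. -/
def sampleNoiseMatrix {v w : ℕ} (y : ℤ → Matrix (Fin p) (Fin q) ℝ)
    (Q : Matrix (Fin q) (Fin w) ℝ) (B : Matrix (Fin p) (Fin v) ℝ) (n : ℕ) :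
    Matrix (Fin p) (Fin p) ℝ :=
  ∑ i : Fin q, (sampleOmega y n i * (Q ⊗ₖ B)) * (sampleOmega y n i * (Q ⊗ₖ B))ᵀ

/-- The recovered factor `X̂_t = (B̂₂' Â₁)⁻¹ B̂₂' Y_t Q̂₂ (P̂₁' Q̂₂)⁻¹`. -/
def recoveredFactor {p₁ p₂ r₁ r₂ : ℕ} (A₁ B₂ : Matrix (Fin p₁) (Fin r₁) ℝ)
    (P₁ Q₂ : Matrix (Fin p₂) (Fin r₂) ℝ) (Y : Matrix (Fin p₁) (Fin p₂) ℝ) :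
    Matrix (Fin r₁) (Fin r₂) ℝ :=
  (B₂ᵀ * A₁)⁻¹ * B₂ᵀ * Y * Q₂ * (P₁ᵀ * Q₂)⁻¹

end

end MatrixFactor

namespace MatrixFactor

open scoped Matrix Kronecker Matrix.Norms.Frobenius

/-! ### The Frobenius norm -/

section Frobenius

variable {l m n o : Type*} [Fintype l] [Fintype m] [Fintype n] [Fintype o]

/-! Everything reduces to one random quantity, the total error of the sample autocovariances at lags
0 to k₀; the rest is deterministic perturbation theory.

Rate of the moments. Truncation gives Davydov's covariance inequality (`abs_covariance_le_rpow`).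
Since α(k)^{1-2/γ} is summable, the variance of a sum of finite-lag functionals is linear in the
number of terms (`exists_variance_sum_le`), and Chebyshev's inequality yields the rate n^{-1/2}
(`isBigOp_sample_covariance`, `isBigOp_momentError`). Moments of order 2γ of the observations give
moments of order γ of their products.

Population structure. A linear form u'Y_t w with u'L₁ = 0 contains no factor, hence is uncorrelated
with the observations at other times (`Model.cov_form`). So M₁ annihilates B₁. It is a Gram matrix
TT' of rank r₁, so its quadratic form dominates a positive multiple of that of A₁A₁' (`exists_gap`).
At lag 0, projecting by Q₁ ⊗ B₁ removes the factor and leaves a positive multiple of XX' with X =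
L₂L₂'B₁, a matrix of rank v₁ whose left kernel is spanned by B₂ (`Model.noiseMatrix_eq`).

Perturbation. Comparing the Ky Fan principle for the sample matrix with the gap of the population
matrix bounds the distance of the eigenprojectors by (2/δ) times the matrix error, whatever the
choice of eigenvectors (`IsBottomEigenvectors.norm_projector_sub_le`). The discrepancy D is at most
this distance. Individual bases do not converge, only projectors do; so the second-stage matrices Ŝ
and the recovered signal must be written through projectors. For Ŝ this is
`mul_kronecker_mul_transpose`. The estimated signal is E Y_t K', with E and K oblique projectors
that are smooth functions of orthogonal ones (`oblique_eq`). At the population values E₀ fixes L₁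
and kills L₂, and likewise K₀ for R₁ and R₂, so E₀ Y_t K₀' is exactly A₁X_tP₁'. Since Y_t is O_p(1)
by stationarity, the error has the stated rate.

The column side follows by transposing the model (`Model.transpose`), and `IsBigOp.of_isBigO` turns
the deterministic bounds into stochastic ones. -/

lemma frobenius_norm_sq (X : Matrix m n ℝ) : ‖X‖ ^ 2 = ∑ i, ∑ j, X i j ^ 2 := by
  have h0 : (0 : ℝ) ≤ ∑ i, ∑ j, X i j ^ 2 := by positivity
  rw [Matrix.frobenius_norm_def, ← Real.sqrt_eq_rpow, Real.sq_sqrt]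
  · simp
  · simpa using h0

lemma frobenius_norm_sq_eq_trace (X : Matrix m n ℝ) : ‖X‖ ^ 2 = (Xᵀ * X).trace := by
  rw [frobenius_norm_sq, Finset.sum_comm]
  simp [Matrix.trace, Matrix.mul_apply, pow_two]

lemma abs_entry_le_frobenius_norm (X : Matrix m n ℝ) (i : m) (j : n) : |X i j| ≤ ‖X‖ := by
  apply abs_le_of_sq_le_sq _ (norm_nonneg _)
  rw [frobenius_norm_sq]
  calc X i j ^ 2 ≤ ∑ j, X i j ^ 2 :=
        Finset.single_le_sum (f := fun j => X i j ^ 2) (fun _ _ => sq_nonneg _) (Finset.mem_univ j)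
    _ ≤ _ := Finset.single_le_sum (f := fun i => ∑ j, X i j ^ 2)
        (fun _ _ => Finset.sum_nonneg fun _ _ => sq_nonneg _) (Finset.mem_univ i)

lemma frobenius_norm_le_sum (X : Matrix m n ℝ) : ‖X‖ ≤ ∑ i, ∑ j, |X i j| := by
  apply le_of_sq_le_sq _ (by positivity)
  rw [frobenius_norm_sq]
  calc ∑ i, ∑ j, X i j ^ 2 = ∑ i, ∑ j, |X i j| ^ 2 := by simp
    _ ≤ ∑ i, (∑ j, |X i j|) ^ 2 := Finset.sum_le_sum fun i _ =>
        Finset.sum_sq_le_sq_sum_of_nonneg fun _ _ => abs_nonneg _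
    _ ≤ _ := Finset.sum_sq_le_sq_sum_of_nonneg fun _ _ => by positivity

lemma trace_mul_le_frobenius (X : Matrix m n ℝ) (Y : Matrix n m ℝ) :
    (X * Y).trace ≤ ‖X‖ * ‖Y‖ := by
  apply le_of_abs_le
  apply abs_le_of_sq_le_sq _ (by positivity)
  rw [mul_pow, ← Matrix.frobenius_norm_transpose Y, frobenius_norm_sq, frobenius_norm_sq]
  have := Finset.sum_mul_sq_le_sq_mul_sq (Finset.univ : Finset (m × n)) (fun x => X x.1 x.2)
    (fun x => Y x.2 x.1)
  simpa [Fintype.sum_prod_type, Matrix.trace, Matrix.mul_apply] using this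

lemma frobenius_norm_kronecker (X : Matrix l m ℝ) (Y : Matrix n o ℝ) :
    ‖X ⊗ₖ Y‖ = ‖X‖ * ‖Y‖ := by
  apply (sq_eq_sq₀ (norm_nonneg _) (by positivity)).1
  rw [mul_pow, frobenius_norm_sq, frobenius_norm_sq, frobenius_norm_sq]
  simp only [Fintype.sum_prod_type, Matrix.kroneckerMap_apply, mul_pow]
  simp only [Finset.sum_mul_sum]

end Frobenius

lemma opNorm_nonneg {p q : ℕ} (H : Matrix (Fin p) (Fin q) ℝ) : 0 ≤ opNorm H := by
  unfold opNorm
  rw [Matrix.l2_opNorm_def]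
  exact norm_nonneg _

lemma opNorm_le_frobenius_norm {p q : ℕ} (H : Matrix (Fin p) (Fin q) ℝ) : opNorm H ≤ ‖H‖ := by
  unfold opNorm
  rw [Matrix.l2_opNorm_def]
  refine ContinuousLinearMap.opNorm_le_bound _ (norm_nonneg _) fun x => ?_
  apply le_of_sq_le_sq _ (by positivity)
  rw [mul_pow, frobenius_norm_sq, EuclideanSpace.norm_sq_eq, EuclideanSpace.norm_sq_eq,
    Finset.sum_mul]
  refine Finset.sum_le_sum fun i _ => ?_
  have := Finset.sum_mul_sq_le_sq_mul_sq Finset.univ (fun j => H i j) (fun j => x j)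
  simpa [Matrix.mulVec, dotProduct] using this

/-! ### Half-orthonormal matrices and projectors -/

section Projectors

variable {p r v : ℕ}

/-- The matrix (A, B) is square with its transpose as left inverse; for square matrices this is also
a right inverse. -/
lemma HalfOrthonormal.mul_transpose_add {A : Matrix (Fin p) (Fin r) ℝ}
    {B : Matrix (Fin p) (Fin v) ℝ} (hA : HalfOrthonormal A) (hB : HalfOrthonormal B)
    (hBA : Bᵀ * A = 0) (hp : r + v = p) : A * Aᵀ + B * Bᵀ = 1 := by
  have hAB : Aᵀ * B = 0 := by
    have := congrArg Matrix.transpose hBA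
    simpa using this
  unfold HalfOrthonormal at hA hB
  have h : (Matrix.fromCols A B)ᵀ * Matrix.fromCols A B = 1 := by
    rw [Matrix.transpose_fromCols, Matrix.fromRows_mul_fromCols, hA, hB, hBA, hAB,
      Matrix.fromBlocks_one]
  have h2 := (Matrix.mul_eq_one_comm_of_card_eq _ _ _ (by simp [hp])).1 h
  rwa [Matrix.transpose_fromCols, Matrix.fromCols_mul_fromRows] at h2

/-- Translates between the traces of the Ky Fan principle and distances of projectors. -/
lemma HalfOrthonormal.norm_projector_sub_sq {H V : Matrix (Fin p) (Fin r) ℝ}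
    (hH : HalfOrthonormal H) (hV : HalfOrthonormal V) :
    ‖H * Hᵀ - V * Vᵀ‖ ^ 2 = 2 * (r - (V * Vᵀ * (H * Hᵀ)).trace) := by
  unfold HalfOrthonormal at hH hV
  rw [frobenius_norm_sq_eq_trace]
  have e : (H * Hᵀ - V * Vᵀ)ᵀ * (H * Hᵀ - V * Vᵀ) =
      H * (Hᵀ * H) * Hᵀ + V * (Vᵀ * V) * Vᵀ - H * Hᵀ * (V * Vᵀ) - V * Vᵀ * (H * Hᵀ) := by
    simp only [Matrix.transpose_sub, Matrix.transpose_mul, Matrix.transpose_transpose,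
      Matrix.sub_mul, Matrix.mul_sub, Matrix.mul_assoc]
    abel
  rw [e, hH, hV, Matrix.mul_one, Matrix.mul_one, Matrix.trace_sub, Matrix.trace_sub,
    Matrix.trace_add, Matrix.trace_mul_comm H, Matrix.trace_mul_comm V, hH, hV,
    Matrix.trace_mul_comm (H * Hᵀ)]
  simp
  ring

/-- With x the trace of the product of the projectors, D² = (r - x)/r, while the squared distance is
2(r - x); the latter also shows r - x ≥ 0. -/
lemma discrepancy_le {H V : Matrix (Fin p) (Fin r) ℝ} (hr : 0 < r)
    (hH : HalfOrthonormal H) (hV : HalfOrthonormal V) :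
    |discrepancy H V| ≤ ‖H * Hᵀ - V * Vᵀ‖ := by
  unfold discrepancy
  rw [abs_of_nonneg (Real.sqrt_nonneg _)]
  apply Real.sqrt_le_iff.2 ⟨norm_nonneg _, ?_⟩
  have h := hH.norm_projector_sub_sq hV
  have h1 : (1 : ℝ) ≤ r := by exact_mod_cast hr
  have e : (H * Hᵀ * V * Vᵀ).trace = (V * Vᵀ * (H * Hᵀ)).trace := by
    rw [Matrix.trace_mul_comm (V * Vᵀ), Matrix.mul_assoc (H * Hᵀ)]
  rw [e]
  set x := (V * Vᵀ * (H * Hᵀ)).trace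
  have h0 : 0 ≤ (r : ℝ) - x := by nlinarith [sq_nonneg ‖H * Hᵀ - V * Vᵀ‖]
  have h2 : 1 - 1 / (r : ℝ) * x = (r - x) / r := by field_simp
  rw [h2, h]
  have : (r - x) / r ≤ (r : ℝ) - x := div_le_self h0 h1
  linarith

end Projectors

/-! ### Extremal eigenvectors -/

section Eigenvectors

variable {p r v : ℕ}

/-- Allows a single perturbation theorem, for the smallest eigenvalues, to serve both ends of the
spectrum. -/
lemma IsTopEigenvectors.neg {M : Matrix (Fin p) (Fin p) ℝ} {V : Matrix (Fin p) (Fin r) ℝ}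
    (h : IsTopEigenvectors M V) : IsBottomEigenvectors (-M) V := by
  obtain ⟨Γ, lam, hp, h1, h2, h3, h4⟩ := h
  refine ⟨Γ, -lam, hp, h1, ?_, h3.neg, h4⟩
  rw [Matrix.neg_mul, h2, ← Matrix.mul_neg, Matrix.diagonal_neg]
  rfl

lemma IsBottomEigenvectors.halfOrthonormal {M : Matrix (Fin p) (Fin p) ℝ}
    {V : Matrix (Fin p) (Fin r) ℝ} (h : IsBottomEigenvectors M V) : HalfOrthonormal V := by
  obtain ⟨Γ, lam, hp, h1, h2, h3, rfl⟩ := h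
  unfold HalfOrthonormal
  have : (Γ.submatrix id (Fin.castLE hp))ᵀ * Γ.submatrix id (Fin.castLE hp) =
      (Γᵀ * Γ).submatrix (Fin.castLE hp) (Fin.castLE hp) := by
    ext i j; simp [Matrix.mul_apply]
  rw [this, h1]
  exact Matrix.submatrix_one _ (Fin.castLE_injective hp)

/-- In the eigenbasis the trace is an average of eigenvalues, weighted by the squared row norms of
Γ'H. The Ky Fan principle then becomes a statement about weights in [0, 1] with sum r. -/
lemma trace_quadratic_eq_sum {M Γ : Matrix (Fin p) (Fin p) ℝ} {lam : Fin p → ℝ}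
    (h1 : Γᵀ * Γ = 1) (h2 : M * Γ = Γ * Matrix.diagonal lam) (H : Matrix (Fin p) (Fin r) ℝ) :
    (Hᵀ * M * H).trace = ∑ a, lam a * ∑ j, (Γᵀ * H) a j ^ 2 := by
  have h1' : Γ * Γᵀ = 1 := mul_eq_one_comm.1 h1
  have hM : M = Γ * Matrix.diagonal lam * Γᵀ := by
    rw [← h2, Matrix.mul_assoc, h1', Matrix.mul_one]
  have e : Hᵀ * M * H = (Γᵀ * H)ᵀ * (Matrix.diagonal lam * (Γᵀ * H)) := by
    rw [hM]; simp [Matrix.mul_assoc]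
  rw [e]
  simp only [Matrix.trace, Matrix.diag_apply, Matrix.mul_apply (M := (Γᵀ * H)ᵀ),
    Matrix.diagonal_mul, Matrix.transpose_apply]
  rw [Finset.sum_comm]
  refine Finset.sum_congr rfl fun a _ => ?_
  rw [Finset.mul_sum]
  exact Finset.sum_congr rfl fun j _ => by ring

/-- The Ky Fan minimum principle. -/
lemma IsBottomEigenvectors.trace_le {M : Matrix (Fin p) (Fin p) ℝ}
    {V H : Matrix (Fin p) (Fin r) ℝ} (h : IsBottomEigenvectors M V) (hH : HalfOrthonormal H) :
    (Vᵀ * M * V).trace ≤ (Hᵀ * M * H).trace := by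
  have hV := h.halfOrthonormal
  obtain ⟨Γ, lam, hp, h1, h2, h3, hVΓ⟩ := h
  rcases Nat.eq_zero_or_pos r with rfl | hr
  · simp [Matrix.trace]
  have h1' : Γ * Γᵀ = 1 := mul_eq_one_comm.1 h1
  rw [trace_quadratic_eq_sum h1 h2, trace_quadratic_eq_sum h1 h2]
  have hsum : ∀ K : Matrix (Fin p) (Fin r) ℝ, HalfOrthonormal K →
      ∑ a, ∑ j, (Γᵀ * K) a j ^ 2 = r := by
    intro K hK
    unfold HalfOrthonormal at hK
    rw [← frobenius_norm_sq, frobenius_norm_sq_eq_trace, Matrix.transpose_mul,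
      Matrix.transpose_transpose, Matrix.mul_assoc, ← Matrix.mul_assoc Γ, h1', Matrix.one_mul, hK]
    simp
  -- The weights are the diagonal entries of the orthogonal projector KK'. Idempotence and symmetry
  -- make a diagonal entry the sum of squares of its row, so it is at least its own square.
  have hle : ∀ a, ∑ j, (Γᵀ * H) a j ^ 2 ≤ 1 := by
    intro a
    set K := Γᵀ * H with hK
    have hKK : Kᵀ * K = 1 := by
      rw [hK, Matrix.transpose_mul, Matrix.transpose_transpose, Matrix.mul_assoc,
        ← Matrix.mul_assoc Γ, h1', Matrix.one_mul]
      exact hH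
    have hid : (K * Kᵀ) * (K * Kᵀ) = K * Kᵀ := by
      rw [Matrix.mul_assoc, ← Matrix.mul_assoc Kᵀ, hKK, Matrix.one_mul]
    have hs : ∑ j, K a j ^ 2 = (K * Kᵀ) a a := by simp [Matrix.mul_apply, pow_two]
    have hsym : ∀ b, (K * Kᵀ) b a = (K * Kᵀ) a b := by
      intro b; simp [Matrix.mul_apply, mul_comm]
    have h5 : (K * Kᵀ) a a = ∑ b, (K * Kᵀ) a b ^ 2 := by
      conv_lhs => rw [← hid, Matrix.mul_apply]
      exact Finset.sum_congr rfl fun b _ => by rw [hsym b, pow_two]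
    have h6 : (K * Kᵀ) a a ^ 2 ≤ (K * Kᵀ) a a := by
      conv_rhs => rw [h5]
      exact Finset.single_le_sum (f := fun b => (K * Kᵀ) a b ^ 2) (fun _ _ => sq_nonneg _)
        (Finset.mem_univ a)
    rw [hs]
    nlinarith
  have hVe : ∀ a j, (Γᵀ * V) a j = if a = Fin.castLE hp j then 1 else 0 := by
    intro a j
    have : (Γᵀ * V) a j = (Γᵀ * Γ) a (Fin.castLE hp j) := by
      rw [hVΓ]; simp [Matrix.mul_apply]
    rw [this, h1, Matrix.one_apply]
  have hV1 : ∀ a : Fin p, (a : ℕ) < r → ∑ j, (Γᵀ * V) a j ^ 2 = 1 := by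
    intro a ha
    rw [Finset.sum_eq_single ⟨a, ha⟩]
    · rw [hVe]; simp
    · intro b _ hb
      rw [hVe, if_neg]
      · simp
      · intro hab; apply hb; subst hab; rfl
    · simp
  have hV0 : ∀ a : Fin p, r ≤ (a : ℕ) → ∑ j, (Γᵀ * V) a j ^ 2 = 0 := by
    intro a ha
    refine Finset.sum_eq_zero fun b _ => ?_
    rw [hVe, if_neg]
    · simp
    · intro hab
      have := b.2
      rw [Fin.ext_iff] at hab
      simp at hab
      omega
  -- The r-th smallest eigenvalue, which exists since r > 0. Below it V has full weight 1, above it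
  -- weight 0, so both factors in each term of `key` have the same sign; as the weights of H and V
  -- have equal sums, c cancels.
  set c := lam (Fin.castLE hp ⟨r - 1, by omega⟩)
  have key : 0 ≤ ∑ a, (lam a - c) * (∑ j, (Γᵀ * H) a j ^ 2 - ∑ j, (Γᵀ * V) a j ^ 2) := by
    refine Finset.sum_nonneg fun a _ => ?_
    rcases lt_or_ge (a : ℕ) r with ha | ha
    · apply mul_nonneg_of_nonpos_of_nonpos
      · have : lam a ≤ c := h3 (by rw [Fin.le_def]; simp; omega)
        linarith
      · rw [hV1 a ha]; linarith [hle a]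
    · apply mul_nonneg
      · have : c ≤ lam a := h3 (by rw [Fin.le_def]; simp; omega)
        linarith
      · rw [hV0 a ha, sub_zero]; positivity
  have e : ∑ a, (lam a - c) * (∑ j, (Γᵀ * H) a j ^ 2 - ∑ j, (Γᵀ * V) a j ^ 2) =
      (∑ a, lam a * ∑ j, (Γᵀ * H) a j ^ 2 - ∑ a, lam a * ∑ j, (Γᵀ * V) a j ^ 2) -
      c * (∑ a, ∑ j, (Γᵀ * H) a j ^ 2 - ∑ a, ∑ j, (Γᵀ * V) a j ^ 2) := by
    rw [← Finset.sum_sub_distrib, ← Finset.sum_sub_distrib, Finset.mul_sum,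
      ← Finset.sum_sub_distrib]
    exact Finset.sum_congr rfl fun a _ => by ring
  rw [e, hsum H hH, hsum V hV] at key
  linarith

/-- Extremal eigenspaces are Lipschitz at a matrix whose quadratic form has linear curvature at the
extremal projector. -/
lemma IsBottomEigenvectors.norm_projector_sub_le {M N : Matrix (Fin p) (Fin p) ℝ}
    {H V : Matrix (Fin p) (Fin r) ℝ} {δ : ℝ} (hδ : 0 < δ) (hH : IsBottomEigenvectors N H)
    (hV : HalfOrthonormal V)
    (hgap : δ * (r - (V * Vᵀ * (H * Hᵀ)).trace) ≤ (Hᵀ * M * H).trace - (Vᵀ * M * V).trace) :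
    ‖H * Hᵀ - V * Vᵀ‖ ≤ 2 / δ * ‖N - M‖ := by
  have hHo := hH.halfOrthonormal
  have h1 := hHo.norm_projector_sub_sq hV
  have h2 := hH.trace_le hV
  have cyc : ∀ (K : Matrix (Fin p) (Fin r) ℝ) (X : Matrix (Fin p) (Fin p) ℝ),
      (Kᵀ * X * K).trace = (X * (K * Kᵀ)).trace := by
    intro K X
    rw [Matrix.trace_mul_comm, ← Matrix.mul_assoc, Matrix.trace_mul_comm]
  have h3 := trace_mul_le_frobenius (M - N) (H * Hᵀ - V * Vᵀ)
  rw [norm_sub_rev M N] at h3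
  simp only [cyc] at hgap h2
  simp only [Matrix.mul_sub, Matrix.sub_mul, Matrix.trace_sub] at h3
  set d := ‖H * Hᵀ - V * Vᵀ‖
  -- By the gap, δd²/2 is at most tr(M(HH' - VV')). Optimality of H for N makes tr(N(HH' - VV'))
  -- nonpositive, so M may be replaced by M - N, and Cauchy–Schwarz applies.
  have h4 : δ / 2 * d ^ 2 ≤ ‖N - M‖ * d := by rw [h1]; linarith
  rcases (norm_nonneg (H * Hᵀ - V * Vᵀ)).eq_or_lt with h0 | h0
  · change 0 = d at h0
    rw [← h0]; positivity
  · change 0 < d at h0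
    have h5 : δ / 2 * d ≤ ‖N - M‖ := by
      have : (δ / 2 * d) * d ≤ ‖N - M‖ * d := by linarith [h4, sq d, mul_assoc (δ/2) d d]
      exact le_of_mul_le_mul_right this h0
    rw [div_mul_eq_mul_div, le_div_iff₀ hδ]
    linarith

lemma isUnit_of_rank_eq {N : Matrix (Fin r) (Fin r) ℝ} (h : r ≤ N.rank) : IsUnit N := by
  rw [← Matrix.mulVec_surjective_iff_isUnit]
  have h1 : N.rank = r := le_antisymm (by simpa using N.rank_le_width) h
  have : LinearMap.range N.mulVecLin = ⊤ := by
    apply Submodule.eq_top_of_finrank_eq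
    rw [Module.finrank_fin_fun]
    exact h1
  exact LinearMap.range_eq_top.1 this

/-- The quadratic form of a Gram matrix `T T'` of rank `r` dominates that of the projector onto the
complement of its kernel. -/
lemma exists_gap {ι : Type*} [Fintype ι] {T : Matrix (Fin p) ι ℝ} {A : Matrix (Fin p) (Fin r) ℝ}
    {B : Matrix (Fin p) (Fin v) ℝ} (hTB : T * Tᵀ * B = 0)
    (hAB : A * Aᵀ + B * Bᵀ = 1) (hrank : (T * Tᵀ).rank = r) :
    ∃ δ : ℝ, 0 < δ ∧ ∀ (q : ℕ) (K : Matrix (Fin p) (Fin q) ℝ),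
      δ * (Kᵀ * (A * Aᵀ) * K).trace ≤ (Kᵀ * (T * Tᵀ) * K).trace := by
  -- The squared norm of T'B is the trace of B'TT'B, which vanishes.
  have hB : Tᵀ * B = 0 := by
    rw [← norm_eq_zero, ← sq_eq_zero_iff, frobenius_norm_sq_eq_trace, Matrix.transpose_mul,
      Matrix.transpose_transpose, Matrix.mul_assoc, ← Matrix.mul_assoc T, hTB]
    simp
  have hT : Tᵀ = Tᵀ * A * Aᵀ := by
    have : Tᵀ = Tᵀ * (A * Aᵀ + B * Bᵀ) := by rw [hAB, Matrix.mul_one]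
    rw [Matrix.mul_add, ← Matrix.mul_assoc, ← Matrix.mul_assoc, hB, Matrix.zero_mul,
      add_zero] at this
    exact this
  -- Since T' only sees the component along A, TT' = ANA'; the rank hypothesis then forces the r × r
  -- matrix N to be invertible.
  set N := (Tᵀ * A)ᵀ * (Tᵀ * A) with hN
  have hNu : IsUnit N := by
    apply isUnit_of_rank_eq
    have : T * Tᵀ = A * N * Aᵀ := by
      conv_lhs => rw [← Matrix.transpose_transpose T, Matrix.transpose_transpose Tᵀ, hT]
      simp only [hN, Matrix.transpose_mul, Matrix.transpose_transpose, Matrix.mul_assoc]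
    refine hrank.symm.le.trans ?_
    rw [this]
    exact (Matrix.rank_mul_le_left _ _).trans (Matrix.rank_mul_le_right _ _)
  have hdet : IsUnit N.det := (Matrix.isUnit_iff_isUnit_det N).1 hNu
  set J := N⁻¹ * (Tᵀ * A)ᵀ
  -- J is a left inverse of T'A, so A'K = J(T'K) and the norm of J controls the gap. Adding 1 avoids
  -- a division by zero.
  refine ⟨1 / (‖J‖ ^ 2 + 1), by positivity, fun q K => ?_⟩
  have e1 : (Kᵀ * (A * Aᵀ) * K).trace = ‖Aᵀ * K‖ ^ 2 := by
    rw [frobenius_norm_sq_eq_trace]; simp [Matrix.mul_assoc]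
  have e2 : (Kᵀ * (T * Tᵀ) * K).trace = ‖Tᵀ * K‖ ^ 2 := by
    rw [frobenius_norm_sq_eq_trace]; simp [Matrix.mul_assoc]
  have e3 : Aᵀ * K = J * (Tᵀ * K) := by
    have : J * (Tᵀ * K) = N⁻¹ * N * (Aᵀ * K) := by
      conv_lhs => rw [hT]
      simp only [J, hN, Matrix.mul_assoc]
    rw [this, Matrix.nonsing_inv_mul _ hdet, Matrix.one_mul]
  have h1 : ‖Aᵀ * K‖ ≤ ‖J‖ * ‖Tᵀ * K‖ := by rw [e3]; exact Matrix.frobenius_norm_mul _ _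
  have h2 : ‖Aᵀ * K‖ ^ 2 ≤ (‖J‖ ^ 2 + 1) * ‖Tᵀ * K‖ ^ 2 := by
    calc ‖Aᵀ * K‖ ^ 2 ≤ (‖J‖ * ‖Tᵀ * K‖) ^ 2 := by gcongr
      _ ≤ _ := by rw [mul_pow]; gcongr; linarith
  rw [e1, e2, div_mul_eq_mul_div, one_mul, div_le_iff₀ (by positivity)]
  linarith

/-! ### Eigenprojectors of perturbations of a matrix with a gap -/

section Gap

variable {N M : Matrix (Fin p) (Fin p) ℝ} {A : Matrix (Fin p) (Fin r) ℝ}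
  {B : Matrix (Fin p) (Fin v) ℝ} {δ : ℝ}

/-- Testing the gap on K = H, with AA' = 1 - BB' and tr(B'MB) = 0, gives precisely the curvature
required at B. -/
lemma IsBottomEigenvectors.norm_projector_sub_le_of_gap (hδ : 0 < δ) (hMB : M * B = 0)
    (hAB : A * Aᵀ + B * Bᵀ = 1) (hB : HalfOrthonormal B)
    (hgap : ∀ (q : ℕ) (K : Matrix (Fin p) (Fin q) ℝ),
      δ * (Kᵀ * (A * Aᵀ) * K).trace ≤ (Kᵀ * M * K).trace)
    {H : Matrix (Fin p) (Fin v) ℝ} (hH : IsBottomEigenvectors N H) :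
    ‖H * Hᵀ - B * Bᵀ‖ ≤ 2 / δ * ‖N - M‖ := by
  apply hH.norm_projector_sub_le hδ hB
  have h := hgap v H
  have hHo : Hᵀ * H = 1 := hH.halfOrthonormal
  have e : (Bᵀ * M * B).trace = 0 := by rw [Matrix.mul_assoc, hMB]; simp
  have hA : A * Aᵀ = 1 - B * Bᵀ := by rw [← hAB]; abel
  rw [hA, Matrix.mul_sub, Matrix.sub_mul, Matrix.mul_one, hHo, Matrix.trace_sub,
    Matrix.mul_assoc Hᵀ, Matrix.trace_mul_comm Hᵀ, Matrix.mul_assoc (B * Bᵀ)] at h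
  simp only [Matrix.trace_one, Fintype.card_fin] at h
  rw [e, sub_zero]
  exact h

lemma IsTopEigenvectors.norm_projector_sub_le_of_gap (hδ : 0 < δ) (hMB : M * B = 0)
    (hAB : A * Aᵀ + B * Bᵀ = 1) (hA : HalfOrthonormal A)
    (hgap : ∀ (q : ℕ) (K : Matrix (Fin p) (Fin q) ℝ),
      δ * (Kᵀ * (A * Aᵀ) * K).trace ≤ (Kᵀ * M * K).trace)
    {H : Matrix (Fin p) (Fin r) ℝ} (hH : IsTopEigenvectors N H) :
    ‖H * Hᵀ - A * Aᵀ‖ ≤ 2 / δ * ‖N - M‖ := by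
  have hHn := hH.neg
  have hHo : Hᵀ * H = 1 := hHn.halfOrthonormal
  have hAo : Aᵀ * A = 1 := hA
  have := hHn.norm_projector_sub_le (M := -M) hδ hA ?_
  · rwa [← neg_sub', norm_neg] at this
  -- Testing the gap on the complementary projector produces r - tr(AA'HH') on the left and tr M -
  -- tr(MHH') on the right; MB = 0 makes tr M equal to tr(MAA').
  have h := hgap p (1 - H * Hᵀ)
  have hK : (1 - H * Hᵀ) * (1 - H * Hᵀ)ᵀ = 1 - H * Hᵀ := by
    have : H * Hᵀ * (H * Hᵀ) = H * Hᵀ := by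
      rw [Matrix.mul_assoc, ← Matrix.mul_assoc Hᵀ, hHo, Matrix.one_mul]
    simp [Matrix.sub_mul, Matrix.mul_sub, this]
  have cyc : ∀ X : Matrix (Fin p) (Fin p) ℝ,
      ((1 - H * Hᵀ)ᵀ * X * (1 - H * Hᵀ)).trace = X.trace - (X * (H * Hᵀ)).trace := by
    intro X
    rw [Matrix.trace_mul_comm, ← Matrix.mul_assoc, hK, Matrix.trace_mul_comm, Matrix.mul_sub,
      Matrix.mul_one, Matrix.trace_sub]
  have cyc' : ∀ (K : Matrix (Fin p) (Fin r) ℝ) (X : Matrix (Fin p) (Fin p) ℝ),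
      (Kᵀ * X * K).trace = (X * (K * Kᵀ)).trace := by
    intro K X
    rw [Matrix.trace_mul_comm, ← Matrix.mul_assoc, Matrix.trace_mul_comm]
  have e1 : (A * Aᵀ).trace = r := by rw [Matrix.trace_mul_comm, hAo]; simp
  have e2 : (M * (A * Aᵀ)).trace = M.trace := by
    have : A * Aᵀ = 1 - B * Bᵀ := by rw [← hAB]; abel
    rw [this, Matrix.mul_sub, ← Matrix.mul_assoc M B, hMB]
    simp
  rw [cyc, cyc, e1] at h
  rw [cyc', cyc', Matrix.neg_mul, Matrix.neg_mul, Matrix.trace_neg, Matrix.trace_neg, e2]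
  linarith

end Gap

end Eigenvectors

/-! ### Oblique projectors -/

section Oblique

variable {p r v : ℕ}

/-- The oblique projector `A (B' A)⁻¹ B'` in terms of the orthogonal projectors. -/
lemma oblique_eq {A B : Matrix (Fin p) (Fin r) ℝ} (hA : HalfOrthonormal A)
    (hT : IsUnit (A * Aᵀ * (B * Bᵀ) * (A * Aᵀ) + (1 - A * Aᵀ))) :
    A * ((Bᵀ * A)⁻¹ * Bᵀ) =
      (A * Aᵀ * (B * Bᵀ) * (A * Aᵀ) + (1 - A * Aᵀ))⁻¹ * (A * Aᵀ * (B * Bᵀ)) := by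
  have hAo : Aᵀ * A = 1 := hA
  set T := A * Aᵀ * (B * Bᵀ) * (A * Aᵀ) + (1 - A * Aᵀ) with hTdef
  have hTA : T * A = A * Aᵀ * B * (Bᵀ * A) := by
    simp only [hTdef, Matrix.add_mul, Matrix.sub_mul, Matrix.mul_assoc, hAo, Matrix.mul_one,
      Matrix.one_mul, sub_self, add_zero]
  -- TA factors through B'A and A is injective, so invertibility of T passes to B'A. The inverse in
  -- the recovered factor is then a genuine one.
  have hinj : IsUnit (Bᵀ * A) := by
    rw [← Matrix.mulVec_injective_iff_isUnit]
    intro x y hxy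
    have h1 : T *ᵥ (A *ᵥ x) = T *ᵥ (A *ᵥ y) := by
      simp only [Matrix.mulVec_mulVec, hTA]
      simp only [← Matrix.mulVec_mulVec] at hxy ⊢
      rw [hxy]
    have h2 := Matrix.mulVec_injective_iff_isUnit.2 hT h1
    have h3 := congrArg (fun z => Aᵀ *ᵥ z) h2
    simpa [Matrix.mulVec_mulVec, hAo] using h3
  have hd := (Matrix.isUnit_iff_isUnit_det _).1 hinj
  have hTd := (Matrix.isUnit_iff_isUnit_det _).1 hT
  have hE : T * (A * ((Bᵀ * A)⁻¹ * Bᵀ)) = A * Aᵀ * (B * Bᵀ) := by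
    rw [← Matrix.mul_assoc, hTA, ← Matrix.mul_assoc, Matrix.mul_assoc _ (Bᵀ * A) (Bᵀ * A)⁻¹,
      Matrix.mul_nonsing_inv _ hd, Matrix.mul_one, Matrix.mul_assoc _ B]
  rw [← hE, ← Matrix.mul_assoc _ T, Matrix.nonsing_inv_mul _ hTd, Matrix.one_mul]

/-- With N = (B'A)'(B'A), the matrix is ANA' + (1 - AA'): it acts as N on the range of A and as the
identity on the orthogonal complement. Its inverse is obtained by replacing N by N⁻¹. -/
lemma isUnit_oblique {A B : Matrix (Fin p) (Fin r) ℝ} (hA : HalfOrthonormal A)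
    (hBA : IsUnit (Bᵀ * A)) : IsUnit (A * Aᵀ * (B * Bᵀ) * (A * Aᵀ) + (1 - A * Aᵀ)) := by
  have hAo : Aᵀ * A = 1 := hA
  have hN : IsUnit ((Bᵀ * A)ᵀ * (Bᵀ * A)) := by
    refine IsUnit.mul ?_ hBA
    rw [Matrix.isUnit_iff_isUnit_det, Matrix.det_transpose, ← Matrix.isUnit_iff_isUnit_det]
    exact hBA
  set N := (Bᵀ * A)ᵀ * (Bᵀ * A) with hNdef
  have hd := (Matrix.isUnit_iff_isUnit_det _).1 hN
  have e : A * Aᵀ * (B * Bᵀ) * (A * Aᵀ) + (1 - A * Aᵀ) = A * N * Aᵀ + (1 - A * Aᵀ) := by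
    simp [hNdef, Matrix.mul_assoc]
  rw [e]
  refine .of_mul_eq_one (A * N⁻¹ * Aᵀ + (1 - A * Aᵀ)) ?_
  have key : ∀ X Y : Matrix (Fin r) (Fin r) ℝ, X * Y = 1 →
      (A * X * Aᵀ + (1 - A * Aᵀ)) * (A * Y * Aᵀ + (1 - A * Aᵀ)) = 1 := by
    intro X Y hXY
    have h1 : A * X * Aᵀ * (A * Y * Aᵀ) = A * Aᵀ := by
      calc _ = A * (X * ((Aᵀ * A) * Y)) * Aᵀ := by simp only [Matrix.mul_assoc]
        _ = _ := by rw [hAo, Matrix.one_mul, hXY, Matrix.mul_one]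
    have h2 : A * X * Aᵀ * (A * Aᵀ) = A * X * Aᵀ := by
      rw [Matrix.mul_assoc, ← Matrix.mul_assoc Aᵀ, hAo, Matrix.one_mul]
    have h3 : A * Aᵀ * (A * Y * Aᵀ) = A * Y * Aᵀ := by
      calc _ = A * ((Aᵀ * A) * Y) * Aᵀ := by simp only [Matrix.mul_assoc]
        _ = _ := by rw [hAo, Matrix.one_mul]
    have h4 : A * Aᵀ * (A * Aᵀ) = A * Aᵀ := by
      rw [Matrix.mul_assoc, ← Matrix.mul_assoc Aᵀ, hAo, Matrix.one_mul]
    simp only [Matrix.add_mul, Matrix.mul_add, Matrix.sub_mul, Matrix.mul_sub, Matrix.mul_one,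
      Matrix.one_mul, h1, h2, h3, h4]
    abel
  exact key _ _ (Matrix.mul_nonsing_inv _ hd)

end Oblique

end MatrixFactor

namespace MatrixFactor

open scoped Matrix Kronecker Matrix.Norms.Frobenius

/-! ### First-order closeness of matrix-valued families -/

section IsClose

open Filter Asymptotics Topology

variable {T : Type*} {k l m n : Type*} [Fintype k] [Fintype l] [Fintype m] [Fintype n]
  {F : Filter T} {e : T → ℝ}

/-- Rates of convergence are preserved by bilinear maps. -/
lemma isBigO_bilin_sub {E₁ E₂ E₃ : Type*} [NormedAddCommGroup E₁] [NormedAddCommGroup E₂]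
    [NormedAddCommGroup E₃] [Module ℝ E₁] [Module ℝ E₂] [Module ℝ E₃] (he : Tendsto e F (𝓝 0))
    (f : E₁ →ₗ[ℝ] E₂ →ₗ[ℝ] E₃) (hf : ∀ X Y, ‖f X Y‖ ≤ ‖X‖ * ‖Y‖)
    {X : T → E₁} {X₀ : E₁} {Y : T → E₂} {Y₀ : E₂}
    (hX : (fun t => X t - X₀) =O[F] e) (hY : (fun t => Y t - Y₀) =O[F] e) :
    (fun t => f (X t) (Y t) - f X₀ Y₀) =O[F] e := by
  -- The second-order term: one factor carries the rate, the other is bounded because e tends to 0.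
  have h1 : (fun t => f (X t - X₀) (Y t - Y₀)) =O[F] e := by
    have a : (fun t => f (X t - X₀) (Y t - Y₀)) =O[F] fun t => ‖X t - X₀‖ * ‖Y t - Y₀‖ :=
      IsBigO.of_bound 1 (Eventually.of_forall fun t => by
        simpa only [norm_mul, norm_norm, one_mul] using hf _ _)
    have b : (fun t => ‖X t - X₀‖ * ‖Y t - Y₀‖) =O[F] fun t => e t * 1 :=
      hX.norm_left.mul (hY.norm_left.trans (he.isBigO_one ℝ))
    simpa using a.trans b
  have h2 : (fun t => f (X t - X₀) Y₀) =O[F] e :=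
    (IsBigO.of_bound ‖Y₀‖ (Eventually.of_forall fun t => by
      rw [mul_comm]; exact hf _ _)).trans hX
  have h3 : (fun t => f X₀ (Y t - Y₀)) =O[F] e :=
    (IsBigO.of_bound ‖X₀‖ (Eventually.of_forall fun t => hf _ _)).trans hY
  refine ((h1.add h2).add h3).congr_left fun t => ?_
  simp only [map_sub, LinearMap.sub_apply]
  abel

/-- `X` converges to `X₀` along `F` at the rate `e`. -/
def IsClose (F : Filter T) (e : T → ℝ) (X : T → Matrix m n ℝ) (X₀ : Matrix m n ℝ) : Prop :=
  (fun t => X t - X₀) =O[F] e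

namespace IsClose

lemma const (X₀ : Matrix m n ℝ) : IsClose F e (fun _ => X₀) X₀ := by
  simpa [IsClose] using isBigO_zero e F

lemma of_norm_le {X : T → Matrix m n ℝ} {X₀ : Matrix m n ℝ} (C : ℝ)
    (h : ∀ t, ‖X t - X₀‖ ≤ C * ‖e t‖) : IsClose F e X X₀ :=
  IsBigO.of_bound C (Eventually.of_forall h)

lemma of_norm_sub_le {X : T → Matrix m n ℝ} {X₀ : Matrix m n ℝ} {Y : T → Matrix k l ℝ}
    {Y₀ : Matrix k l ℝ} (hY : IsClose F e Y Y₀) (C : ℝ) (h : ∀ t, ‖X t - X₀‖ ≤ C * ‖Y t - Y₀‖) :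
    IsClose F e X X₀ :=
  (IsBigO.of_bound C (Eventually.of_forall h)).trans hY

lemma add {X Y : T → Matrix m n ℝ} {X₀ Y₀ : Matrix m n ℝ} (hX : IsClose F e X X₀)
    (hY : IsClose F e Y Y₀) : IsClose F e (fun t => X t + Y t) (X₀ + Y₀) := by
  refine (IsBigO.add hX hY).congr_left fun t => ?_
  exact (add_sub_add_comm _ _ _ _).symm

lemma sub {X Y : T → Matrix m n ℝ} {X₀ Y₀ : Matrix m n ℝ} (hX : IsClose F e X X₀)
    (hY : IsClose F e Y Y₀) : IsClose F e (fun t => X t - Y t) (X₀ - Y₀) := by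
  refine (IsBigO.sub hX hY).congr_left fun t => ?_
  exact (sub_sub_sub_comm _ _ _ _).symm

lemma sum {ι : Type*} {s : Finset ι} {X : ι → T → Matrix m n ℝ} {X₀ : ι → Matrix m n ℝ}
    (h : ∀ i ∈ s, IsClose F e (X i) (X₀ i)) :
    IsClose F e (fun t => ∑ i ∈ s, X i t) (∑ i ∈ s, X₀ i) := by
  refine (IsBigO.sum h).congr_left fun t => ?_
  simp

lemma transpose {X : T → Matrix m n ℝ} {X₀ : Matrix m n ℝ} (hX : IsClose F e X X₀) :
    IsClose F e (fun t => (X t)ᵀ) X₀ᵀ :=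
  hX.of_norm_sub_le 1 fun t => by
    rw [← Matrix.transpose_sub, Matrix.frobenius_norm_transpose, one_mul]

lemma tendsto {X : T → Matrix m n ℝ} {X₀ : Matrix m n ℝ} (he : Tendsto e F (𝓝 0))
    (hX : IsClose F e X X₀) : Tendsto (fun t => X t - X₀) F (𝓝 0) :=
  IsBigO.trans_tendsto hX he

lemma mul (he : Tendsto e F (𝓝 0)) {X : T → Matrix l m ℝ} {X₀ : Matrix l m ℝ}
    {Y : T → Matrix m n ℝ} {Y₀ : Matrix m n ℝ}
    (hX : IsClose F e X X₀) (hY : IsClose F e Y Y₀) :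
    IsClose F e (fun t => X t * Y t) (X₀ * Y₀) :=
  isBigO_bilin_sub he (LinearMap.mk₂ ℝ (fun (X : Matrix l m ℝ) (Y : Matrix m n ℝ) => X * Y)
    Matrix.add_mul (fun _ _ _ => Matrix.smul_mul _ _ _) Matrix.mul_add
    (fun _ _ _ => Matrix.mul_smul _ _ _)) (fun X Y => Matrix.frobenius_norm_mul X Y) hX hY

lemma kronecker (he : Tendsto e F (𝓝 0)) {X : T → Matrix k l ℝ} {X₀ : Matrix k l ℝ}
    {Y : T → Matrix m n ℝ} {Y₀ : Matrix m n ℝ}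
    (hX : IsClose F e X X₀) (hY : IsClose F e Y Y₀) :
    IsClose F e (fun t => X t ⊗ₖ Y t) (X₀ ⊗ₖ Y₀) :=
  isBigO_bilin_sub he (LinearMap.mk₂ ℝ (fun (X : Matrix k l ℝ) (Y : Matrix m n ℝ) => X ⊗ₖ Y)
    Matrix.add_kronecker (fun _ _ _ => Matrix.smul_kronecker _ _ _) Matrix.kronecker_add
    (fun _ _ _ => Matrix.kronecker_smul _ _ _)) (fun X Y => (frobenius_norm_kronecker X Y).le) hX hY

lemma eventually_isUnit [DecidableEq m] (he : Tendsto e F (𝓝 0)) {X : T → Matrix m m ℝ}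
    {X₀ : Matrix m m ℝ} (hX : IsClose F e X X₀) (hu : IsUnit X₀) : ∀ᶠ t in F, IsUnit (X t) := by
  have h : Tendsto X F (𝓝 X₀) := by
    refine tendsto_sub_nhds_zero_iff.1 ?_
    exact hX.tendsto he
  exact h.eventually (Units.isOpen.mem_nhds hu)

/-- First-order expansion of inversion at a unit. Singular values of X cause no trouble:
`Ring.inverse` and the matrix inverse agree everywhere, and units form an open set. -/
lemma inv [DecidableEq m] (he : Tendsto e F (𝓝 0)) {X : T → Matrix m m ℝ}
    {X₀ : Matrix m m ℝ} (hX : IsClose F e X X₀) (hu : IsUnit X₀) :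
    IsClose F e (fun t => (X t)⁻¹) X₀⁻¹ := by
  obtain ⟨u, rfl⟩ := hu
  have h := (NormedRing.inverse_add_norm_diff_first_order u).comp_tendsto (hX.tendsto he)
  refine (h.trans (IsBigO.norm_left hX)).congr_left fun t => ?_
  simp only [Function.comp_apply, add_sub_cancel, Matrix.nonsing_inv_eq_ringInverse,
    Ring.inverse_unit]

end IsClose

end IsClose

end MatrixFactor

namespace MatrixFactor

variable {Ω : Type*} [mΩ : MeasurableSpace Ω] {μ : Measure Ω}

/-! ### Covariance inequalities -/

section Covariance

/-- As X is m-measurable, Y may be replaced by g = E[Y | m]. Splitting by the sign of g, the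
integral of |g| is a difference of two integrals of Y over m-measurable sets, each at most a in
absolute value. -/
lemma abs_integral_mul_le_of_setIntegral_le {Ω : Type*} {m : MeasurableSpace Ω}
    [mΩ : MeasurableSpace Ω] {μ : Measure Ω} [IsProbabilityMeasure μ]
    (hm : m ≤ mΩ) {X Y : Ω → ℝ} {M a : ℝ} (hX : Measurable[m] X) (hXM : ∀ ω, |X ω| ≤ M)
    (hY : Integrable Y μ) (h : ∀ A, MeasurableSet[m] A → |∫ ω in A, Y ω ∂μ| ≤ a) :
    |∫ ω, X ω * Y ω ∂μ| ≤ 2 * M * a := by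
  have hM : 0 ≤ M := by
    obtain ⟨ω⟩ : Nonempty Ω := nonempty_of_isProbabilityMeasure μ
    exact (abs_nonneg _).trans (hXM ω)
  set g := μ[Y|m] with hg
  have hgm : StronglyMeasurable[m] g := stronglyMeasurable_condExp
  have hgi : Integrable g μ := integrable_condExp
  have hXs : StronglyMeasurable[m] X := hX.stronglyMeasurable
  have hXY : Integrable (X * Y) μ :=
    hY.bdd_mul (c := M) (hXs.mono hm).aestronglyMeasurable (Filter.Eventually.of_forall hXM)
  have e1 : ∫ ω, X ω * Y ω ∂μ = ∫ ω, X ω * g ω ∂μ := by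
    have h1 := condExp_mul_of_stronglyMeasurable_left hXs hXY hY
    have h2 := integral_condExp (μ := μ) (f := X * Y) hm
    rw [← integral_congr_ae h1.symm] at h2
    exact h2.symm
  set S := {ω | 0 ≤ g ω} with hS
  have hSm : MeasurableSet[m] S := hgm.measurable measurableSet_Ici
  have e2 : ∫ ω, |g ω| ∂μ = ∫ ω in S, Y ω ∂μ - ∫ ω in Sᶜ, Y ω ∂μ := by
    rw [← integral_add_compl (hm _ hSm) hgi.abs, ← setIntegral_condExp hm hY hSm,
      ← setIntegral_condExp hm hY hSm.compl, sub_eq_add_neg, ← integral_neg]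
    congr 1
    · exact setIntegral_congr_fun (hm _ hSm) fun ω hω => abs_of_nonneg hω
    · exact setIntegral_congr_fun (hm _ hSm.compl) fun ω hω =>
        abs_of_neg (not_le.1 hω)
  calc |∫ ω, X ω * Y ω ∂μ| = |∫ ω, X ω * g ω ∂μ| := by rw [e1]
    _ ≤ ∫ ω, |X ω * g ω| ∂μ := abs_integral_le_integral_abs
    _ ≤ ∫ ω, M * |g ω| ∂μ := by
        refine integral_mono_of_nonneg (Filter.Eventually.of_forall fun ω => abs_nonneg _)
          (hgi.abs.const_mul M) (Filter.Eventually.of_forall fun ω => ?_)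
        simp only [abs_mul]
        exact mul_le_mul_of_nonneg_right (hXM ω) (abs_nonneg _)
    _ = M * ∫ ω, |g ω| ∂μ := integral_const_mul _ _
    _ ≤ M * (2 * a) := by
        refine mul_le_mul_of_nonneg_left ?_ hM
        rw [e2]
        have h1 := h S hSm
        have h2 := h Sᶜ hSm.compl
        rw [abs_le] at h1 h2
        linarith [h1.2, h2.1]
    _ = 2 * M * a := by ring

/-- The covariance inequality for bounded variables and events that are almost independent. -/
lemma abs_covariance_le_of_bounded {Ω : Type*} {m₁ m₂ : MeasurableSpace Ω}
    [mΩ : MeasurableSpace Ω] {μ : Measure Ω} [IsProbabilityMeasure μ]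
    (h₁ : m₁ ≤ mΩ) (h₂ : m₂ ≤ mΩ) {α : ℝ}
    (hα : ∀ A B, MeasurableSet[m₁] A → MeasurableSet[m₂] B →
      |μ.real (A ∩ B) - μ.real A * μ.real B| ≤ α)
    {X Y : Ω → ℝ} {M : ℝ} (hX : Measurable[m₁] X) (hY : Measurable[m₂] Y)
    (hXM : ∀ ω, |X ω| ≤ M) (hYM : ∀ ω, |Y ω| ≤ M) :
    |cov[X, Y; μ]| ≤ 4 * M ^ 2 * α := by
  have bdd : ∀ {Z : Ω → ℝ} {m : MeasurableSpace Ω}, m ≤ mΩ → Measurable[m] Z →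
      (∀ ω, |Z ω| ≤ M) → Integrable Z μ := fun hm hZ hZM =>
    Integrable.of_bound (hZ.mono hm le_rfl).aestronglyMeasurable M
      (Filter.Eventually.of_forall hZM)
  have hXi := bdd h₁ hX hXM
  have hYi := bdd h₂ hY hYM
  have hXm : Measurable X := hX.mono h₁ le_rfl
  -- The integral bound is used twice: here for Y against the centered indicator of a fixed A, and
  -- at the end for X against the centered Y. Each use costs a factor 2M.
  have step : ∀ A, MeasurableSet[m₁] A → |∫ ω in A, (Y ω - ∫ x, Y x ∂μ) ∂μ| ≤ 2 * M * α := by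
    intro A hA
    have hAm := h₁ _ hA
    have hZ : Integrable (fun ω => A.indicator (fun _ => (1 : ℝ)) ω - μ.real A) μ :=
      ((integrable_const (1 : ℝ)).indicator hAm).sub (integrable_const _)
    have key := abs_integral_mul_le_of_setIntegral_le h₂ (a := α) hY hYM hZ (by
      intro B hB
      have hBm := h₂ _ hB
      rw [integral_sub ((integrable_const (1 : ℝ)).indicator hAm).integrableOn
        (integrable_const _).integrableOn, setIntegral_indicator hAm, setIntegral_const,
        setIntegral_const, Set.inter_comm B A]
      have := hα A B hA hB
      simpa [mul_comm] using this)
    have e : ∫ ω, Y ω * (A.indicator (fun _ => (1 : ℝ)) ω - μ.real A) ∂μ =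
        ∫ ω in A, (Y ω - ∫ x, Y x ∂μ) ∂μ := by
      have hYA : (fun ω => Y ω * A.indicator (fun _ => (1 : ℝ)) ω) = A.indicator Y := by
        ext ω; by_cases hω : ω ∈ A <;> simp [hω]
      simp only [mul_sub]
      rw [integral_sub (by rw [hYA]; exact hYi.indicator hAm) (hYi.mul_const _), hYA,
        integral_indicator hAm, integral_mul_const,
        integral_sub hYi.integrableOn (integrable_const _).integrableOn, setIntegral_const]
      simp [mul_comm]
    rwa [e] at key
  have e : cov[X, Y; μ] = ∫ ω, X ω * (Y ω - ∫ x, Y x ∂μ) ∂μ := by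
    have hYc : Integrable (fun ω => Y ω - ∫ x, Y x ∂μ) μ := hYi.sub (integrable_const _)
    have h0 : ∫ ω, (Y ω - ∫ x, Y x ∂μ) ∂μ = 0 := by
      rw [integral_sub hYi (integrable_const _)]; simp
    unfold covariance
    simp only [sub_mul (X _)]
    rw [integral_sub _ (hYc.const_mul _), integral_const_mul, h0, mul_zero, sub_zero]
    exact hYc.bdd_mul (c := M) hXm.aestronglyMeasurable (Filter.Eventually.of_forall hXM)
  rw [e]
  have := abs_integral_mul_le_of_setIntegral_le h₁ hX hXM (hYi.sub (integrable_const _)) step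
  calc _ ≤ 2 * M * (2 * M * α) := this
    _ = _ := by ring

/-- If truncation changes anything, the larger of the two moduli, say |u|, exceeds M, and |xy| ≤
|u|² = |u|^{2-γ}|u|^γ ≤ M^{2-γ}|u|^γ because γ > 2. -/
lemma abs_mul_sub_truncate_mul_truncate_le {γ M : ℝ} (hγ : 2 < γ) (hM : 1 ≤ M) (x y : ℝ) :
    |x * y - (if |x| ≤ M then x else 0) * (if |y| ≤ M then y else 0)| ≤
      M ^ (2 - γ) * (|x| ^ γ + |y| ^ γ) := by
  have hM0 : 0 < M := by linarith
  have big : ∀ u v : ℝ, M < |u| → |v| ≤ |u| → |u| * |v| ≤ M ^ (2 - γ) * (|u| ^ γ + |v| ^ γ) := by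
    intro u v hu hv
    have hu0 : 0 < |u| := hM0.trans hu
    have h1 : |u| ^ (2 - γ) ≤ M ^ (2 - γ) :=
      Real.rpow_le_rpow_of_nonpos hM0 hu.le (by linarith)
    calc |u| * |v| ≤ |u| ^ (2 : ℝ) := by
          rw [Real.rpow_two, pow_two]; gcongr
      _ = |u| ^ (2 - γ) * |u| ^ γ := by rw [← Real.rpow_add hu0]; ring_nf
      _ ≤ M ^ (2 - γ) * |u| ^ γ := by gcongr
      _ ≤ _ := by gcongr; linarith [Real.rpow_nonneg (abs_nonneg v) γ]
  have gen : M < |x| ∨ M < |y| → |x| * |y| ≤ M ^ (2 - γ) * (|x| ^ γ + |y| ^ γ) := by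
    intro h
    rcases le_total |y| |x| with hxy | hxy
    · exact big x y (by rcases h with h | h <;> linarith) hxy
    · rw [mul_comm |x|, add_comm (|x| ^ γ)]
      exact big y x (by rcases h with h | h <;> linarith) hxy
  by_cases hx : |x| ≤ M <;> by_cases hy : |y| ≤ M
  · simp only [hx, hy, if_true, sub_self, abs_zero]
    positivity
  · simpa [hx, hy, abs_mul] using gen (Or.inr (not_le.1 hy))
  · simpa [hx, hy, abs_mul] using gen (Or.inl (not_le.1 hx))
  · simpa [hx, hy, abs_mul] using gen (Or.inl (not_le.1 hx))

lemma abs_le_one_add_rpow {γ : ℝ} (hγ : 1 ≤ γ) (x : ℝ) : |x| ≤ 1 + |x| ^ γ := by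
  rcases le_total |x| 1 with h | h
  · linarith [Real.rpow_nonneg (abs_nonneg x) γ]
  · have := Real.rpow_le_rpow_of_exponent_le h hγ
    rw [Real.rpow_one] at this
    linarith

/-- Davydov's covariance inequality. -/
lemma abs_covariance_le_rpow_of_pos {Ω : Type*} {m₁ m₂ : MeasurableSpace Ω}
    [mΩ : MeasurableSpace Ω] {μ : Measure Ω} [IsProbabilityMeasure μ]
    (h₁ : m₁ ≤ mΩ) (h₂ : m₂ ≤ mΩ) {α γ K : ℝ} (hγ : 2 < γ) (hα0 : 0 < α) (hα1 : α ≤ 1)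
    (hα : ∀ A B, MeasurableSet[m₁] A → MeasurableSet[m₂] B →
      |μ.real (A ∩ B) - μ.real A * μ.real B| ≤ α)
    {X Y : Ω → ℝ} (hX : Measurable[m₁] X) (hY : Measurable[m₂] Y)
    (hX2 : MemLp X 2 μ) (hY2 : MemLp Y 2 μ)
    (hXi : Integrable (fun ω => |X ω| ^ γ) μ) (hYi : Integrable (fun ω => |Y ω| ^ γ) μ)
    (hXK : ∫ ω, |X ω| ^ γ ∂μ ≤ K) (hYK : ∫ ω, |Y ω| ^ γ ∂μ ≤ K) :
    |cov[X, Y; μ]| ≤ (4 + 2 * K + 2 * (K + 1) ^ 2) * α ^ (1 - 2 / γ) := by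
  have hγ0 : 0 < γ := by linarith
  -- The truncation level that balances the bounded part, of order M²α, against the truncation
  -- error, of order M^{2-γ}: both equal α^{1-2/γ}.
  set M := α ^ (-(1 / γ)) with hMdef
  have hM1 : 1 ≤ M := Real.one_le_rpow_of_pos_of_le_one_of_nonpos hα0 hα1 (by
    have : 0 ≤ 1 / γ := by positivity
    linarith)
  have hM0 : 0 < M := by linarith
  have hMα : M ^ 2 * α = α ^ (1 - 2 / γ) := by
    rw [hMdef, ← Real.rpow_natCast, ← Real.rpow_mul hα0.le]
    nth_rewrite 2 [← Real.rpow_one α]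
    rw [← Real.rpow_add hα0]
    congr 1
    push_cast
    ring
  have hMγ : M ^ (2 - γ) = α ^ (1 - 2 / γ) := by
    rw [hMdef, ← Real.rpow_mul hα0.le]
    congr 1
    field_simp
    ring
  set θ := α ^ (1 - 2 / γ)
  have hθ : 0 < θ := Real.rpow_pos_of_pos hα0 _
  let tr : ℝ → ℝ := fun x => if |x| ≤ M then x else 0
  have htrm : Measurable tr :=
    Measurable.ite (measurableSet_le measurable_abs measurable_const) measurable_id
      measurable_const
  have htrM : ∀ x, |tr x| ≤ M := by
    intro x; by_cases h : |x| ≤ M <;> simp [tr, h, hM0.le]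
  have htrle : ∀ x, |tr x| ≤ |x| := by
    intro x; by_cases h : |x| ≤ M <;> simp [tr, h]
  have hK0 : 0 ≤ K := le_trans (integral_nonneg fun ω => by positivity) hXK
  have hXm : Measurable X := hX.mono h₁ le_rfl
  have hYm : Measurable Y := hY.mono h₂ le_rfl
  have hX1 : Integrable X μ := hX2.integrable (by norm_num)
  have hY1 : Integrable Y μ := hY2.integrable (by norm_num)
  have hXY : Integrable (fun ω => X ω * Y ω) μ := hX2.integrable_mul hY2
  have bdd : ∀ {Z : Ω → ℝ}, Measurable Z → MemLp (fun ω => tr (Z ω)) 2 μ := fun hZ =>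
    MemLp.of_bound (htrm.comp hZ).aestronglyMeasurable M
      (Filter.Eventually.of_forall fun ω => htrM _)
  have hXt := bdd hXm
  have hYt := bdd hYm
  have hXYt : Integrable (fun ω => tr (X ω) * tr (Y ω)) μ := hXt.integrable_mul hYt
  have hXt1 : Integrable (fun ω => tr (X ω)) μ := hXt.integrable (by norm_num)
  have hYt1 : Integrable (fun ω => tr (Y ω)) μ := hYt.integrable (by norm_num)
  have first : ∀ {Z : Ω → ℝ}, Integrable (fun ω => |Z ω| ^ γ) μ → ∫ ω, |Z ω| ^ γ ∂μ ≤ K →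
      ∫ ω, (1 + |Z ω| ^ γ) ∂μ ≤ 1 + K := by
    intro Z hZi hZK
    rw [integral_add (integrable_const _) hZi]
    simpa using hZK
  have mean : ∀ {Z Z' : Ω → ℝ}, Integrable (fun ω => |Z ω| ^ γ) μ → ∫ ω, |Z ω| ^ γ ∂μ ≤ K →
      (∀ ω, |Z' ω| ≤ |Z ω|) → |∫ ω, Z' ω ∂μ| ≤ 1 + K := by
    intro Z Z' hZi hZK hZ'
    refine abs_integral_le_integral_abs.trans (le_trans ?_ (first hZi hZK))
    exact integral_mono_of_nonneg (Filter.Eventually.of_forall fun ω => abs_nonneg _)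
      ((integrable_const _).add hZi)
      (Filter.Eventually.of_forall fun ω => (hZ' ω).trans
        (abs_le_one_add_rpow (by linarith) _))
  have meandiff : ∀ {Z : Ω → ℝ}, Integrable Z μ → Integrable (fun ω => tr (Z ω)) μ →
      Integrable (fun ω => |Z ω| ^ γ) μ →
      ∫ ω, |Z ω| ^ γ ∂μ ≤ K → |∫ ω, Z ω ∂μ - ∫ ω, tr (Z ω) ∂μ| ≤ θ * (1 + K) := by
    intro Z hZ hZt hZi hZK
    rw [← integral_sub hZ hZt]
    refine abs_integral_le_integral_abs.trans ?_
    calc ∫ ω, |Z ω - tr (Z ω)| ∂μ ≤ ∫ ω, θ * (1 + |Z ω| ^ γ) ∂μ := by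
          refine integral_mono_of_nonneg (Filter.Eventually.of_forall fun ω => abs_nonneg _)
            (((integrable_const _).add hZi).const_mul _) (Filter.Eventually.of_forall fun ω => ?_)
          -- The second variable is the constant 1, which truncation leaves unchanged because M ≥ 1.
          have := abs_mul_sub_truncate_mul_truncate_le hγ hM1 (Z ω) 1
          rw [hMγ] at this
          simpa [hM1, tr, add_comm] using this
      _ ≤ _ := by rw [integral_const_mul]; gcongr; exact first hZi hZK
  have c1 : |∫ ω, X ω * Y ω ∂μ - ∫ ω, tr (X ω) * tr (Y ω) ∂μ| ≤ θ * (2 * K) := by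
    rw [← integral_sub hXY hXYt]
    refine abs_integral_le_integral_abs.trans ?_
    calc ∫ ω, |X ω * Y ω - tr (X ω) * tr (Y ω)| ∂μ ≤ ∫ ω, θ * (|X ω| ^ γ + |Y ω| ^ γ) ∂μ := by
          refine integral_mono_of_nonneg (Filter.Eventually.of_forall fun ω => abs_nonneg _)
            ((hXi.add hYi).const_mul _) (Filter.Eventually.of_forall fun ω => ?_)
          have := abs_mul_sub_truncate_mul_truncate_le hγ hM1 (X ω) (Y ω)
          rw [hMγ] at this
          exact this
      _ ≤ _ := by rw [integral_const_mul, integral_add hXi hYi]; gcongr; linarith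
  have c2 : |cov[fun ω => tr (X ω), fun ω => tr (Y ω); μ]| ≤ 4 * θ := by
    have := abs_covariance_le_of_bounded (M := M) h₁ h₂ hα (htrm.comp hX) (htrm.comp hY)
      (fun ω => htrM _) (fun ω => htrM _)
    rw [mul_assoc, hMα] at this
    exact this
  rw [covariance_eq_sub hXt hYt] at c2
  rw [covariance_eq_sub hX2 hY2]
  simp only [Pi.mul_apply] at c2 ⊢
  have c3 := mean hYi hYK (Z' := Y) fun ω => le_rfl
  have c4 := mean hXi hXK (Z' := fun ω => tr (X ω)) fun ω => htrle _
  have c5 := meandiff hX1 hXt1 hXi hXK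
  have c6 := meandiff hY1 hYt1 hYi hYK
  set a := ∫ ω, X ω * Y ω ∂μ
  set a' := ∫ ω, tr (X ω) * tr (Y ω) ∂μ
  set b := ∫ ω, X ω ∂μ
  set b' := ∫ ω, tr (X ω) ∂μ
  set c := ∫ ω, Y ω ∂μ
  set c' := ∫ ω, tr (Y ω) ∂μ
  -- Truncation error of the product, covariance of the truncated variables, and truncation errors
  -- of the two means.
  have e : a - b * c = (a - a') + (a' - b' * c') - (b - b') * c - b' * (c - c') := by ring
  rw [e]
  have d1 : |(b - b') * c| ≤ θ * (1 + K) * (1 + K) := by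
    rw [abs_mul]; gcongr
  have d2 : |b' * (c - c')| ≤ (1 + K) * (θ * (1 + K)) := by
    rw [abs_mul]; gcongr
  calc _ ≤ |a - a'| + |a' - b' * c'| + |(b - b') * c| + |b' * (c - c')| := by
        refine (abs_sub _ _).trans ?_
        gcongr
        refine (abs_sub _ _).trans ?_
        gcongr
        exact abs_add_le _ _
    _ ≤ θ * (2 * K) + 4 * θ + θ * (1 + K) * (1 + K) + (1 + K) * (θ * (1 + K)) := by gcongr
    _ = _ := by ring

/-- For α = 0 the truncation level would be infinite. The hypothesis then holds for every small
positive α, and the bound passes to the limit since 1 - 2/γ > 0. -/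
lemma abs_covariance_le_rpow {Ω : Type*} {m₁ m₂ : MeasurableSpace Ω}
    [mΩ : MeasurableSpace Ω] {μ : Measure Ω} [IsProbabilityMeasure μ]
    (h₁ : m₁ ≤ mΩ) (h₂ : m₂ ≤ mΩ) {α γ K : ℝ} (hγ : 2 < γ) (hα0 : 0 ≤ α) (hα1 : α ≤ 1)
    (hα : ∀ A B, MeasurableSet[m₁] A → MeasurableSet[m₂] B →
      |μ.real (A ∩ B) - μ.real A * μ.real B| ≤ α)
    {X Y : Ω → ℝ} (hX : Measurable[m₁] X) (hY : Measurable[m₂] Y)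
    (hX2 : MemLp X 2 μ) (hY2 : MemLp Y 2 μ)
    (hXi : Integrable (fun ω => |X ω| ^ γ) μ) (hYi : Integrable (fun ω => |Y ω| ^ γ) μ)
    (hXK : ∫ ω, |X ω| ^ γ ∂μ ≤ K) (hYK : ∫ ω, |Y ω| ^ γ ∂μ ≤ K) :
    |cov[X, Y; μ]| ≤ (4 + 2 * K + 2 * (K + 1) ^ 2) * α ^ (1 - 2 / γ) := by
  have hθ : 0 < 1 - 2 / γ := by
    rw [sub_pos, div_lt_one (by linarith)]; exact hγ
  rcases hα0.eq_or_lt with rfl | h0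
  · have hlim : Filter.Tendsto (fun x : ℝ => (4 + 2 * K + 2 * (K + 1) ^ 2) * x ^ (1 - 2 / γ))
        (nhdsWithin 0 (Set.Ioi 0)) (nhds ((4 + 2 * K + 2 * (K + 1) ^ 2) * 0 ^ (1 - 2 / γ))) :=
      ((Real.continuousAt_rpow_const 0 _ (Or.inr hθ.le)).const_mul _).tendsto.mono_left
        nhdsWithin_le_nhds
    refine ge_of_tendsto hlim ?_
    filter_upwards [Ioo_mem_nhdsGT (zero_lt_one' ℝ)] with x hx
    exact abs_covariance_le_rpow_of_pos h₁ h₂ hγ hx.1 hx.2.le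
      (fun A B hA hB => (hα A B hA hB).trans hx.1.le) hX hY hX2 hY2 hXi hYi hXK hYK
  · exact abs_covariance_le_rpow_of_pos h₁ h₂ hγ h0 hα1 hα hX hY hX2 hY2 hXi hYi hXK hYK

end Covariance

end MatrixFactor

namespace MatrixFactor

variable {Ω : Type*} [mΩ : MeasurableSpace Ω] {μ : Measure Ω}

/-! ### Mixing -/

section Mixing

variable {E : Type*} [MeasurableSpace E] {V : ℤ → Ω → E}

lemma abs_measureReal_inter_sub_le_one [IsProbabilityMeasure μ] (A B : Set Ω) :
    |μ.real (A ∩ B) - μ.real A * μ.real B| ≤ 1 := by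
  have h1 : μ.real (A ∩ B) ≤ 1 := measureReal_le_one
  have h2 : 0 ≤ μ.real (A ∩ B) := measureReal_nonneg
  have h3 : μ.real A * μ.real B ≤ 1 :=
    mul_le_one₀ measureReal_le_one measureReal_nonneg measureReal_le_one
  have h4 : 0 ≤ μ.real A * μ.real B := mul_nonneg measureReal_nonneg measureReal_nonneg
  rw [abs_le]; constructor <;> linarith

lemma sigmaField_le (hV : ∀ t, Measurable (V t)) (S : Set ℤ) : sigmaField V S ≤ mΩ :=
  iSup₂_le fun t _ => (hV t).comap_le

lemma sigmaField_mono {Ω : Type*} {V : ℤ → Ω → E} {S S' : Set ℤ} (h : S ⊆ S') :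
    sigmaField V S ≤ sigmaField V S' :=
  biSup_mono fun _ ht => h ht

lemma mixingCoeff_nonneg (k : ℕ) : 0 ≤ mixingCoeff μ V k := by
  apply Real.sSup_nonneg
  rintro x ⟨i, A, B, -, -, rfl⟩
  exact abs_nonneg _

lemma mixingCoeff_le_one [IsProbabilityMeasure μ] (k : ℕ) : mixingCoeff μ V k ≤ 1 := by
  refine Real.sSup_le ?_ zero_le_one
  rintro x ⟨i, A, B, -, -, rfl⟩
  exact abs_measureReal_inter_sub_le_one A B

lemma abs_measureReal_inter_sub_le_mixingCoeff [IsProbabilityMeasure μ] {i : ℤ} {k : ℕ}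
    {A B : Set Ω} (hA : MeasurableSet[sigmaField V (Set.Iic i)] A)
    (hB : MeasurableSet[sigmaField V (Set.Ici (i + (k : ℤ)))] B) :
    |μ.real (A ∩ B) - μ.real A * μ.real B| ≤ mixingCoeff μ V k := by
  refine le_csSup ⟨1, ?_⟩ ⟨i, A, B, hA, hB, rfl⟩
  rintro x ⟨i, A, B, -, -, rfl⟩
  exact abs_measureReal_inter_sub_le_one A B

/-- The variance of a sum of finite-lag functionals of a mixing process grows at most linearly in
the number of terms. -/
lemma exists_variance_sum_le [IsProbabilityMeasure μ] (hV : ∀ t, Measurable (V t)) {γ K : ℝ}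
    (hγ : 2 < γ) (hmix : Summable fun k : ℕ => mixingCoeff μ V (k + 1) ^ (1 - 2 / γ))
    {U : ℤ → Ω → ℝ} (k : ℕ)
    (hU : ∀ t, Measurable[sigmaField V (Set.Icc (t - (k : ℤ)) t)] (U t))
    (hU2 : ∀ t, MemLp (U t) 2 μ) (hUi : ∀ t, Integrable (fun ω => |U t ω| ^ γ) μ)
    (hUK : ∀ t, ∫ ω, |U t ω| ^ γ ∂μ ≤ K) :
    ∃ C : ℝ, 0 ≤ C ∧ ∀ s : Finset ℕ,
      Var[fun ω => ∑ t ∈ s, U (t : ℤ) ω; μ] ≤ C * (s.card : ℝ) := by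
  have hK0 : 0 ≤ K := le_trans (integral_nonneg fun ω => by positivity) (hUK 0)
  set D := 4 + 2 * K + 2 * (K + 1) ^ 2 with hD
  have hD0 : 0 ≤ D := by positivity
  -- U_t depends on the window [t - k, t], so the windows of U_t and U_{t+m} are m - k apart.
  -- Overlapping windows get the trivial bound 1, which affects finitely many lags.
  let a : ℕ → ℝ := fun m => if m ≤ k then 1 else mixingCoeff μ V (m - k)
  have ha0 : ∀ m, 0 ≤ a m := by
    intro m; by_cases h : m ≤ k <;> simp [a, h, mixingCoeff_nonneg]
  have ha1 : ∀ m, a m ≤ 1 := by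
    intro m; by_cases h : m ≤ k <;> simp [a, h, mixingCoeff_le_one]
  let b : ℕ → ℝ := fun m => D * a m ^ (1 - 2 / γ)
  have hb0 : ∀ m, 0 ≤ b m := fun m => mul_nonneg hD0 (Real.rpow_nonneg (ha0 m) _)
  have hbs : Summable b := by
    refine Summable.mul_left D ?_
    rw [← summable_nat_add_iff (k + 1)]
    refine hmix.congr fun m => ?_
    have h1 : ¬ (m + (k + 1) ≤ k) := by omega
    have h2 : m + (k + 1) - k = m + 1 := by omega
    simp only [a, h1, if_false, h2]
  have hcov : ∀ (t : ℤ) (m : ℕ), |cov[U t, U (t + m); μ]| ≤ b m := by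
    intro t m
    refine abs_covariance_le_rpow (sigmaField_le hV (Set.Iic t))
      (sigmaField_le hV (Set.Ici (t + m - k))) hγ (ha0 m) (ha1 m) ?_
      ((hU t).mono (sigmaField_mono fun x hx => hx.2) le_rfl)
      ((hU (t + m)).mono (sigmaField_mono fun x hx => hx.1) le_rfl)
      (hU2 _) (hU2 _) (hUi _) (hUi _) (hUK _) (hUK _)
    intro A B hA hB
    by_cases h : m ≤ k
    · simp only [a, h, if_true]
      exact abs_measureReal_inter_sub_le_one A B
    · simp only [a, h, if_false]
      refine abs_measureReal_inter_sub_le_mixingCoeff hA (i := t) ?_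
      have e : t + ((m - k : ℕ) : ℤ) = t + m - k := by
        rw [Nat.cast_sub (by omega)]; ring
      rwa [e]
  have hcov' : ∀ s t : ℤ, cov[U s, U t; μ] ≤ b (t - s).natAbs := by
    intro s t
    refine (le_abs_self _).trans ?_
    rcases le_total s t with h | h
    · have := hcov s (t - s).natAbs
      rwa [Int.natAbs_of_nonneg (by omega), add_sub_cancel] at this
    · have := hcov t (t - s).natAbs
      rw [covariance_comm]
      rwa [Int.ofNat_natAbs_of_nonpos (by omega), show t + -(t - s) = s by ring] at this
  have hbZ : Summable fun j : ℤ => b j.natAbs := by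
    refine Summable.of_nat_of_neg ?_ ?_ <;> simpa using hbs
  -- Each row of the covariance matrix is dominated by the same two-sided series in the time
  -- difference, so C is its sum and the number of rows gives the linear growth.
  refine ⟨∑' j : ℤ, b j.natAbs, tsum_nonneg fun j => hb0 _, fun s => ?_⟩
  rw [variance_fun_sum' fun i _ => hU2 _]
  calc ∑ i ∈ s, ∑ j ∈ s, cov[U i, U j; μ] ≤ ∑ i ∈ s, ∑' j : ℤ, b j.natAbs := by
        refine Finset.sum_le_sum fun i _ => ?_
        calc ∑ j ∈ s, cov[U i, U j; μ] ≤ ∑ j ∈ s, b ((j : ℤ) - i).natAbs :=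
              Finset.sum_le_sum fun j _ => hcov' _ _
          _ = ∑ j ∈ s.image (fun j : ℕ => (j : ℤ) - i), b j.natAbs := by
              rw [Finset.sum_image]
              intro x _ y _ hxy
              simpa using hxy
          _ ≤ _ := hbZ.sum_le_tsum _ fun j _ => hb0 _
    _ = _ := by simp [mul_comm]

end Mixing

/-! ### Stochastic order symbols -/

section BigOp

variable {X Y : ℕ → Ω → ℝ} {a b : ℕ → ℝ}

lemma IsBigOp.mono_left (hY : IsBigOp μ Y a) (N : ℕ) (h : ∀ n, N ≤ n → ∀ ω, |X n ω| ≤ |Y n ω|) :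
    IsBigOp μ X a := by
  intro ε hε
  obtain ⟨C, hC, N', hN'⟩ := hY ε hε
  refine ⟨C, hC, max N N', fun n hn => le_trans (measure_mono fun ω hω => ?_)
    (hN' n (le_trans (le_max_right _ _) hn))⟩
  exact lt_of_lt_of_le hω (h n (le_trans (le_max_left _ _) hn) ω)

lemma IsBigOp.mono_right (hX : IsBigOp μ X a) (N : ℕ) (h : ∀ n, N ≤ n → a n ≤ b n) :
    IsBigOp μ X b := by
  intro ε hε
  obtain ⟨C, hC, N', hN'⟩ := hX ε hε
  refine ⟨C, hC, max N N', fun n hn => le_trans (measure_mono fun ω hω => ?_)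
    (hN' n (le_trans (le_max_right _ _) hn))⟩
  exact (mul_le_mul_of_nonneg_left (h n (le_trans (le_max_left _ _) hn)) hC.le).trans_lt hω

lemma IsBigOp.of_abs_le (c : ℕ → ℝ) (C : ℝ) (N : ℕ) (h : ∀ n, N ≤ n → |c n| ≤ C * a n)
    (ha : ∀ n, 0 ≤ a n) : IsBigOp μ (fun n _ => c n) a := by
  intro ε hε
  refine ⟨|C| + 1, by positivity, N, fun n hn => ?_⟩
  have : {ω : Ω | (|C| + 1) * a n < |c n|} = ∅ := by
    rw [Set.eq_empty_iff_forall_notMem]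
    intro ω hω
    have h1 := h n hn
    have h2 : C * a n ≤ (|C| + 1) * a n := by
      have := ha n
      gcongr
      linarith [le_abs_self C]
    have h3 : (|C| + 1) * a n < |c n| := hω
    linarith
  rw [this]
  simp

/-- Reduces the calculus of O_p to pointwise implications: outside two exceptional events of measure
ε/2 both bounds hold, and G and N may depend on C and D. -/
lemma IsBigOp.union_bound {X Y Z : ℕ → Ω → ℝ} {a b c : ℕ → ℝ} (hX : IsBigOp μ X a)
    (hY : IsBigOp μ Y b)
    (h : ∀ C D : ℝ, 0 < C → 0 < D → ∃ G : ℝ, 0 < G ∧ ∃ N : ℕ, ∀ n, N ≤ n → ∀ ω,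
      |X n ω| ≤ C * a n → |Y n ω| ≤ D * b n → |Z n ω| ≤ G * c n) : IsBigOp μ Z c := by
  intro ε hε
  obtain ⟨C, hC, N, hN⟩ := hX (ε / 2) (by positivity)
  obtain ⟨D, hD, N', hN'⟩ := hY (ε / 2) (by positivity)
  obtain ⟨G, hG, N'', hN''⟩ := h C D hC hD
  refine ⟨G, hG, max N (max N' N''), fun n hn => ?_⟩
  have h1 := hN n (by omega)
  have h2 := hN' n (by omega)
  have h3 := hN'' n (by omega)
  calc μ {ω | G * c n < |Z n ω|} ≤ μ ({ω | C * a n < |X n ω|} ∪ {ω | D * b n < |Y n ω|}) := by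
        refine measure_mono fun ω hω => ?_
        by_contra hcon
        simp only [Set.mem_union, Set.mem_ofPred_eq, not_or, not_lt] at hcon
        exact absurd (h3 ω hcon.1 hcon.2) (not_le.2 hω)
    _ ≤ _ := measure_union_le _ _
    _ ≤ ENNReal.ofReal (ε / 2) + ENNReal.ofReal (ε / 2) := add_le_add h1 h2
    _ = ENNReal.ofReal ε := by
        rw [← ENNReal.ofReal_add (by positivity) (by positivity), add_halves]

lemma IsBigOp.add (hX : IsBigOp μ X a) (hY : IsBigOp μ Y a) :
    IsBigOp μ (fun n ω => X n ω + Y n ω) a :=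
  hX.union_bound hY fun C D hC hD => ⟨C + D, by positivity, 0, fun n _ ω h1 h2 => by
    rw [add_mul]; exact (abs_add_le _ _).trans (add_le_add h1 h2)⟩

lemma IsBigOp.neg (hX : IsBigOp μ X a) : IsBigOp μ (fun n ω => - X n ω) a :=
  hX.mono_left 0 fun n _ ω => by simp

lemma IsBigOp.sub (hX : IsBigOp μ X a) (hY : IsBigOp μ Y a) :
    IsBigOp μ (fun n ω => X n ω - Y n ω) a := by
  simpa only [sub_eq_add_neg] using hX.add hY.neg

lemma IsBigOp.mul (hX : IsBigOp μ X a) (hY : IsBigOp μ Y b) :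
    IsBigOp μ (fun n ω => X n ω * Y n ω) (fun n => a n * b n) :=
  hX.union_bound hY fun C D hC hD => ⟨C * D, by positivity, 0, fun n _ ω h1 h2 => by
    rw [abs_mul, mul_mul_mul_comm]
    exact mul_le_mul h1 h2 (abs_nonneg _) ((abs_nonneg _).trans h1)⟩

lemma IsBigOp.abs (hX : IsBigOp μ X a) : IsBigOp μ (fun n ω => |X n ω|) a :=
  hX.mono_left 0 fun n _ ω => by simp

lemma IsBigOp.sum {ι : Type*} (s : Finset ι) {X : ι → ℕ → Ω → ℝ} (ha : ∀ n, 0 ≤ a n)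
    (h : ∀ i ∈ s, IsBigOp μ (X i) a) : IsBigOp μ (fun n ω => ∑ i ∈ s, X i n ω) a := by
  classical
  induction s using Finset.induction with
  | empty => simpa using IsBigOp.of_abs_le (μ := μ) (fun _ => 0) 1 0 (by simpa using ha) ha
  | insert i s hi ih =>
    simp only [Finset.sum_insert hi]
    exact (h i (Finset.mem_insert_self _ _)).add
      (ih fun j hj => h j (Finset.mem_insert_of_mem hj))

/-- A quantity that is dominated by a small one, as soon as the latter is below a threshold, and by
a bounded factor. -/
lemma IsBigOp.of_local_le {X e Y : ℕ → Ω → ℝ} (he : IsBigOp μ e a)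
    (ha : Filter.Tendsto a Filter.atTop (nhds 0)) (hY : IsBigOp μ Y (fun _ => 1)) {C η : ℝ}
    (hη : 0 < η) (h : ∀ n ω, |e n ω| ≤ η → |X n ω| ≤ C * |e n ω| * |Y n ω|) :
    IsBigOp μ X a := by
  refine he.union_bound hY fun D G hD hG => ?_
  have hηD : 0 < η / D := by positivity
  obtain ⟨N, hN⟩ := Filter.eventually_atTop.1 (ha.eventually (gt_mem_nhds hηD))
  refine ⟨(|C| + 1) * D * G, by positivity, N, fun n hn ω h1 h2 => ?_⟩
  have h3 : |e n ω| ≤ η := by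
    have := hN n hn
    rw [lt_div_iff₀ hD] at this
    linarith
  have h4 : 0 ≤ D * a n := (abs_nonneg _).trans h1
  calc |X n ω| ≤ C * |e n ω| * |Y n ω| := h n ω h3
    _ ≤ (|C| + 1) * |e n ω| * |Y n ω| := by gcongr; linarith [le_abs_self C]
    _ ≤ (|C| + 1) * (D * a n) * (G * 1) := by gcongr
    _ = _ := by ring

/-- Chebyshev's inequality in terms of stochastic orders. -/
lemma IsBigOp.of_variance_le [IsProbabilityMeasure μ] {a : ℕ → ℝ} {C : ℝ} (N : ℕ)
    (hX : ∀ n, MemLp (X n) 2 μ) (hmean : ∀ n, N ≤ n → ∫ ω, X n ω ∂μ = 0)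
    (ha : ∀ n, N ≤ n → 0 < a n) (hvar : ∀ n, N ≤ n → Var[X n; μ] ≤ C * a n ^ 2) :
    IsBigOp μ X a := by
  intro ε hε
  -- Chosen so that Chebyshev's bound |C|a²/(Da)² is at most ε; the added 1 keeps D positive.
  set D := Real.sqrt ((|C| + 1) / ε)
  have hD : 0 < D := Real.sqrt_pos.2 (by positivity)
  refine ⟨D, hD, N, fun n hn => ?_⟩
  have han := ha n hn
  have h1 := meas_ge_le_variance_div_sq (hX n) (c := D * a n) (by positivity)
  rw [hmean n hn] at h1
  refine (measure_mono fun ω hω => ?_).trans (h1.trans (ENNReal.ofReal_le_ofReal ?_))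
  · simpa using le_of_lt hω
  · rw [mul_pow, Real.sq_sqrt (by positivity), div_le_iff₀ (by positivity)]
    calc Var[X n; μ] ≤ C * a n ^ 2 := hvar n hn
      _ ≤ (|C| + 1) * a n ^ 2 := by gcongr; linarith [le_abs_self C]
      _ = _ := by field_simp

end BigOp

/-! ### Sample moments of a mixing process -/

section SampleMoments

lemma rate_pos {n : ℕ} (hn : 1 ≤ n) : 0 < (n : ℝ) ^ (-(1 / 2) : ℝ) :=
  Real.rpow_pos_of_pos (by exact_mod_cast hn) _

lemma rate_sq (n : ℕ) : ((n : ℝ) ^ (-(1 / 2) : ℝ)) ^ 2 = 1 / n := by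
  rw [← Real.rpow_natCast, ← Real.rpow_mul (Nat.cast_nonneg n)]
  norm_num [Real.rpow_neg_one]

lemma rate_nonneg (n : ℕ) : 0 ≤ (n : ℝ) ^ (-(1 / 2) : ℝ) := by positivity

lemma rate_le_one {n : ℕ} (hn : 1 ≤ n) : (n : ℝ) ^ (-(1 / 2) : ℝ) ≤ 1 :=
  Real.rpow_le_one_of_one_le_of_nonpos (by exact_mod_cast hn) (by norm_num)

lemma tendsto_rate : Filter.Tendsto (fun n : ℕ => (n : ℝ) ^ (-(1 / 2) : ℝ)) Filter.atTop (nhds 0) :=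
  (tendsto_rpow_neg_atTop (by norm_num : (0 : ℝ) < 1 / 2)).comp tendsto_natCast_atTop_atTop

variable {E : Type*} [MeasurableSpace E] {V : ℤ → Ω → E}

/-- The average has mean zero and variance at most Cn/n², the square of the rate up to a constant.
The start l + 1 accommodates lagged sums. -/
lemma isBigOp_centered_mean [IsProbabilityMeasure μ] (hV : ∀ t, Measurable (V t)) {γ K : ℝ}
    (hγ : 2 < γ) (hmix : Summable fun k : ℕ => mixingCoeff μ V (k + 1) ^ (1 - 2 / γ))
    {U : ℤ → Ω → ℝ} (k : ℕ)
    (hU : ∀ t, Measurable[sigmaField V (Set.Icc (t - (k : ℤ)) t)] (U t))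
    (hU2 : ∀ t, MemLp (U t) 2 μ) (hUi : ∀ t, Integrable (fun ω => |U t ω| ^ γ) μ)
    (hUK : ∀ t, ∫ ω, |U t ω| ^ γ ∂μ ≤ K) {c : ℝ} (hc : ∀ t, ∫ ω, U t ω ∂μ = c)
    (l : ℕ) :
    IsBigOp μ (fun n ω => (1 / (n : ℝ)) * ∑ t ∈ Finset.Icc (l + 1) n, (U (t : ℤ) ω - c))
      (fun n => (n : ℝ) ^ (-(1 / 2) : ℝ)) := by
  obtain ⟨C, hC, hvar⟩ := exists_variance_sum_le hV hγ hmix k hU hU2 hUi hUK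
  have hUint : ∀ t, Integrable (U t) μ := fun t => (hU2 t).integrable (by norm_num)
  have hUc : ∀ t, MemLp (fun ω => U t ω - c) 2 μ := fun t => (hU2 t).sub (memLp_const c)
  have hUci : ∀ t, Integrable (fun ω => U t ω - c) μ := fun t => (hUc t).integrable (by norm_num)
  refine IsBigOp.of_variance_le (C := C) 1 ?_ ?_ (fun n hn => rate_pos hn) ?_
  · intro n
    exact (memLp_finsetSum (Finset.Icc (l + 1) n) fun t _ => hUc t).const_mul _
  · intro n _
    rw [integral_const_mul, integral_finsetSum _ fun (t : ℕ) _ => hUci t,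
      Finset.sum_eq_zero, mul_zero]
    intro t _
    rw [integral_sub (hUint t) (integrable_const c), hc]
    simp
  · intro n hn
    have hn0 : (0 : ℝ) < n := by exact_mod_cast hn
    have e : Var[fun ω => ∑ t ∈ Finset.Icc (l + 1) n, (U (t : ℤ) ω - c); μ] =
        Var[fun ω => ∑ t ∈ Finset.Icc (l + 1) n, U (t : ℤ) ω; μ] := by
      have h : AEStronglyMeasurable (fun ω => ∑ t ∈ Finset.Icc (l + 1) n, U (t : ℤ) ω) μ :=
        (memLp_finsetSum (p := 2) (Finset.Icc (l + 1) n)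
          fun t _ => hU2 t).aestronglyMeasurable
      simp only [Finset.sum_sub_distrib]
      exact variance_sub_const h _
    rw [variance_const_mul, e, rate_sq]
    have h1 := hvar (Finset.Icc (l + 1) n)
    have h2 : ((Finset.Icc (l + 1) n).card : ℝ) ≤ n := by
      rw [Nat.card_Icc]; exact_mod_cast (by omega)
    calc (1 / (n : ℝ)) ^ 2 * _ ≤ (1 / (n : ℝ)) ^ 2 * (C * n) := by
          gcongr
          exact h1.trans (by gcongr)
      _ = _ := by field_simp

/-- Moments of order 2γ of the variables give moments of order γ of their products, to which the
covariance inequality is applied. -/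
lemma abs_mul_rpow_le (γ x y : ℝ) :
    |x * y| ^ γ ≤ |x| ^ (2 * γ) + |y| ^ (2 * γ) := by
  have e : ∀ z : ℝ, |z| ^ (2 * γ) = (|z| ^ γ) ^ 2 := by
    intro z
    rw [mul_comm, Real.rpow_mul (abs_nonneg z), Real.rpow_two]
  rw [abs_mul, Real.mul_rpow (abs_nonneg _) (abs_nonneg _), e, e]
  nlinarith [sq_nonneg (|x| ^ γ - |y| ^ γ), sq_nonneg (|x| ^ γ), sq_nonneg (|y| ^ γ)]

/-- The sample autocovariances of a centered mixing process are root-`n` consistent. -/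
lemma isBigOp_sample_covariance [IsProbabilityMeasure μ] (hV : ∀ t, Measurable (V t)) {γ K : ℝ}
    (hγ : 2 < γ) (hmix : Summable fun k : ℕ => mixingCoeff μ V (k + 1) ^ (1 - 2 / γ))
    {x y : ℤ → Ω → ℝ} (k : ℕ)
    (hx : ∀ t, Measurable[MeasurableSpace.comap (V t) inferInstance] (x t))
    (hy : ∀ t, Measurable[MeasurableSpace.comap (V t) inferInstance] (y t))
    (hxi : ∀ t, Integrable (fun ω => |x t ω| ^ (2 * γ)) μ)
    (hyi : ∀ t, Integrable (fun ω => |y t ω| ^ (2 * γ)) μ)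
    (hxK : ∀ t, ∫ ω, |x t ω| ^ (2 * γ) ∂μ ≤ K) (hyK : ∀ t, ∫ ω, |y t ω| ^ (2 * γ) ∂μ ≤ K)
    (hx0 : ∀ t, ∫ ω, x t ω ∂μ = 0) (hy0 : ∀ t, ∫ ω, y t ω ∂μ = 0) {c : ℝ}
    (hc : ∀ t, ∫ ω, x t ω * y (t - k) ω ∂μ = c) :
    IsBigOp μ (fun n ω => (1 / (n : ℝ)) * ∑ t ∈ Finset.Icc (k + 1) n,
        (x t ω - (1 / (n : ℝ)) * ∑ s ∈ Finset.Icc 1 n, x s ω) *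
          (y (t - k) ω - (1 / (n : ℝ)) * ∑ s ∈ Finset.Icc 1 n, y s ω) - c)
      (fun n => (n : ℝ) ^ (-(1 / 2) : ℝ)) := by
  have hγ0 : 0 < γ := by linarith
  have hp : (0 : ℝ) < 2 * γ := by linarith
  have comap_le : ∀ {t : ℤ} {S : Set ℤ}, t ∈ S →
      MeasurableSpace.comap (V t) inferInstance ≤ sigmaField V S := fun ht =>
    le_biSup (fun t => MeasurableSpace.comap (V t) inferInstance) ht
  have hmem : ∀ {z : ℤ → Ω → ℝ},
      (∀ t, Measurable[MeasurableSpace.comap (V t) inferInstance] (z t)) →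
      (∀ t, Integrable (fun ω => |z t ω| ^ (2 * γ)) μ) →
      ∀ t, MemLp (z t) (ENNReal.ofReal (2 * γ)) μ := by
    intro z hz hzi t
    have hzm : Measurable (z t) := (hz t).mono (hV t).comap_le le_rfl
    rw [← integrable_norm_rpow_iff hzm.aestronglyMeasurable (by simp [hγ0]) ENNReal.ofReal_ne_top,
      ENNReal.toReal_ofReal hp.le]
    simpa using hzi t
  have hx4 := hmem hx hxi
  have hy4 := hmem hy hyi
  have two_le : (2 : ENNReal) ≤ ENNReal.ofReal (2 * γ) := by
    rw [ENNReal.le_ofReal_iff_toReal_le (by simp) hp.le]; simp; linarith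
  -- Because 2γ > 4, products of two variables are square integrable.
  have four_le : (4 : ENNReal) ≤ ENNReal.ofReal (2 * γ) := by
    rw [ENNReal.le_ofReal_iff_toReal_le (by simp) hp.le]; simp; linarith
  have hx2 : ∀ t, MemLp (x t) 2 μ := fun t => (hx4 t).mono_exponent two_le
  have hy2 : ∀ t, MemLp (y t) 2 μ := fun t => (hy4 t).mono_exponent two_le
  have hrpow : ∀ {z : ℤ → Ω → ℝ},
      (∀ t, Measurable[MeasurableSpace.comap (V t) inferInstance] (z t)) →
      (∀ t, Integrable (fun ω => |z t ω| ^ (2 * γ)) μ) → (∀ t, ∫ ω, |z t ω| ^ (2 * γ) ∂μ ≤ K) →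
      ∀ t, Integrable (fun ω => |z t ω| ^ γ) μ ∧ ∫ ω, |z t ω| ^ γ ∂μ ≤ 1 + K := by
    intro z hz hzi hzK t
    have hzm : Measurable (z t) := (hz t).mono (hV t).comap_le le_rfl
    have hle : ∀ ω, |z t ω| ^ γ ≤ 1 + |z t ω| ^ (2 * γ) := by
      intro ω
      have := abs_mul_rpow_le γ (z t ω) 1
      simpa [add_comm] using this
    have hint : Integrable (fun ω => 1 + |z t ω| ^ (2 * γ)) μ := (integrable_const _).add (hzi t)
    have hi : Integrable (fun ω => |z t ω| ^ γ) μ :=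
      hint.mono' (hzm.abs.pow_const γ).aestronglyMeasurable (Filter.Eventually.of_forall fun ω => by
        rw [Real.norm_of_nonneg (by positivity)]; exact hle ω)
    refine ⟨hi, (integral_mono hi hint hle).trans ?_⟩
    rw [integral_add (integrable_const _) (hzi t)]
    simpa using hzK t
  have hxγ := hrpow hx hxi hxK
  have hyγ := hrpow hy hyi hyK
  have mean0 : ∀ {z : ℤ → Ω → ℝ},
      (∀ t, Measurable[MeasurableSpace.comap (V t) inferInstance] (z t)) →
      (∀ t, MemLp (z t) 2 μ) →
      (∀ t, Integrable (fun ω => |z t ω| ^ γ) μ ∧ ∫ ω, |z t ω| ^ γ ∂μ ≤ 1 + K) →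
      (∀ t, ∫ ω, z t ω ∂μ = 0) → ∀ j l : ℕ,
      IsBigOp μ (fun n ω => (1 / (n : ℝ)) * ∑ t ∈ Finset.Icc (l + 1) n, z (t - j) ω)
        (fun n => (n : ℝ) ^ (-(1 / 2) : ℝ)) := by
    intro z hz hz2 hzγ hz0 j l
    have := isBigOp_centered_mean hV hγ hmix (U := fun t => z (t - j)) j
      (fun t => (hz (t - j)).mono (comap_le (Set.mem_Icc.2 ⟨le_rfl, by omega⟩)) le_rfl)
      (fun t => hz2 _) (fun t => (hzγ _).1) (fun t => (hzγ _).2) (fun t => hz0 _) l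
    simpa using this
  have hxbar := mean0 hx hx2 hxγ hx0 0 0
  have hybar := mean0 hy hy2 hyγ hy0 0 0
  have hSx := mean0 hx hx2 hxγ hx0 0 k
  have hSy := mean0 hy hy2 hyγ hy0 k k
  simp only [Nat.cast_zero, sub_zero, zero_add] at hxbar hybar hSx
  have hprod := isBigOp_centered_mean hV hγ hmix (U := fun t ω => x t ω * y (t - k) ω)
    (K := K + K) (c := c) k
    (fun t => ((hx t).mono (comap_le (Set.mem_Icc.2 ⟨by omega, le_rfl⟩)) le_rfl).mul
      ((hy (t - k)).mono (comap_le (Set.mem_Icc.2 ⟨le_rfl, by omega⟩)) le_rfl))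
    (fun t => by
      have : ENNReal.HolderTriple 4 4 2 := ⟨by
        rw [← two_mul, show (4 : ENNReal) = 2 * 2 by norm_num,
          ENNReal.mul_inv (by simp) (by simp), ← mul_assoc,
          ENNReal.mul_inv_cancel (by simp) (by simp), one_mul]⟩
      exact ((hy4 (t - k)).mono_exponent four_le).mul ((hx4 t).mono_exponent four_le))
    (fun t => by
      have hxm : Measurable (x t) := (hx t).mono (hV t).comap_le le_rfl
      have hym : Measurable (y (t - k)) := (hy (t - k)).mono (hV _).comap_le le_rfl
      exact ((hxi t).add (hyi (t - k))).mono'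
        ((hxm.mul hym).abs.pow_const γ).aestronglyMeasurable
        (Filter.Eventually.of_forall fun ω => by
          rw [Real.norm_of_nonneg (by positivity)]; exact abs_mul_rpow_le γ _ _))
    (fun t => by
      refine (integral_mono_of_nonneg (Filter.Eventually.of_forall fun ω => by positivity)
        ((hxi t).add (hyi (t - k)))
        (Filter.Eventually.of_forall fun ω => abs_mul_rpow_le γ _ _)).trans ?_
      exact (integral_add (hxi t) (hyi (t - k))).trans_le (add_le_add (hxK _) (hyK _))) hc k
  have weak : ∀ {X Y : ℕ → Ω → ℝ}, IsBigOp μ X (fun n => (n : ℝ) ^ (-(1 / 2) : ℝ)) →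
      IsBigOp μ Y (fun n => (n : ℝ) ^ (-(1 / 2) : ℝ)) →
      IsBigOp μ (fun n ω => X n ω * Y n ω) (fun n => (n : ℝ) ^ (-(1 / 2) : ℝ)) := by
    intro X Y hX hY
    exact (hX.mul hY).mono_right 1 fun n hn =>
      mul_le_of_le_one_right (rate_nonneg n) (rate_le_one hn)
  -- The sum has n - k terms but is divided by n; the resulting bias -ck/n is of smaller order than
  -- the rate.
  have hconst : IsBigOp μ (fun (n : ℕ) (_ : Ω) => c * ((n - k : ℝ) / n - 1))
      (fun n => (n : ℝ) ^ (-(1 / 2) : ℝ)) := by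
    refine IsBigOp.of_abs_le _ (|c| * k) 1 (fun n hn => ?_) rate_nonneg
    have hn0 : (0 : ℝ) < n := by exact_mod_cast hn
    have e : c * ((n - k : ℝ) / n - 1) = -(c * k * (1 / n)) := by field_simp; ring
    rw [e, abs_neg, abs_mul, abs_mul, abs_of_nonneg (Nat.cast_nonneg k (α := ℝ)),
      abs_of_nonneg (by positivity : 0 ≤ 1 / (n : ℝ)), ← rate_sq]
    gcongr
    rw [pow_two]
    exact mul_le_of_le_one_right (rate_nonneg n) (rate_le_one hn)
  have hfac : IsBigOp μ (fun (n : ℕ) (_ : Ω) => (n - k : ℝ) / n) (fun _ => 1) := by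
    refine IsBigOp.of_abs_le _ 1 (k + 1) (fun n hn => ?_) (fun _ => zero_le_one)
    have hk : (k : ℝ) ≤ n := by exact_mod_cast (by omega)
    have hn0 : (0 : ℝ) < n := by exact_mod_cast (by omega : 0 < n)
    rw [abs_of_nonneg (div_nonneg (by linarith) hn0.le), one_mul, div_le_one hn0]
    linarith [Nat.cast_nonneg k (α := ℝ)]
  have hlast : IsBigOp μ (fun n ω => ((1 / (n : ℝ)) * ∑ s ∈ Finset.Icc 1 n, x s ω) *
      ((1 / (n : ℝ)) * ∑ s ∈ Finset.Icc 1 n, y s ω) * ((n - k : ℝ) / n))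
      (fun n => (n : ℝ) ^ (-(1 / 2) : ℝ)) := by
    simpa using (weak hxbar hybar).mul hfac
  -- Expansion of the product of deviations from the sample means, exact for n > k: the centered
  -- products, the bias, two cross terms, and the product of the means with its factor (n - k)/n.
  -- The last three are products of quantities already of the order of the rate.
  refine ((((hprod.add hconst).sub (weak hybar hSx)).sub (weak hxbar hSy)).add hlast).mono_left
    (k + 1) fun n hn ω => le_of_eq ?_
  congr 1
  have hn0 : (n : ℝ) ≠ 0 := by exact_mod_cast (by omega : n ≠ 0)
  set xb := (1 / (n : ℝ)) * ∑ s ∈ Finset.Icc 1 n, x s ω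
  set yb := (1 / (n : ℝ)) * ∑ s ∈ Finset.Icc 1 n, y s ω
  have hcard : ((Finset.Icc (k + 1) n).card : ℝ) = n - k := by
    rw [Nat.card_Icc, show n + 1 - (k + 1) = n - k by omega, Nat.cast_sub (by omega)]
  have e : ∀ t : ℕ, (x t ω - xb) * (y (t - k) ω - yb) =
      (x t ω * y (t - k) ω - c) + c - yb * x t ω - xb * y (t - k) ω + xb * yb := fun t => by ring
  simp only [e, Finset.sum_add_distrib, Finset.sum_sub_distrib, ← Finset.mul_sum,
    Finset.sum_const, nsmul_eq_mul, hcard]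
  field_simp
  ring

end SampleMoments

end MatrixFactor

namespace MatrixFactor

open scoped Matrix Kronecker Matrix.Norms.Frobenius

/-! ### Loading spaces -/

section Loadings

variable {p r v : ℕ} {L₁ A₁ : Matrix (Fin p) (Fin r) ℝ} {L₂ A₂ : Matrix (Fin p) (Fin v) ℝ}
  {W₁ : Matrix (Fin r) (Fin r) ℝ} {W₂ : Matrix (Fin v) (Fin v) ℝ} {B₁ : Matrix (Fin p) (Fin v) ℝ}

/-- The columns of `(L₁, L₂)` are linearly independent. -/
def LoadingsIndependent (L₁ : Matrix (Fin p) (Fin r) ℝ) (L₂ : Matrix (Fin p) (Fin v) ℝ) : Prop :=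
  ∀ x y, L₁ *ᵥ x + L₂ *ᵥ y = 0 → x = 0 ∧ y = 0

lemma loadingsIndependent_of_rank (hp : r + v = p) (h : (Matrix.fromCols L₁ L₂).rank = p) :
    LoadingsIndependent L₁ L₂ := by
  intro x y hxy
  have h1 := LinearMap.finrank_range_add_finrank_ker (Matrix.fromCols L₁ L₂).mulVecLin
  have h2 : Module.finrank ℝ (LinearMap.ker (Matrix.fromCols L₁ L₂).mulVecLin) = 0 := by
    have h3 : Module.finrank ℝ (LinearMap.range (Matrix.fromCols L₁ L₂).mulVecLin) = p := h
    rw [h3, Module.finrank_fintype_fun_eq_card] at h1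
    simp at h1
    omega
  have h3 := Submodule.finrank_eq_zero.1 h2
  have h4 : Sum.elim x y ∈ LinearMap.ker (Matrix.fromCols L₁ L₂).mulVecLin := by
    rw [LinearMap.mem_ker, Matrix.mulVecLin_apply, Matrix.fromCols_mulVec_sumElim]
    exact hxy
  rw [h3, Submodule.mem_bot] at h4
  constructor
  · ext i; exact congrFun h4 (Sum.inl i)
  · ext i; exact congrFun h4 (Sum.inr i)

lemma LoadingsIndependent.symm (h : LoadingsIndependent L₁ L₂) : LoadingsIndependent L₂ L₁ :=
  fun x y hxy => (h y x (by rwa [add_comm])).symm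

lemma isUnit_of_mulVec_eq_zero {N : Matrix (Fin r) (Fin r) ℝ} (h : ∀ x, N *ᵥ x = 0 → x = 0) :
    IsUnit N := by
  rw [← Matrix.mulVec_injective_iff_isUnit]
  intro x y hxy
  refine sub_eq_zero.1 (h _ ?_)
  rw [Matrix.mulVec_sub, sub_eq_zero]
  exact hxy

lemma LoadingsIndependent.isUnit_left (h : LoadingsIndependent L₁ L₂) (hL : L₁ = A₁ * W₁) :
    IsUnit W₁ := by
  refine isUnit_of_mulVec_eq_zero fun x hx => (h x 0 ?_).1
  rw [hL, ← Matrix.mulVec_mulVec, hx]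
  simp

/-- If B₁'L₂y = 0, then L₂y lies in the column space of A₁, which is that of L₁ because W₁ is
invertible. Independence of (L₁, L₂) forces y = 0. -/
lemma LoadingsIndependent.isUnit_complement (h : LoadingsIndependent L₁ L₂) (hL : L₁ = A₁ * W₁)
    (hAB : A₁ * A₁ᵀ + B₁ * B₁ᵀ = 1) : IsUnit (B₁ᵀ * L₂) := by
  refine isUnit_of_mulVec_eq_zero fun y hy => ?_
  have hd := (Matrix.isUnit_iff_isUnit_det _).1 (h.isUnit_left hL)
  have h1 : L₂ *ᵥ y = A₁ *ᵥ (A₁ᵀ *ᵥ (L₂ *ᵥ y)) := by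
    have h2 : L₂ *ᵥ y = (A₁ * A₁ᵀ + B₁ * B₁ᵀ) *ᵥ (L₂ *ᵥ y) := by
      rw [hAB, Matrix.one_mulVec]
    rw [Matrix.add_mulVec, ← Matrix.mulVec_mulVec, ← Matrix.mulVec_mulVec _ B₁,
      Matrix.mulVec_mulVec _ B₁ᵀ, hy, Matrix.mulVec_zero, add_zero] at h2
    exact h2
  set z := A₁ᵀ *ᵥ (L₂ *ᵥ y)
  refine (h (-(W₁⁻¹ *ᵥ z)) y ?_).2
  rw [h1, hL, Matrix.mulVec_neg, ← Matrix.mulVec_mulVec, Matrix.mulVec_mulVec _ W₁,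
    Matrix.mul_nonsing_inv _ hd, Matrix.one_mulVec]
  simp

end Loadings

/-! ### Linear forms of the observations -/

section Model

variable {Ω : Type*} [mΩ : MeasurableSpace Ω] {μ : Measure Ω}
  {p₁ p₂ r₁ r₂ v₁ v₂ : ℕ}
  {L₁ : Matrix (Fin p₁) (Fin r₁) ℝ} {L₂ : Matrix (Fin p₁) (Fin v₁) ℝ}
  {R₁ : Matrix (Fin p₂) (Fin r₂) ℝ} {R₂ : Matrix (Fin p₂) (Fin v₂) ℝ}
  {F : ℤ → Ω → Matrix (Fin r₁) (Fin r₂) ℝ} {Z₁₂ : ℤ → Ω → Matrix (Fin r₁) (Fin v₂) ℝ}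
  {Z₂₁ : ℤ → Ω → Matrix (Fin v₁) (Fin r₂) ℝ} {Z₂₂ : ℤ → Ω → Matrix (Fin v₁) (Fin v₂) ℝ}
  {Y : ℤ → Ω → Matrix (Fin p₁) (Fin p₂) ℝ}

/-- The index map that corresponds to the transposition of the noise blocks. -/
def idioSwap : (Fin r₁ × Fin v₂) ⊕ ((Fin v₁ × Fin r₂) ⊕ (Fin v₁ × Fin v₂)) →
    (Fin r₂ × Fin v₁) ⊕ ((Fin v₂ × Fin r₁) ⊕ (Fin v₂ × Fin v₁)) :=
  Sum.elim (fun x => Sum.inr (Sum.inl x.swap))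
    (Sum.elim (fun x => Sum.inl x.swap) fun x => Sum.inr (Sum.inr x.swap))

lemma idioSwap_injective :
    Function.Injective (idioSwap (r₁ := r₁) (r₂ := r₂) (v₁ := v₁) (v₂ := v₂)) := by
  rintro (⟨a, b⟩ | ⟨a, b⟩ | ⟨a, b⟩) (⟨c, d⟩ | ⟨c, d⟩ | ⟨c, d⟩) h <;>
    simp_all [idioSwap]

lemma idioVec_transpose (z₁₂ : Matrix (Fin r₁) (Fin v₂) ℝ) (z₂₁ : Matrix (Fin v₁) (Fin r₂) ℝ)
    (z₂₂ : Matrix (Fin v₁) (Fin v₂) ℝ) (a) :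
    idioVec z₂₁ᵀ z₁₂ᵀ z₂₂ᵀ a = idioVec z₁₂ z₂₁ z₂₂ (idioSwap a) := by
  rcases a with a | a | a <;> rfl

/-- The model is symmetric under transposition with Z₁₂ and Z₂₁ exchanged, so statements on row
loadings yield those on column loadings. -/
lemma Model.transpose (h : Model μ L₁ L₂ R₁ R₂ F Z₁₂ Z₂₁ Z₂₂ Y) :
    Model μ R₁ R₂ L₁ L₂ (fun t ω => (F t ω)ᵀ) (fun t ω => (Z₂₁ t ω)ᵀ) (fun t ω => (Z₁₂ t ω)ᵀ)
      (fun t ω => (Z₂₂ t ω)ᵀ) (fun t ω => (Y t ω)ᵀ) where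
  dim₁ := h.dim₂
  dim₂ := h.dim₁
  rank_L := h.rank_R
  rank_R := h.rank_L
  measurable_factor t a := h.measurable_factor t a.swap
  measurable_noise t a := by
    simp only [idioVec_transpose]
    exact h.measurable_noise t _
  eq t ω := by
    rw [h.eq, Matrix.transpose_mul, Matrix.transpose_mul, Matrix.transpose_transpose,
      Matrix.fromBlocks_transpose, Matrix.mul_assoc]
  stationary :=
    { memLp := fun t a => h.stationary.memLp t a.swap
      mean_zero := fun t a => h.stationary.mean_zero t a.swap
      cov_shift := fun s t k a b => h.stationary.cov_shift s t k a.swap b.swap }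
  factor :=
    { memLp := fun t a => h.factor.memLp t a.swap
      mean_zero := fun t a => h.factor.mean_zero t a.swap
      cov_eq := fun t a b => (h.factor.cov_eq t a.swap b.swap).trans (by
        simp [Prod.swap_inj]) }
  noise :=
    { memLp := fun t a => by
        simp only [idioVec_transpose]; exact h.noise.memLp t _
      mean_zero := fun t a => by
        simp only [idioVec_transpose]; exact h.noise.mean_zero t _
      cov_eq := fun t a b => by
        simp only [idioVec_transpose]
        rw [h.noise.cov_eq]
        simp [idioSwap_injective.eq_iff] }
  white s t hst a b := by
    simp only [idioVec_transpose]; exact h.white s t hst _ _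
  uncorrelated s t a b := by
    simp only [idioVec_transpose]; exact h.uncorrelated s t a.swap _

/-- The coefficients of a bilinear form of the blocks. -/
def blockCoeff (u₁ : Fin r₁ → ℝ) (u₂ : Fin v₁ → ℝ) (w₁ : Fin r₂ → ℝ) (w₂ : Fin v₂ → ℝ) :
    (Fin r₂ × Fin r₁) ⊕ ((Fin r₂ × Fin v₁) ⊕ ((Fin v₂ × Fin r₁) ⊕ (Fin v₂ × Fin v₁))) → ℝ :=
  Sum.elim (fun x => u₁ x.2 * w₁ x.1) (Sum.elim (fun x => u₂ x.2 * w₁ x.1)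
    (Sum.elim (fun x => u₁ x.2 * w₂ x.1) fun x => u₂ x.2 * w₂ x.1))

/-- The factors and the noise variables, stacked. -/
def stacked (F : ℤ → Ω → Matrix (Fin r₁) (Fin r₂) ℝ) (Z₁₂ : ℤ → Ω → Matrix (Fin r₁) (Fin v₂) ℝ)
    (Z₂₁ : ℤ → Ω → Matrix (Fin v₁) (Fin r₂) ℝ) (Z₂₂ : ℤ → Ω → Matrix (Fin v₁) (Fin v₂) ℝ)
    (t : ℤ) (x : (Fin r₂ × Fin r₁) ⊕ ((Fin r₂ × Fin v₁) ⊕ ((Fin v₂ × Fin r₁) ⊕ (Fin v₂ × Fin v₁))))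
    (ω : Ω) : ℝ :=
  Sum.elim (F t ω).vec (idioVec (Z₁₂ t ω) (Z₂₁ t ω) (Z₂₂ t ω)) x

lemma sum_prod_swap_mul {m n : ℕ} (u : Fin m → ℝ) (w : Fin n → ℝ) (M : Matrix (Fin m) (Fin n) ℝ) :
    ∑ x : Fin n × Fin m, u x.2 * w x.1 * M.vec x = u ⬝ᵥ (M *ᵥ w) := by
  rw [Fintype.sum_prod_type, Finset.sum_comm]
  simp only [dotProduct, Matrix.mulVec, Matrix.vec, Finset.mul_sum]
  exact Finset.sum_congr rfl fun i _ => Finset.sum_congr rfl fun j _ => by ring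

/-- Expresses bilinear forms of Y_t in the factor and noise coordinates. The factor enters only
through u'L₁ and w'R₁, hence disappears when either vanishes. -/
lemma Model.form_eq (h : Model μ L₁ L₂ R₁ R₂ F Z₁₂ Z₂₁ Z₂₂ Y) (u : Fin p₁ → ℝ) (w : Fin p₂ → ℝ)
    (t : ℤ) (ω : Ω) : u ⬝ᵥ (Y t ω *ᵥ w) =
      ∑ x, blockCoeff (u ᵥ* L₁) (u ᵥ* L₂) (w ᵥ* R₁) (w ᵥ* R₂) x *
        stacked F Z₁₂ Z₂₁ Z₂₂ t x ω := by
  simp only [Fintype.sum_sum_type, blockCoeff, stacked, idioVec, Sum.elim_inl, Sum.elim_inr,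
    sum_prod_swap_mul]
  rw [h.eq, ← Matrix.mulVec_mulVec, ← Matrix.mulVec_mulVec, Matrix.dotProduct_mulVec,
    Matrix.mulVec_transpose, Matrix.vecMul_fromCols, Matrix.vecMul_fromCols,
    Matrix.fromBlocks_mulVec]
  simp only [sumElim_dotProduct_sumElim, dotProduct_add, Sum.elim_comp_inl,
    Sum.elim_comp_inr]
  ring

lemma Model.entry_eq (h : Model μ L₁ L₂ R₁ R₂ F Z₁₂ Z₂₁ Z₂₂ Y) (a : Fin p₁) (i : Fin p₂)
    (t : ℤ) (ω : Ω) : Y t ω a i =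
      ∑ x, blockCoeff (Pi.single a 1 ᵥ* L₁) (Pi.single a 1 ᵥ* L₂) (Pi.single i 1 ᵥ* R₁)
        (Pi.single i 1 ᵥ* R₂) x * stacked F Z₁₂ Z₂₁ Z₂₂ t x ω := by
  rw [← h.form_eq]
  simp

lemma Model.memLp_stacked (h : Model μ L₁ L₂ R₁ R₂ F Z₁₂ Z₂₁ Z₂₂ Y) (t x) :
    MemLp (stacked F Z₁₂ Z₂₁ Z₂₂ t x) 2 μ := by
  rcases x with x | x
  · exact h.factor.memLp t x
  · exact h.noise.memLp t x

lemma Model.measurable_stacked (h : Model μ L₁ L₂ R₁ R₂ F Z₁₂ Z₂₁ Z₂₂ Y) (t x) :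
    Measurable (stacked F Z₁₂ Z₂₁ Z₂₂ t x) := by
  rcases x with x | x
  · exact h.measurable_factor t x
  · exact h.measurable_noise t x

lemma Model.measurable_entry (h : Model μ L₁ L₂ R₁ R₂ F Z₁₂ Z₂₁ Z₂₂ Y) (t : ℤ) (a : Fin p₁)
    (i : Fin p₂) : Measurable fun ω => Y t ω a i := by
  simp only [h.entry_eq]
  exact Finset.measurable_sum _ fun x _ => (h.measurable_stacked t x).const_mul _

/-- Each |g x| is at most the q-th root of the sum of all |g x|^q; this works for every q > 0
without convexity. -/
lemma abs_sum_mul_rpow_le {ι : Type*} [Fintype ι] (c g : ι → ℝ) {q : ℝ} (hq : 0 < q) :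
    |∑ x, c x * g x| ^ q ≤ (∑ x, |c x|) ^ q * ∑ x, |g x| ^ q := by
  have hs : 0 ≤ ∑ x, |g x| ^ q := by positivity
  have hg : ∀ x, |g x| ≤ (∑ x, |g x| ^ q) ^ q⁻¹ := by
    intro x
    rw [Real.le_rpow_inv_iff_of_pos (abs_nonneg _) hs hq]
    exact Finset.single_le_sum (f := fun x => |g x| ^ q) (fun _ _ => by positivity)
      (Finset.mem_univ x)
  have h1 : |∑ x, c x * g x| ≤ (∑ x, |c x|) * (∑ x, |g x| ^ q) ^ q⁻¹ := by
    rw [Finset.sum_mul]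
    refine (Finset.abs_sum_le_sum_abs _ _).trans (Finset.sum_le_sum fun x _ => ?_)
    rw [abs_mul]
    exact mul_le_mul_of_nonneg_left (hg x) (abs_nonneg _)
  calc |∑ x, c x * g x| ^ q ≤ ((∑ x, |c x|) * (∑ x, |g x| ^ q) ^ q⁻¹) ^ q := by gcongr
    _ = _ := by
        rw [Real.mul_rpow (by positivity) (by positivity), Real.rpow_inv_rpow hs hq.ne']

/-- The entries of the observations have uniformly bounded moments. -/
lemma Model.exists_moment_bound (h : Model μ L₁ L₂ R₁ R₂ F Z₁₂ Z₂₁ Z₂₂ Y) {q : ℝ} (hq : 0 < q)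
    {C₁ C₂ : ℝ}
    (hF : ∀ t a, Integrable (fun ω => |(F t ω).vec a| ^ q) μ ∧
      ∫ ω, |(F t ω).vec a| ^ q ∂μ < C₁)
    (hZ : ∀ t b, Integrable (fun ω => |idioVec (Z₁₂ t ω) (Z₂₁ t ω) (Z₂₂ t ω) b| ^ q) μ ∧
      ∫ ω, |idioVec (Z₁₂ t ω) (Z₂₁ t ω) (Z₂₂ t ω) b| ^ q ∂μ < C₂) :
    ∃ K : ℝ, ∀ t a i, Integrable (fun ω => |Y t ω a i| ^ q) μ ∧ ∫ ω, |Y t ω a i| ^ q ∂μ ≤ K := by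
  have hst : ∀ t x, Integrable (fun ω => |stacked F Z₁₂ Z₂₁ Z₂₂ t x ω| ^ q) μ ∧
      ∫ ω, |stacked F Z₁₂ Z₂₁ Z₂₂ t x ω| ^ q ∂μ ≤ max C₁ C₂ := by
    rintro t (x | x)
    · exact ⟨(hF t x).1, (hF t x).2.le.trans (le_max_left _ _)⟩
    · exact ⟨(hZ t x).1, (hZ t x).2.le.trans (le_max_right _ _)⟩
  let c : Fin p₁ → Fin p₂ → ℝ := fun a i =>
    (∑ x, |blockCoeff (Pi.single a 1 ᵥ* L₁) (Pi.single a 1 ᵥ* L₂) (Pi.single i 1 ᵥ* R₁)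
        (Pi.single i 1 ᵥ* R₂) x|) ^ q *
      ∑ _x : (Fin r₂ × Fin r₁) ⊕ ((Fin r₂ × Fin v₁) ⊕ ((Fin v₂ × Fin r₁) ⊕ (Fin v₂ × Fin v₁))),
        max C₁ C₂
  refine ⟨∑ a, ∑ i, |c a i|, fun t a i => ?_⟩
  have hle : ∀ ω, |Y t ω a i| ^ q ≤ (∑ x, |blockCoeff (Pi.single a 1 ᵥ* L₁)
      (Pi.single a 1 ᵥ* L₂) (Pi.single i 1 ᵥ* R₁) (Pi.single i 1 ᵥ* R₂) x|) ^ q *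
      ∑ x, |stacked F Z₁₂ Z₂₁ Z₂₂ t x ω| ^ q := fun ω => by
    rw [h.entry_eq]
    exact abs_sum_mul_rpow_le _ _ hq
  have hint := (integrable_finsetSum Finset.univ fun x _ => (hst t x).1).const_mul
    ((∑ x, |blockCoeff (Pi.single a 1 ᵥ* L₁)
      (Pi.single a 1 ᵥ* L₂) (Pi.single i 1 ᵥ* R₁) (Pi.single i 1 ᵥ* R₂) x|) ^ q)
  constructor
  · refine hint.mono' ((h.measurable_entry t a i).abs.pow_const q).aestronglyMeasurable
      (Filter.Eventually.of_forall fun ω => ?_)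
    rw [Real.norm_of_nonneg (by positivity)]
    exact hle ω
  · calc ∫ ω, |Y t ω a i| ^ q ∂μ ≤ _ :=
          integral_mono_of_nonneg (Filter.Eventually.of_forall fun ω => by positivity) hint
            (Filter.Eventually.of_forall hle)
      _ ≤ c a i := by
          rw [integral_const_mul, integral_finsetSum _ fun x _ => (hst t x).1]
          exact mul_le_mul_of_nonneg_left (Finset.sum_le_sum fun x _ => (hst t x).2)
            (by positivity)
      _ ≤ |c a i| := le_abs_self _
      _ ≤ ∑ i, |c a i| := Finset.single_le_sum (f := fun i => |c a i|)
          (fun _ _ => abs_nonneg _) (Finset.mem_univ i)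
      _ ≤ _ := Finset.single_le_sum (f := fun a => ∑ i, |c a i|)
          (fun _ _ => Finset.sum_nonneg fun _ _ => abs_nonneg _) (Finset.mem_univ a)

/-- Covariances of linear forms, one of which is free of the factors. -/
lemma Model.cov_form [IsProbabilityMeasure μ] (h : Model μ L₁ L₂ R₁ R₂ F Z₁₂ Z₂₁ Z₂₂ Y)
    {u : Fin p₁ → ℝ} (hu : u ᵥ* L₁ = 0) (w : Fin p₂ → ℝ) (u' : Fin p₁ → ℝ) (w' : Fin p₂ → ℝ)
    (s t : ℤ) :
    cov[fun ω => u ⬝ᵥ (Y s ω *ᵥ w), fun ω => u' ⬝ᵥ (Y t ω *ᵥ w'); μ] =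
      if s = t then ((u ᵥ* L₂) ⬝ᵥ (u' ᵥ* L₂)) *
        ((w ᵥ* R₁) ⬝ᵥ (w' ᵥ* R₁) + (w ᵥ* R₂) ⬝ᵥ (w' ᵥ* R₂)) else 0 := by
  simp only [h.form_eq, hu]
  rw [covariance_fun_sum_fun_sum (fun x => (h.memLp_stacked s x).const_mul _)
    (fun x => (h.memLp_stacked t x).const_mul _)]
  simp only [covariance_const_mul_left, covariance_const_mul_right]
  -- As u'L₁ = 0, the factor has coefficient 0 on the left, so factor autocovariances never enter.
  -- Factor-noise covariances vanish, and the noise covariance is the identity at equal times and 0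
  -- otherwise.
  have hcov : ∀ x y, blockCoeff (u' ᵥ* L₁) (u' ᵥ* L₂) (w' ᵥ* R₁) (w' ᵥ* R₂) y *
      (blockCoeff 0 (u ᵥ* L₂) (w ᵥ* R₁) (w ᵥ* R₂) x *
        cov[stacked F Z₁₂ Z₂₁ Z₂₂ s x, stacked F Z₁₂ Z₂₁ Z₂₂ t y; μ]) =
      if x = y then (if s = t then blockCoeff 0 (u ᵥ* L₂) (w ᵥ* R₁) (w ᵥ* R₂) x *
      blockCoeff (u' ᵥ* L₁) (u' ᵥ* L₂) (w' ᵥ* R₁) (w' ᵥ* R₂) x else 0) else 0 := by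
    rintro (x | x) (y | y)
    · simp [blockCoeff]
    · simp [blockCoeff]
    · have e : cov[stacked F Z₁₂ Z₂₁ Z₂₂ s (Sum.inr x), stacked F Z₁₂ Z₂₁ Z₂₂ t (Sum.inl y); μ]
          = 0 := by
        rw [covariance_comm]
        exact h.uncorrelated t s y x
      simp [e]
    · by_cases hst : s = t
      · subst hst
        have e : cov[stacked F Z₁₂ Z₂₁ Z₂₂ s (Sum.inr x), stacked F Z₁₂ Z₂₁ Z₂₂ s (Sum.inr y); μ]
            = if x = y then 1 else 0 := h.noise.cov_eq s x y
        rw [e]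
        by_cases hxy : x = y
        · subst hxy; simp [mul_comm]
        · simp [hxy]
      · have e : cov[stacked F Z₁₂ Z₂₁ Z₂₂ s (Sum.inr x), stacked F Z₁₂ Z₂₁ Z₂₂ t (Sum.inr y); μ]
            = 0 := h.white s t hst x y
        simp [e, hst]
  simp only [hcov, Finset.sum_ite_eq, Finset.mem_univ, if_true]
  by_cases hst : s = t
  · simp only [hst, if_true, Fintype.sum_sum_type, blockCoeff, Sum.elim_inl, Sum.elim_inr,
      Pi.zero_apply, zero_mul, Finset.sum_const_zero, zero_add]
    have e : ∀ {m n : ℕ} (a a' : Fin m → ℝ) (b b' : Fin n → ℝ),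
        ∑ x : Fin n × Fin m, a x.2 * b x.1 * (a' x.2 * b' x.1) = (a ⬝ᵥ a') * (b ⬝ᵥ b') := by
      intro m n a a' b b'
      rw [Fintype.sum_prod_type, Finset.sum_comm]
      simp only [dotProduct, Finset.sum_mul_sum]
      exact Finset.sum_congr rfl fun i _ => Finset.sum_congr rfl fun j _ => by ring
    rw [e, e]
    ring
  · simp [hst]

end Model

end MatrixFactor

/-! ### Half-orthonormal decompositions of the loadings, and population moments -/

namespace MatrixFactor

open scoped Matrix Kronecker Matrix.Norms.Frobenius

/-- The decomposition of a full-rank loading matrix `(L₁, L₂)` into half-orthonormal and square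
factors, with orthonormal complements. -/
structure LoadingDecomposition {p r v : ℕ} (L₁ A₁ : Matrix (Fin p) (Fin r) ℝ)
    (L₂ A₂ : Matrix (Fin p) (Fin v) ℝ) (W₁ : Matrix (Fin r) (Fin r) ℝ)
    (W₂ : Matrix (Fin v) (Fin v) ℝ) (B₁ : Matrix (Fin p) (Fin v) ℝ)
    (B₂ : Matrix (Fin p) (Fin r) ℝ) : Prop where
  dim : r + v = p
  rank : (Matrix.fromCols L₁ L₂).rank = p
  half_A₁ : HalfOrthonormal A₁
  half_A₂ : HalfOrthonormal A₂
  half_B₁ : HalfOrthonormal B₁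
  half_B₂ : HalfOrthonormal B₂
  eq₁ : L₁ = A₁ * W₁
  eq₂ : L₂ = A₂ * W₂
  orth₁ : B₁ᵀ * A₁ = 0
  orth₂ : B₂ᵀ * A₂ = 0

namespace LoadingDecomposition

variable {p r v : ℕ} {L₁ A₁ : Matrix (Fin p) (Fin r) ℝ} {L₂ A₂ : Matrix (Fin p) (Fin v) ℝ}
  {W₁ : Matrix (Fin r) (Fin r) ℝ} {W₂ : Matrix (Fin v) (Fin v) ℝ} {B₁ : Matrix (Fin p) (Fin v) ℝ}
  {B₂ : Matrix (Fin p) (Fin r) ℝ}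

lemma independent (d : LoadingDecomposition L₁ A₁ L₂ A₂ W₁ W₂ B₁ B₂) :
    LoadingsIndependent L₁ L₂ :=
  loadingsIndependent_of_rank d.dim d.rank

lemma complement₁ (d : LoadingDecomposition L₁ A₁ L₂ A₂ W₁ W₂ B₁ B₂) :
    A₁ * A₁ᵀ + B₁ * B₁ᵀ = 1 :=
  d.half_A₁.mul_transpose_add d.half_B₁ d.orth₁ d.dim

lemma complement₂ (d : LoadingDecomposition L₁ A₁ L₂ A₂ W₁ W₂ B₁ B₂) :
    A₂ * A₂ᵀ + B₂ * B₂ᵀ = 1 :=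
  d.half_A₂.mul_transpose_add d.half_B₂ d.orth₂ (by rw [add_comm]; exact d.dim)

lemma orth_L₁ (d : LoadingDecomposition L₁ A₁ L₂ A₂ W₁ W₂ B₁ B₂) : B₁ᵀ * L₁ = 0 := by
  rw [d.eq₁, ← Matrix.mul_assoc, d.orth₁, Matrix.zero_mul]

lemma orth_L₂ (d : LoadingDecomposition L₁ A₁ L₂ A₂ W₁ W₂ B₁ B₂) : B₂ᵀ * L₂ = 0 := by
  rw [d.eq₂, ← Matrix.mul_assoc, d.orth₂, Matrix.zero_mul]

/-- B₂ is a complement of L₂, so B₂'L₁ = (B₂'A₁)W₁ is invertible, hence so is its first factor. -/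
lemma isUnit_B₂A₁ (d : LoadingDecomposition L₁ A₁ L₂ A₂ W₁ W₂ B₁ B₂) : IsUnit (B₂ᵀ * A₁) := by
  have h := d.independent.symm.isUnit_complement d.eq₂ d.complement₂
  rw [d.eq₁, ← Matrix.mul_assoc, Matrix.isUnit_iff_isUnit_det, Matrix.det_mul] at h
  rw [Matrix.isUnit_iff_isUnit_det]
  exact isUnit_of_mul_isUnit_left h

/-- L₂ = A₂W₂ has the left inverse W₂⁻¹A₂', and L₂'B₁ is square and invertible. This full column
rank determines the rank of the population noise matrix. -/
lemma exists_left_inverse (d : LoadingDecomposition L₁ A₁ L₂ A₂ W₁ W₂ B₁ B₂) :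
    ∃ G : Matrix (Fin v) (Fin p) ℝ, G * (L₂ * (L₂ᵀ * B₁)) = 1 := by
  have hW := (Matrix.isUnit_iff_isUnit_det _).1 (d.independent.symm.isUnit_left d.eq₂)
  have hB := (Matrix.isUnit_iff_isUnit_det _).1
    (d.independent.isUnit_complement d.eq₁ d.complement₁)
  have hB' : IsUnit (L₂ᵀ * B₁).det := by
    rw [← Matrix.det_transpose]; simpa using hB
  have hA : A₂ᵀ * A₂ = 1 := d.half_A₂
  refine ⟨(L₂ᵀ * B₁)⁻¹ * (W₂⁻¹ * A₂ᵀ), ?_⟩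
  have h1 : W₂⁻¹ * A₂ᵀ * L₂ = 1 := by
    rw [d.eq₂, Matrix.mul_assoc, ← Matrix.mul_assoc A₂ᵀ, hA, Matrix.one_mul,
      Matrix.nonsing_inv_mul _ hW]
  rw [Matrix.mul_assoc, ← Matrix.mul_assoc _ L₂, h1, Matrix.one_mul,
    Matrix.nonsing_inv_mul _ hB']

end LoadingDecomposition

/-! ### Population moments -/

section Population

variable {Ω : Type*} [mΩ : MeasurableSpace Ω] {μ : Measure Ω}

/-- `Ω_{y_i} = Cov(y_{i,t}, vec(Y_t))`, at `t = 0`. -/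
noncomputable def covOmega {p q : ℕ} (μ : Measure Ω) (Y : ℤ → Ω → Matrix (Fin p) (Fin q) ℝ)
    (i : Fin q) : Matrix (Fin p) (Fin q × Fin p) ℝ :=
  Matrix.of fun a x => autoCov μ Y i x.1 0 a x.2

/-- The population version of `sampleNoiseMatrix`. -/
noncomputable def noiseMatrix {p q v w : ℕ} (μ : Measure Ω) (Y : ℤ → Ω → Matrix (Fin p) (Fin q) ℝ)
    (Q : Matrix (Fin q) (Fin w) ℝ) (B : Matrix (Fin p) (Fin v) ℝ) : Matrix (Fin p) (Fin p) ℝ :=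
  ∑ i : Fin q, (covOmega μ Y i * (Q ⊗ₖ B)) * (covOmega μ Y i * (Q ⊗ₖ B))ᵀ

/-- Placing the matrices side by side writes the sum as TT', the form needed by `exists_gap`. -/
lemma sum_mul_transpose_eq_gram {p q : ℕ} {ι : Type*} [Fintype ι]
    (C : ι → Matrix (Fin p) (Fin q) ℝ) :
    ∑ x, C x * (C x)ᵀ = (Matrix.of fun a (x : ι × Fin q) => C x.1 a x.2) *
      (Matrix.of fun a (x : ι × Fin q) => C x.1 a x.2)ᵀ := by
  ext a b
  simp [Matrix.sum_apply, Matrix.mul_apply, Fintype.sum_prod_type]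

lemma lagMatrix_eq_sum {p q : ℕ} (Y : ℤ → Ω → Matrix (Fin p) (Fin q) ℝ) (k₀ : ℕ) :
    lagMatrix μ Y k₀ = ∑ x : Finset.Icc 1 k₀ × Fin q × Fin q,
      autoCov μ Y x.2.1 x.2.2 x.1 * (autoCov μ Y x.2.1 x.2.2 x.1)ᵀ := by
  rw [lagMatrix, ← Finset.sum_coe_sort]
  simp only [Fintype.sum_prod_type]

variable {p₁ p₂ r₁ r₂ v₁ v₂ : ℕ}
  {L₁ A₁ : Matrix (Fin p₁) (Fin r₁) ℝ} {L₂ A₂ : Matrix (Fin p₁) (Fin v₁) ℝ}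
  {R₁ P₁ : Matrix (Fin p₂) (Fin r₂) ℝ} {R₂ P₂ : Matrix (Fin p₂) (Fin v₂) ℝ}
  {F : ℤ → Ω → Matrix (Fin r₁) (Fin r₂) ℝ} {Z₁₂ : ℤ → Ω → Matrix (Fin r₁) (Fin v₂) ℝ}
  {Z₂₁ : ℤ → Ω → Matrix (Fin v₁) (Fin r₂) ℝ} {Z₂₂ : ℤ → Ω → Matrix (Fin v₁) (Fin v₂) ℝ}
  {Y : ℤ → Ω → Matrix (Fin p₁) (Fin p₂) ℝ}
  {W₁ : Matrix (Fin r₁) (Fin r₁) ℝ} {W₂ : Matrix (Fin v₁) (Fin v₁) ℝ}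
  {G₁ : Matrix (Fin r₂) (Fin r₂) ℝ} {G₂ : Matrix (Fin v₂) (Fin v₂) ℝ}
  {B₁ : Matrix (Fin p₁) (Fin v₁) ℝ} {B₂ : Matrix (Fin p₁) (Fin r₁) ℝ}
  {Q₁ : Matrix (Fin p₂) (Fin v₂) ℝ} {Q₂ : Matrix (Fin p₂) (Fin r₂) ℝ}

lemma Model.memLp_entry (h : Model μ L₁ L₂ R₁ R₂ F Z₁₂ Z₂₁ Z₂₂ Y) (t : ℤ) (a : Fin p₁)
    (i : Fin p₂) : MemLp (fun ω => Y t ω a i) 2 μ :=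
  h.stationary.memLp t (i, a)

lemma Model.sum_cov_entry [IsProbabilityMeasure μ] (h : Model μ L₁ L₂ R₁ R₂ F Z₁₂ Z₂₁ Z₂₂ Y)
    {u : Fin p₁ → ℝ} (hu : u ᵥ* L₁ = 0) (w : Fin p₂ → ℝ) (b : Fin p₁) (j : Fin p₂) (s t : ℤ) :
    ∑ a, ∑ i, u a * w i * cov[fun ω => Y s ω a i, fun ω => Y t ω b j; μ] =
      if s = t then ((u ᵥ* L₂) ⬝ᵥ L₂ b) * ((w ᵥ* R₁) ⬝ᵥ R₁ j + (w ᵥ* R₂) ⬝ᵥ R₂ j) else 0 := by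
  have key := h.cov_form hu w (Pi.single b 1) (Pi.single j 1) s t
  have e : ∀ ω, u ⬝ᵥ (Y s ω *ᵥ w) = ∑ x : Fin p₁ × Fin p₂, u x.1 * w x.2 * Y s ω x.1 x.2 := by
    intro ω
    rw [Fintype.sum_prod_type]
    simp only [dotProduct, Matrix.mulVec, Finset.mul_sum]
    exact Finset.sum_congr rfl fun i _ => Finset.sum_congr rfl fun j _ => by ring
  have e' : ∀ ω, Pi.single b 1 ⬝ᵥ (Y t ω *ᵥ Pi.single j 1) = Y t ω b j := by
    intro ω; simp
  simp only [e, e'] at key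
  have hX : ∀ x : Fin p₁ × Fin p₂, MemLp (fun ω => u x.1 * w x.2 * Y s ω x.1 x.2) 2 μ :=
    fun x => (h.memLp_entry s x.1 x.2).const_mul _
  rw [covariance_fun_sum_left hX (h.memLp_entry t b j), Fintype.sum_prod_type] at key
  simp only [covariance_const_mul_left, Matrix.single_one_vecMul] at key
  exact key

/-- B₁'Y_t is free of the factor, so it is uncorrelated with the observations at every other time;
this is where k ≥ 1 is needed. -/
lemma Model.autoCov_transpose_mul [IsProbabilityMeasure μ]
    (h : Model μ L₁ L₂ R₁ R₂ F Z₁₂ Z₂₁ Z₂₂ Y) (hB : B₁ᵀ * L₁ = 0) (i j : Fin p₂) {k : ℕ}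
    (hk : 1 ≤ k) : (autoCov μ Y i j k)ᵀ * B₁ = 0 := by
  ext b c
  have hu : B₁ᵀ c ᵥ* L₁ = 0 := by
    ext x; exact congrFun (congrFun hB c) x
  have key := h.sum_cov_entry hu (Pi.single i 1) b j 0 (-(k : ℤ))
  rw [if_neg (by omega)] at key
  rw [Matrix.zero_apply, ← key, Matrix.mul_apply]
  refine Finset.sum_congr rfl fun a _ => ?_
  rw [Finset.sum_eq_single i]
  · simp [autoCov, mul_comm]
  · intro x _ hx; simp [hx]
  · simp

lemma Model.lagMatrix_mul [IsProbabilityMeasure μ]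
    (h : Model μ L₁ L₂ R₁ R₂ F Z₁₂ Z₂₁ Z₂₂ Y) (hB : B₁ᵀ * L₁ = 0) (k₀ : ℕ) :
    lagMatrix μ Y k₀ * B₁ = 0 := by
  rw [lagMatrix_eq_sum, Matrix.sum_mul]
  refine Finset.sum_eq_zero fun x _ => ?_
  rw [Matrix.mul_assoc, h.autoCov_transpose_mul hB _ _ (Finset.mem_Icc.1 x.1.2).1, Matrix.mul_zero]

/-- The form b'Y_t q with b'L₁ = 0 and q'R₁ = 0 involves only Z₂₂, whose identity covariance makes
the row and column parts separate into a product. -/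
lemma Model.covOmega_mul [IsProbabilityMeasure μ]
    (h : Model μ L₁ L₂ R₁ R₂ F Z₁₂ Z₂₁ Z₂₂ Y) (hB : B₁ᵀ * L₁ = 0) (hQ : Q₁ᵀ * R₁ = 0)
    (i : Fin p₂) (a : Fin p₁) (x : Fin v₂ × Fin v₁) :
    (covOmega μ Y i * (Q₁ ⊗ₖ B₁)) a x = (L₂ * (L₂ᵀ * B₁)) a x.2 * (R₂ * (R₂ᵀ * Q₁)) i x.1 := by
  have hu : B₁ᵀ x.2 ᵥ* L₁ = 0 := by
    ext y; exact congrFun (congrFun hB x.2) y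
  have hw : Q₁ᵀ x.1 ᵥ* R₁ = 0 := by
    ext y; exact congrFun (congrFun hQ x.1) y
  have key := h.sum_cov_entry hu (Q₁ᵀ x.1) a i 0 0
  rw [if_pos rfl, hw, zero_dotProduct, zero_add] at key
  have e : ∀ {p m n : ℕ} (L : Matrix (Fin p) (Fin m) ℝ) (B : Matrix (Fin p) (Fin n) ℝ) (a y),
      (Bᵀ y ᵥ* L) ⬝ᵥ L a = (L * (Lᵀ * B)) a y := by
    intro p m n L B a y
    rw [dotProduct_comm, Matrix.mul_apply]
    simp only [dotProduct, Matrix.vecMul, Matrix.mul_apply, Matrix.transpose_apply, mul_comm]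
  rw [← e, ← e, ← key, Matrix.mul_apply, Fintype.sum_prod_type, Finset.sum_comm]
  refine Finset.sum_congr rfl fun b _ => Finset.sum_congr rfl fun j _ => ?_
  rw [covariance_comm]
  simp only [covOmega, autoCov, Matrix.of_apply, Matrix.kroneckerMap_apply, Nat.cast_zero,
    neg_zero, Matrix.transpose_apply]
  ring

/-- After the separation of `Model.covOmega_mul`, summing the squares of the column parts yields
only the scalar ‖R₂R₂'Q₁‖², which is split evenly to display a Gram matrix. -/
lemma Model.noiseMatrix_eq [IsProbabilityMeasure μ]
    (h : Model μ L₁ L₂ R₁ R₂ F Z₁₂ Z₂₁ Z₂₂ Y) (hB : B₁ᵀ * L₁ = 0) (hQ : Q₁ᵀ * R₁ = 0) :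
    noiseMatrix μ Y Q₁ B₁ = (‖R₂ * (R₂ᵀ * Q₁)‖ • (L₂ * (L₂ᵀ * B₁))) *
      (‖R₂ * (R₂ᵀ * Q₁)‖ • (L₂ * (L₂ᵀ * B₁)))ᵀ := by
  have key := h.covOmega_mul hB hQ
  generalize L₂ * (L₂ᵀ * B₁) = X at key ⊢
  generalize R₂ * (R₂ᵀ * Q₁) = V at key ⊢
  rw [Matrix.transpose_smul, Matrix.smul_mul, Matrix.mul_smul, smul_smul, ← pow_two,
    frobenius_norm_sq]
  ext a b
  rw [noiseMatrix, Matrix.sum_apply, Matrix.smul_apply, Matrix.mul_apply, smul_eq_mul,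
    Finset.sum_mul]
  refine Finset.sum_congr rfl fun i _ => ?_
  rw [Matrix.mul_apply]
  simp only [Matrix.transpose_apply, key, Fintype.sum_prod_type, Finset.sum_mul, Finset.mul_sum]
  rw [Finset.sum_comm]
  refine Finset.sum_congr rfl fun c _ => Finset.sum_congr rfl fun w _ => ?_
  ring

/-- The curvature of the quadratic form of a matrix at the projector `A A'`. -/
def HasGap {p r : ℕ} (M : Matrix (Fin p) (Fin p) ℝ) (A : Matrix (Fin p) (Fin r) ℝ) (δ : ℝ) : Prop :=
  ∀ (q : ℕ) (K : Matrix (Fin p) (Fin q) ℝ),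
    δ * (Kᵀ * (A * Aᵀ) * K).trace ≤ (Kᵀ * M * K).trace

lemma Model.exists_hasGap_lagMatrix [IsProbabilityMeasure μ]
    (h : Model μ L₁ L₂ R₁ R₂ F Z₁₂ Z₂₁ Z₂₂ Y)
    (d : LoadingDecomposition L₁ A₁ L₂ A₂ W₁ W₂ B₁ B₂) {k₀ : ℕ}
    (hrank : (lagMatrix μ Y k₀).rank = r₁) :
    ∃ δ : ℝ, 0 < δ ∧ HasGap (lagMatrix μ Y k₀) A₁ δ := by
  have hz := h.lagMatrix_mul d.orth_L₁ k₀
  rw [lagMatrix_eq_sum, sum_mul_transpose_eq_gram fun x : Finset.Icc 1 k₀ × Fin p₂ × Fin p₂ =>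
    autoCov μ Y x.2.1 x.2.2 x.1] at hz hrank ⊢
  exact exists_gap hz d.complement₁ hrank

lemma Model.noiseMatrix_mul [IsProbabilityMeasure μ]
    (h : Model μ L₁ L₂ R₁ R₂ F Z₁₂ Z₂₁ Z₂₂ Y)
    (d : LoadingDecomposition L₁ A₁ L₂ A₂ W₁ W₂ B₁ B₂)
    (d' : LoadingDecomposition R₁ P₁ R₂ P₂ G₁ G₂ Q₁ Q₂) :
    noiseMatrix μ Y Q₁ B₁ * B₂ = 0 := by
  have h0 : L₂ᵀ * B₂ = 0 := by
    have := congrArg Matrix.transpose d.orth_L₂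
    simpa using this
  rw [h.noiseMatrix_eq d.orth_L₁ d'.orth_L₁, Matrix.mul_assoc, Matrix.transpose_smul,
    Matrix.smul_mul _ _ B₂, Matrix.transpose_mul, Matrix.mul_assoc _ L₂ᵀ B₂, h0]
  simp

lemma Model.exists_hasGap_noiseMatrix [IsProbabilityMeasure μ]
    (h : Model μ L₁ L₂ R₁ R₂ F Z₁₂ Z₂₁ Z₂₂ Y) (hv₂ : 0 < v₂)
    (d : LoadingDecomposition L₁ A₁ L₂ A₂ W₁ W₂ B₁ B₂)
    (d' : LoadingDecomposition R₁ P₁ R₂ P₂ G₁ G₂ Q₁ Q₂) :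
    ∃ δ : ℝ, 0 < δ ∧ HasGap (noiseMatrix μ Y Q₁ B₁) A₂ δ := by
  have hz := h.noiseMatrix_mul d d'
  -- A zero matrix with a left inverse would give 0 = 1 in dimension v₂, impossible for v₂ > 0.
  have hc : ‖R₂ * (R₂ᵀ * Q₁)‖ ≠ 0 := by
    intro h0
    obtain ⟨G, hG⟩ := d'.exists_left_inverse
    rw [norm_eq_zero.1 h0, Matrix.mul_zero] at hG
    have := congrFun (congrFun hG ⟨0, hv₂⟩) ⟨0, hv₂⟩
    simp at this
  rw [h.noiseMatrix_eq d.orth_L₁ d'.orth_L₁] at hz ⊢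
  refine exists_gap hz d.complement₂ ?_
  rw [Matrix.rank_self_mul_transpose]
  obtain ⟨G, hG⟩ := d.exists_left_inverse
  refine le_antisymm (by simpa using Matrix.rank_le_width _) ?_
  have e : (‖R₂ * (R₂ᵀ * Q₁)‖⁻¹ • G) * (‖R₂ * (R₂ᵀ * Q₁)‖ • (L₂ * (L₂ᵀ * B₁))) = 1 := by
    rw [Matrix.smul_mul, Matrix.mul_smul, hG, smul_smul, inv_mul_cancel₀ hc, one_smul]
  have h1 := Matrix.rank_mul_le_right (‖R₂ * (R₂ᵀ * Q₁)‖⁻¹ • G)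
    (‖R₂ * (R₂ᵀ * Q₁)‖ • (L₂ * (L₂ᵀ * B₁)))
  rw [e, Matrix.rank_one, Fintype.card_fin] at h1
  exact h1

end Population

end MatrixFactor

namespace MatrixFactor

open scoped Matrix Kronecker Matrix.Norms.Frobenius

/-! ### Consistency of the estimators -/

section Consistency

open Filter Asymptotics Topology

variable {T : Type*} {l : Filter T} {e : T → ℝ} {Ω : Type*} [mΩ : MeasurableSpace Ω]
  {μ : Measure Ω}

lemma IsClose.of_entries {m n : Type*} [Fintype m] [Fintype n] {X : T → Matrix m n ℝ}
    {X₀ : Matrix m n ℝ} (h : ∀ i j, (fun t => X t i j - X₀ i j) =O[l] e) : IsClose l e X X₀ := by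
  have h1 : (fun t => ∑ i, ∑ j, |X t i j - X₀ i j|) =O[l] e :=
    IsBigO.fun_sum fun i _ => IsBigO.fun_sum fun j _ => (h i j).abs_left
  refine IsBigO.trans (IsBigO.of_bound 1 (Eventually.of_forall fun t => ?_)) h1
  rw [one_mul, Real.norm_of_nonneg (by positivity)]
  exact frobenius_norm_le_sum (X t - X₀)

lemma IsClose.entry {m n : Type*} [Fintype m] [Fintype n] {X : T → Matrix m n ℝ}
    {X₀ : Matrix m n ℝ} (h : IsClose l e X X₀) (i : m) (j : n) :
    (fun t => X t i j - X₀ i j) =O[l] e :=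
  (IsBigO.of_bound 1 (Eventually.of_forall fun t => by
    rw [one_mul]; exact abs_entry_le_frobenius_norm (X t - X₀) i j)).trans h

variable {p q : ℕ} {Y : ℤ → Ω → Matrix (Fin p) (Fin q) ℝ} {y : T → ℤ → Matrix (Fin p) (Fin q) ℝ}
  {n : T → ℕ}

lemma IsClose.sampleLagMatrix (he : Tendsto e l (𝓝 0)) {k₀ : ℕ}
    (h : ∀ k ≤ k₀, ∀ i j, IsClose l e (fun t => sampleAutoCov (y t) (n t) i j k)
      (autoCov μ Y i j k)) :
    IsClose l e (fun t => MatrixFactor.sampleLagMatrix (y t) k₀ (n t)) (lagMatrix μ Y k₀) :=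
  IsClose.sum fun k hk => IsClose.sum fun i _ => IsClose.sum fun j _ =>
    (h k (Finset.mem_Icc.1 hk).2 i j).mul he (h k (Finset.mem_Icc.1 hk).2 i j).transpose

lemma sampleOmega_apply {p q : ℕ} (y : ℤ → Matrix (Fin p) (Fin q) ℝ) (n : ℕ) (i : Fin q)
    (a : Fin p) (x : Fin q × Fin p) :
    sampleOmega y n i a x = sampleAutoCov y n i x.1 0 a x.2 := by
  simp [sampleOmega, sampleAutoCov, Matrix.sum_apply, Matrix.vecMulVec_apply, Matrix.vec,
    Matrix.col]

lemma IsClose.sampleOmega (h : ∀ i j, IsClose l e (fun t => sampleAutoCov (y t) (n t) i j 0)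
      (autoCov μ Y i j 0)) (i : Fin q) :
    IsClose l e (fun t => MatrixFactor.sampleOmega (y t) (n t) i) (covOmega μ Y i) := by
  refine IsClose.of_entries fun a x => ?_
  simp only [sampleOmega_apply]
  exact (h i x.1).entry a x.2

/-- Ŝ depends on the first-stage estimates only through their projectors. This is essential, as
orthonormal eigenvectors are not unique and need not converge. -/
lemma mul_kronecker_mul_transpose {v w : ℕ} (X : Matrix (Fin p) (Fin q × Fin p) ℝ)
    (Q : Matrix (Fin q) (Fin w) ℝ) (B : Matrix (Fin p) (Fin v) ℝ) :
    X * (Q ⊗ₖ B) * (X * (Q ⊗ₖ B))ᵀ = X * ((Q * Qᵀ) ⊗ₖ (B * Bᵀ)) * Xᵀ := by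
  rw [Matrix.mul_kronecker_mul, Matrix.transpose_mul, Matrix.kroneckerMap_transpose]
  simp only [Matrix.mul_assoc]

lemma IsClose.sampleNoiseMatrix (he : Tendsto e l (𝓝 0)) {v w : ℕ}
    (h : ∀ i j, IsClose l e (fun t => sampleAutoCov (y t) (n t) i j 0) (autoCov μ Y i j 0))
    {Q : T → Matrix (Fin q) (Fin w) ℝ} {Q₀ : Matrix (Fin q) (Fin w) ℝ}
    {B : T → Matrix (Fin p) (Fin v) ℝ} {B₀ : Matrix (Fin p) (Fin v) ℝ}
    (hQ : IsClose l e (fun t => Q t * (Q t)ᵀ) (Q₀ * Q₀ᵀ))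
    (hB : IsClose l e (fun t => B t * (B t)ᵀ) (B₀ * B₀ᵀ)) :
    IsClose l e (fun t => MatrixFactor.sampleNoiseMatrix (y t) (Q t) (B t) (n t))
      (noiseMatrix μ Y Q₀ B₀) := by
  simp only [MatrixFactor.sampleNoiseMatrix, noiseMatrix, mul_kronecker_mul_transpose]
  exact IsClose.sum fun i _ => ((IsClose.sampleOmega h i).mul he (hQ.kronecker he hB)).mul he
    (IsClose.sampleOmega h i).transpose

lemma IsClose.top_projector {r v : ℕ} {N : T → Matrix (Fin p) (Fin p) ℝ}
    {M : Matrix (Fin p) (Fin p) ℝ} (hN : IsClose l e N M) {A : Matrix (Fin p) (Fin r) ℝ}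
    {B : Matrix (Fin p) (Fin v) ℝ} (hMB : M * B = 0) (hAB : A * Aᵀ + B * Bᵀ = 1)
    (hA : HalfOrthonormal A) (hgap : ∃ δ : ℝ, 0 < δ ∧ HasGap M A δ)
    {H : T → Matrix (Fin p) (Fin r) ℝ} (hH : ∀ t, IsTopEigenvectors (N t) (H t)) :
    IsClose l e (fun t => H t * (H t)ᵀ) (A * Aᵀ) := by
  obtain ⟨δ, hδ, hg⟩ := hgap
  exact hN.of_norm_sub_le (2 / δ) fun t => (hH t).norm_projector_sub_le_of_gap hδ hMB hAB hA hg

lemma IsClose.bottom_projector {r v : ℕ} {N : T → Matrix (Fin p) (Fin p) ℝ}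
    {M : Matrix (Fin p) (Fin p) ℝ} (hN : IsClose l e N M) {A : Matrix (Fin p) (Fin r) ℝ}
    {B : Matrix (Fin p) (Fin v) ℝ} (hMB : M * B = 0) (hAB : A * Aᵀ + B * Bᵀ = 1)
    (hB : HalfOrthonormal B) (hgap : ∃ δ : ℝ, 0 < δ ∧ HasGap M A δ)
    {H : T → Matrix (Fin p) (Fin v) ℝ} (hH : ∀ t, IsBottomEigenvectors (N t) (H t)) :
    IsClose l e (fun t => H t * (H t)ᵀ) (B * Bᵀ) := by
  obtain ⟨δ, hδ, hg⟩ := hgap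
  exact hN.of_norm_sub_le (2 / δ) fun t => (hH t).norm_projector_sub_le_of_gap hδ hMB hAB hB hg

lemma isBigO_discrepancy {r : ℕ} (hr : 0 < r) {H : T → Matrix (Fin p) (Fin r) ℝ}
    {V : Matrix (Fin p) (Fin r) ℝ} (hH : ∀ t, HalfOrthonormal (H t)) (hV : HalfOrthonormal V)
    (h : IsClose l e (fun t => H t * (H t)ᵀ) (V * Vᵀ)) :
    (fun t => discrepancy (H t) V) =O[l] e :=
  (IsBigO.of_bound 1 (Eventually.of_forall fun t => by
    rw [one_mul]; exact discrepancy_le hr (hH t) hV)).trans h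

/-- The oblique projector onto the column space of `A` along the orthogonal complement of that
of `B`. -/
noncomputable def oblique {p r : ℕ} (A B : Matrix (Fin p) (Fin r) ℝ) : Matrix (Fin p) (Fin p) ℝ :=
  A * ((Bᵀ * A)⁻¹ * Bᵀ)

/-- Only the orthogonal projectors are assumed close; `oblique_eq` writes the oblique one as
products and an inverse of those. -/
lemma IsClose.oblique (he : Tendsto e l (𝓝 0)) {r : ℕ} {A B : T → Matrix (Fin p) (Fin r) ℝ}
    {A₀ B₀ : Matrix (Fin p) (Fin r) ℝ} (hA : ∀ t, HalfOrthonormal (A t)) (hA₀ : HalfOrthonormal A₀)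
    (hu : IsUnit (B₀ᵀ * A₀)) (hAc : IsClose l e (fun t => A t * (A t)ᵀ) (A₀ * A₀ᵀ))
    (hBc : IsClose l e (fun t => B t * (B t)ᵀ) (B₀ * B₀ᵀ)) :
    IsClose l e (fun t => MatrixFactor.oblique (A t) (B t)) (MatrixFactor.oblique A₀ B₀) := by
  have hT := ((hAc.mul he hBc).mul he hAc).add ((IsClose.const 1).sub hAc)
  have hu₀ := isUnit_oblique hA₀ hu
  have hev := hT.eventually_isUnit he hu₀
  have h := (hT.inv he hu₀).mul he (hAc.mul he hBc)
  refine IsBigO.congr' h ?_ EventuallyEq.rfl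
  -- The formula through orthogonal projectors is available only where the matrix to be inverted is
  -- a unit, which holds eventually.
  filter_upwards [hev] with t ht
  simp only [MatrixFactor.oblique]
  rw [oblique_eq (hA t) ht, oblique_eq hA₀ hu₀]

/-- The estimated signal is a two-sided oblique projection of the observation. The identity is
purely associative and also holds with the convention that a singular matrix has inverse 0. -/
lemma mul_recoveredFactor_mul {p₁ p₂ r₁ r₂ : ℕ} (A B : Matrix (Fin p₁) (Fin r₁) ℝ)
    (P Q : Matrix (Fin p₂) (Fin r₂) ℝ) (X : Matrix (Fin p₁) (Fin p₂) ℝ) :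
    A * recoveredFactor A B P Q X * Pᵀ = oblique A B * X * (oblique P Q)ᵀ := by
  have e : (oblique P Q)ᵀ = Q * (Pᵀ * Q)⁻¹ * Pᵀ := by
    simp only [oblique, Matrix.transpose_mul, Matrix.transpose_nonsing_inv,
      Matrix.transpose_transpose]
  rw [e]
  simp only [recoveredFactor, oblique, Matrix.mul_assoc]

/-- The oblique projector fixes L₁ and annihilates L₂, because B₂'L₂ = 0. -/
lemma LoadingDecomposition.oblique_mul {p r v : ℕ} {L₁ A₁ : Matrix (Fin p) (Fin r) ℝ}
    {L₂ A₂ : Matrix (Fin p) (Fin v) ℝ} {W₁ : Matrix (Fin r) (Fin r) ℝ}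
    {W₂ : Matrix (Fin v) (Fin v) ℝ} {B₁ : Matrix (Fin p) (Fin v) ℝ}
    {B₂ : Matrix (Fin p) (Fin r) ℝ} (d : LoadingDecomposition L₁ A₁ L₂ A₂ W₁ W₂ B₁ B₂) :
    oblique A₁ B₂ * Matrix.fromCols L₁ L₂ = Matrix.fromCols L₁ 0 := by
  have hd := (Matrix.isUnit_iff_isUnit_det _).1 d.isUnit_B₂A₁
  have h1 : oblique A₁ B₂ * L₁ = L₁ := by
    calc oblique A₁ B₂ * L₁ = A₁ * ((B₂ᵀ * A₁)⁻¹ * (B₂ᵀ * A₁)) * W₁ := by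
          simp only [oblique, d.eq₁, Matrix.mul_assoc]
      _ = L₁ := by rw [Matrix.nonsing_inv_mul _ hd, Matrix.mul_one, d.eq₁]
  have h2 : oblique A₁ B₂ * L₂ = 0 := by
    simp only [oblique, Matrix.mul_assoc, d.orth_L₂, Matrix.mul_zero]
  rw [Matrix.mul_fromCols, h1, h2]

end Consistency

/-! ### From deterministic bounds to rates in probability -/

section Rates

open Filter Asymptotics Topology

variable {Ω : Type*} [mΩ : MeasurableSpace Ω] {μ : Measure Ω}

/-- Along the pullback of the neighbourhoods of 0 under e, a big-O bound says that ‖Z‖ ≤ C|e|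
whenever |e| is below some η, uniformly in n and ω. As e is small with high probability, the rate
follows. No measurability of Z is involved. -/
lemma IsBigOp.of_isBigO {E : Type*} [Norm E] {X : ℕ → Ω → ℝ} {e y : ℕ → Ω → ℝ} {a : ℕ → ℝ}
    (he : IsBigOp μ e a) (ha : Tendsto a atTop (𝓝 0)) (hy : IsBigOp μ y (fun _ => 1))
    (Z : ℕ → Ω → E) (hXZ : ∀ n ω, |X n ω| ≤ ‖Z n ω‖ * |y n ω|)
    (h : (fun t : ℕ × Ω => Z t.1 t.2) =O[comap (fun t : ℕ × Ω => e t.1 t.2) (𝓝 0)]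
      fun t => e t.1 t.2) : IsBigOp μ X a := by
  obtain ⟨C, hC⟩ := h.bound
  rw [eventually_comap, Metric.eventually_nhds_iff] at hC
  obtain ⟨η, hη, hC⟩ := hC
  refine he.of_local_le ha hy (C := C) (half_pos hη) fun n ω hle => (hXZ n ω).trans ?_
  have h1 : dist (e n ω) 0 < η := by
    rw [Real.dist_0_eq_abs]; linarith
  exact mul_le_mul_of_nonneg_right (hC h1 (n, ω) rfl) (abs_nonneg _)

lemma isBigOp_one : IsBigOp μ (fun _ _ => 1) (fun _ => 1) :=
  IsBigOp.of_abs_le _ 1 0 (fun _ _ => by simp) fun _ => zero_le_one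

/-- The total error of the sample autocovariances up to lag `k₀`. -/
noncomputable def momentError {p q : ℕ} (μ : Measure Ω) (Y : ℤ → Ω → Matrix (Fin p) (Fin q) ℝ)
    (k₀ n : ℕ) (ω : Ω) : ℝ :=
  ∑ k ∈ Finset.range (k₀ + 1), ∑ i, ∑ j,
    ‖sampleAutoCov (fun t => Y t ω) n i j k - autoCov μ Y i j k‖

lemma momentError_nonneg {p q : ℕ} (Y : ℤ → Ω → Matrix (Fin p) (Fin q) ℝ) (k₀ n : ℕ) (ω : Ω) :
    0 ≤ momentError μ Y k₀ n ω :=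
  Finset.sum_nonneg fun _ _ => Finset.sum_nonneg fun _ _ => Finset.sum_nonneg fun _ _ =>
    norm_nonneg _

lemma norm_sampleAutoCov_sub_le {p q : ℕ} (Y : ℤ → Ω → Matrix (Fin p) (Fin q) ℝ) {k₀ k : ℕ}
    (hk : k ≤ k₀) (n : ℕ) (ω : Ω) (i j : Fin q) :
    ‖sampleAutoCov (fun t => Y t ω) n i j k - autoCov μ Y i j k‖ ≤ momentError μ Y k₀ n ω := by
  let f : ℕ → Fin q → Fin q → ℝ := fun k i j =>
    ‖sampleAutoCov (fun t => Y t ω) n i j k - autoCov μ Y i j k‖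
  have hf : ∀ k i j, 0 ≤ f k i j := fun _ _ _ => norm_nonneg _
  calc f k i j ≤ ∑ j, f k i j :=
        Finset.single_le_sum (f := f k i) (fun j _ => hf k i j) (Finset.mem_univ j)
    _ ≤ ∑ i, ∑ j, f k i j := Finset.single_le_sum (f := fun i => ∑ j, f k i j)
        (fun i _ => Finset.sum_nonneg fun j _ => hf k i j) (Finset.mem_univ i)
    _ ≤ _ := Finset.single_le_sum (f := fun k => ∑ i, ∑ j, f k i j)
        (fun k _ => Finset.sum_nonneg fun i _ => Finset.sum_nonneg fun j _ => hf k i j)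
        (Finset.mem_range.2 (by omega))

lemma sampleAutoCov_apply {p q : ℕ} (y : ℤ → Matrix (Fin p) (Fin q) ℝ) (n : ℕ) (i j : Fin q)
    (k : ℕ) (a b : Fin p) :
    sampleAutoCov y n i j k a b = (1 / (n : ℝ)) * ∑ t ∈ Finset.Icc (k + 1) n,
      (y t a i - (1 / (n : ℝ)) * ∑ s ∈ Finset.Icc 1 n, y s a i) *
        (y (t - k) b j - (1 / (n : ℝ)) * ∑ s ∈ Finset.Icc 1 n, y s b j) := by
  simp [sampleAutoCov, sampleMean, Matrix.sum_apply, Matrix.vecMulVec_apply, Matrix.col]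

variable {E : Type*} [MeasurableSpace E] {V : ℤ → Ω → E}

lemma isBigOp_momentError [IsProbabilityMeasure μ] {p q : ℕ}
    {Y : ℤ → Ω → Matrix (Fin p) (Fin q) ℝ} (hV : ∀ t, Measurable (V t)) {γ K : ℝ}
    (hγ : 2 < γ) (hmix : Summable fun k : ℕ => mixingCoeff μ V (k + 1) ^ (1 - 2 / γ))
    (hYm : ∀ t a i, Measurable[MeasurableSpace.comap (V t) inferInstance] fun ω => Y t ω a i)
    (hst : IsCenteredWeaklyStationary μ fun t ω => (Y t ω).vec)
    (hK : ∀ t a i, Integrable (fun ω => |Y t ω a i| ^ (2 * γ)) μ ∧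
      ∫ ω, |Y t ω a i| ^ (2 * γ) ∂μ ≤ K) (k₀ : ℕ) :
    IsBigOp μ (momentError μ Y k₀) (fun n => (n : ℝ) ^ (-(1 / 2) : ℝ)) := by
  refine IsBigOp.sum _ rate_nonneg fun k _ => IsBigOp.sum _ rate_nonneg fun i _ =>
    IsBigOp.sum _ rate_nonneg fun j _ => ?_
  -- Weak stationarity moves the covariance to time 0, and the zero means identify it with the
  -- expected product.
  have hc : ∀ (a b : Fin p) (t : ℤ), ∫ ω, Y t ω a i * Y (t - k) ω b j ∂μ =
      autoCov μ Y i j k a b := by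
    intro a b t
    have h1 := hst.cov_shift 0 (-(k : ℤ)) t (i, a) (j, b)
    have h2 := covariance_eq_sub (hst.memLp (0 + t) (i, a)) (hst.memLp (-(k : ℤ) + t) (j, b))
    rw [hst.mean_zero, zero_mul, sub_zero, h1, zero_add, neg_add_eq_sub] at h2
    exact h2.symm
  have hent : ∀ a b, IsBigOp μ (fun n ω => |sampleAutoCov (fun t => Y t ω) n i j k a b -
      autoCov μ Y i j k a b|) (fun n => (n : ℝ) ^ (-(1 / 2) : ℝ)) := by
    intro a b
    simp only [sampleAutoCov_apply]
    exact (isBigOp_sample_covariance hV hγ hmix k (fun t => hYm t a i) (fun t => hYm t b j)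
      (fun t => (hK t a i).1) (fun t => (hK t b j).1) (fun t => (hK t a i).2)
      (fun t => (hK t b j).2) (fun t => hst.mean_zero t (i, a)) (fun t => hst.mean_zero t (j, b))
      (hc a b)).abs
  refine (IsBigOp.sum Finset.univ rate_nonneg fun a _ =>
    IsBigOp.sum Finset.univ rate_nonneg fun b _ => hent a b).mono_left 0 fun n _ ω => ?_
  rw [abs_of_nonneg (norm_nonneg _), abs_of_nonneg (by positivity)]
  exact frobenius_norm_le_sum _

/-- A weakly stationary process is bounded in probability, uniformly in time. -/
lemma IsCenteredWeaklyStationary.isBigOp_norm [IsProbabilityMeasure μ] {p q : ℕ}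
    {Y : ℤ → Ω → Matrix (Fin p) (Fin q) ℝ}
    (hst : IsCenteredWeaklyStationary μ fun t ω => (Y t ω).vec) (τ : ℕ → ℤ) :
    IsBigOp μ (fun n ω => ‖Y (τ n) ω‖) (fun _ => 1) := by
  have h : ∀ a i, IsBigOp μ (fun n ω => |Y (τ n) ω a i|) (fun _ => 1) := by
    intro a i
    refine IsBigOp.abs (IsBigOp.of_variance_le (C := Var[fun ω => Y 0 ω a i; μ]) 0
      (fun n => hst.memLp (τ n) (i, a)) (fun n _ => hst.mean_zero (τ n) (i, a))
      (fun n _ => zero_lt_one) fun n _ => ?_)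
    have h1 := hst.cov_shift 0 0 (τ n) (i, a) (i, a)
    rw [covariance_self (hst.memLp _ (i, a)).aestronglyMeasurable.aemeasurable,
      covariance_self (hst.memLp _ (i, a)).aestronglyMeasurable.aemeasurable, zero_add] at h1
    rw [one_pow, mul_one]
    exact h1.le
  refine (IsBigOp.sum Finset.univ (fun _ => zero_le_one) fun a _ =>
    IsBigOp.sum Finset.univ (fun _ => zero_le_one) fun i _ => h a i).mono_left 0 fun n _ ω => ?_
  rw [abs_of_nonneg (norm_nonneg _), abs_of_nonneg (by positivity)]
  exact frobenius_norm_le_sum _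

end Rates

end MatrixFactor

/-! ### The consistency theorem -/

namespace MatrixFactor

open scoped Matrix Matrix.Norms.Frobenius

open Filter Asymptotics Topology in
/-- Root-`n` consistency of the estimated loading spaces and of the recovered factors. -/
theorem consistency {Ω : Type*} [MeasurableSpace Ω] {μ : Measure Ω} [IsProbabilityMeasure μ]
    {p₁ p₂ r₁ r₂ v₁ v₂ : ℕ} (hr₁ : 0 < r₁) (hr₂ : 0 < r₂) (hv₁ : 0 < v₁) (hv₂ : 0 < v₂) {k₀ : ℕ}
    {L₁ A₁ : Matrix (Fin p₁) (Fin r₁) ℝ} {L₂ A₂ : Matrix (Fin p₁) (Fin v₁) ℝ}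
    {R₁ P₁ : Matrix (Fin p₂) (Fin r₂) ℝ} {R₂ P₂ : Matrix (Fin p₂) (Fin v₂) ℝ}
    {F : ℤ → Ω → Matrix (Fin r₁) (Fin r₂) ℝ} {Z₁₂ : ℤ → Ω → Matrix (Fin r₁) (Fin v₂) ℝ}
    {Z₂₁ : ℤ → Ω → Matrix (Fin v₁) (Fin r₂) ℝ} {Z₂₂ : ℤ → Ω → Matrix (Fin v₁) (Fin v₂) ℝ}
    {Y : ℤ → Ω → Matrix (Fin p₁) (Fin p₂) ℝ} (hmodel : Model μ L₁ L₂ R₁ R₂ F Z₁₂ Z₂₁ Z₂₂ Y)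
    (hM₁ : (lagMatrix μ Y k₀).rank = r₁) (hM₂ : (lagMatrix μ (fun t ω => (Y t ω)ᵀ) k₀).rank = r₂)
    {W₁ : Matrix (Fin r₁) (Fin r₁) ℝ} {W₂ : Matrix (Fin v₁) (Fin v₁) ℝ}
    {G₁ : Matrix (Fin r₂) (Fin r₂) ℝ} {G₂ : Matrix (Fin v₂) (Fin v₂) ℝ}
    {B₁ : Matrix (Fin p₁) (Fin v₁) ℝ} {B₂ : Matrix (Fin p₁) (Fin r₁) ℝ}
    {Q₁ : Matrix (Fin p₂) (Fin v₂) ℝ} {Q₂ : Matrix (Fin p₂) (Fin r₂) ℝ}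
    (d₁ : LoadingDecomposition L₁ A₁ L₂ A₂ W₁ W₂ B₁ B₂)
    (d₂ : LoadingDecomposition R₁ P₁ R₂ P₂ G₁ G₂ Q₁ Q₂) {γ : ℝ} (hγ : 2 < γ)
    (hmix : Summable fun k : ℕ =>
      mixingCoeff μ (fun t ω => ((Y t ω).vec, (F t ω).vec)) (k + 1) ^ (1 - 2 / γ))
    {C₁ C₂ : ℝ}
    (hF : ∀ t a, Integrable (fun ω => |(F t ω).vec a| ^ (2 * γ)) μ ∧
      ∫ ω, |(F t ω).vec a| ^ (2 * γ) ∂μ < C₁)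
    (hZ : ∀ t b, Integrable (fun ω => |idioVec (Z₁₂ t ω) (Z₂₁ t ω) (Z₂₂ t ω) b| ^ (2 * γ)) μ ∧
      ∫ ω, |idioVec (Z₁₂ t ω) (Z₂₁ t ω) (Z₂₂ t ω) b| ^ (2 * γ) ∂μ < C₂)
    {hatA₁ : ℕ → Ω → Matrix (Fin p₁) (Fin r₁) ℝ} {hatB₁ : ℕ → Ω → Matrix (Fin p₁) (Fin v₁) ℝ}
    {hatP₁ : ℕ → Ω → Matrix (Fin p₂) (Fin r₂) ℝ} {hatQ₁ : ℕ → Ω → Matrix (Fin p₂) (Fin v₂) ℝ}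
    {hatB₂ : ℕ → Ω → Matrix (Fin p₁) (Fin r₁) ℝ} {hatQ₂ : ℕ → Ω → Matrix (Fin p₂) (Fin r₂) ℝ}
    (h_hatA₁ : ∀ n ω, IsTopEigenvectors (sampleLagMatrix (fun t => Y t ω) k₀ n) (hatA₁ n ω))
    (h_hatB₁ : ∀ n ω, IsBottomEigenvectors (sampleLagMatrix (fun t => Y t ω) k₀ n) (hatB₁ n ω))
    (h_hatP₁ : ∀ n ω,
      IsTopEigenvectors (sampleLagMatrix (fun t => (Y t ω)ᵀ) k₀ n) (hatP₁ n ω))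
    (h_hatQ₁ : ∀ n ω,
      IsBottomEigenvectors (sampleLagMatrix (fun t => (Y t ω)ᵀ) k₀ n) (hatQ₁ n ω))
    (h_hatB₂ : ∀ n ω, IsBottomEigenvectors
      (sampleNoiseMatrix (fun t => Y t ω) (hatQ₁ n ω) (hatB₁ n ω) n) (hatB₂ n ω))
    (h_hatQ₂ : ∀ n ω, IsBottomEigenvectors
      (sampleNoiseMatrix (fun t => (Y t ω)ᵀ) (hatB₁ n ω) (hatQ₁ n ω) n) (hatQ₂ n ω)) :
    IsBigOp μ (fun n ω => discrepancy (hatA₁ n ω) A₁)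
      (fun n => (n : ℝ) ^ (-(1 / 2) : ℝ)) ∧
    IsBigOp μ (fun n ω => discrepancy (hatB₁ n ω) B₁)
      (fun n => (n : ℝ) ^ (-(1 / 2) : ℝ)) ∧
    IsBigOp μ (fun n ω => discrepancy (hatP₁ n ω) P₁)
      (fun n => (n : ℝ) ^ (-(1 / 2) : ℝ)) ∧
    IsBigOp μ (fun n ω => discrepancy (hatQ₁ n ω) Q₁)
      (fun n => (n : ℝ) ^ (-(1 / 2) : ℝ)) ∧
    IsBigOp μ (fun n ω => discrepancy (hatB₂ n ω) B₂)
      (fun n => (n : ℝ) ^ (-(1 / 2) : ℝ)) ∧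
    IsBigOp μ (fun n ω => discrepancy (hatQ₂ n ω) Q₂)
      (fun n => (n : ℝ) ^ (-(1 / 2) : ℝ)) ∧
    -- the time `t` may be fixed or vary with the sample size
    ∀ t : ℕ → ℤ, IsBigOp μ
      (fun n ω => opNorm
        (hatA₁ n ω * recoveredFactor (hatA₁ n ω) (hatB₂ n ω) (hatP₁ n ω) (hatQ₂ n ω)
            (Y (t n) ω) * (hatP₁ n ω).transpose
          - A₁ * (W₁ * F (t n) ω * G₁.transpose) * P₁.transpose))
      (fun n => (n : ℝ) ^ (-(1 / 2) : ℝ)) := by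
  have htr := hmodel.transpose
  -- the rate of the sample moments
  have hYm : ∀ t a i, Measurable[MeasurableSpace.comap (fun ω => ((Y t ω).vec, (F t ω).vec))
      inferInstance] fun ω => Y t ω a i := fun t a i =>
    ((measurable_pi_apply (i, a)).comp measurable_fst).comp
      (comap_measurable fun ω => ((Y t ω).vec, (F t ω).vec))
  have hV : ∀ t, Measurable fun ω => ((Y t ω).vec, (F t ω).vec) := fun t =>
    (measurable_pi_iff.2 fun (x : Fin p₂ × Fin p₁) => hmodel.measurable_entry t x.2 x.1).prodMk
      (measurable_pi_iff.2 fun x => hmodel.measurable_factor t x)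
  obtain ⟨K, hK⟩ := hmodel.exists_moment_bound (by linarith : 0 < 2 * γ) hF hZ
  have he₁ := isBigOp_momentError hV hγ hmix hYm hmodel.stationary hK k₀
  have he₂ := isBigOp_momentError (Y := fun t ω => (Y t ω)ᵀ) hV hγ hmix
    (fun t a i => hYm t i a) htr.stationary (fun t a i => hK t i a) k₀
  have hrate := he₁.add he₂
  set e : ℕ → Ω → ℝ := fun n ω =>
    momentError μ Y k₀ n ω + momentError μ (fun t ω => (Y t ω)ᵀ) k₀ n ω
  -- All deterministic estimates are made along this filter on pairs (n, ω), where the total moment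
  -- error tends to 0 by construction.
  set l : Filter (ℕ × Ω) := comap (fun t : ℕ × Ω => e t.1 t.2) (𝓝 0)
  have he : Tendsto (fun t : ℕ × Ω => e t.1 t.2) l (𝓝 0) := tendsto_comap
  have hle₁ : ∀ n ω, momentError μ Y k₀ n ω ≤ e n ω := fun n ω =>
    le_add_of_nonneg_right (momentError_nonneg _ _ _ _)
  have hle₂ : ∀ n ω, momentError μ (fun t ω => (Y t ω)ᵀ) k₀ n ω ≤ e n ω := fun n ω =>
    le_add_of_nonneg_left (momentError_nonneg _ _ _ _)
  have hcov₁ : ∀ k ≤ k₀, ∀ i j, IsClose l (fun t => e t.1 t.2)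
      (fun t => sampleAutoCov (fun s => Y s t.2) t.1 i j k) (autoCov μ Y i j k) :=
    fun k hk i j => IsClose.of_norm_le 1 fun t => by
      rw [one_mul]
      exact ((norm_sampleAutoCov_sub_le Y hk t.1 t.2 i j).trans (hle₁ _ _)).trans (le_abs_self _)
  have hcov₂ : ∀ k ≤ k₀, ∀ i j, IsClose l (fun t => e t.1 t.2)
      (fun t => sampleAutoCov (fun s => (Y s t.2)ᵀ) t.1 i j k)
      (autoCov μ (fun t ω => (Y t ω)ᵀ) i j k) :=
    fun k hk i j => IsClose.of_norm_le 1 fun t => by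
      rw [one_mul]
      exact ((norm_sampleAutoCov_sub_le (fun t ω => (Y t ω)ᵀ) hk t.1 t.2 i j).trans
        (hle₂ _ _)).trans (le_abs_self _)
  -- closeness of the estimated projectors
  have hN₁ := IsClose.sampleLagMatrix he hcov₁
  have hN₂ := IsClose.sampleLagMatrix he hcov₂
  have hg₁ := hmodel.exists_hasGap_lagMatrix d₁ hM₁
  have hg₂ := htr.exists_hasGap_lagMatrix d₂ hM₂
  have hz₁ := hmodel.lagMatrix_mul d₁.orth_L₁ k₀
  have hz₂ := htr.lagMatrix_mul d₂.orth_L₁ k₀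
  have cA₁ := hN₁.top_projector hz₁ d₁.complement₁ d₁.half_A₁ hg₁ fun t => h_hatA₁ t.1 t.2
  have cB₁ := hN₁.bottom_projector hz₁ d₁.complement₁ d₁.half_B₁ hg₁ fun t => h_hatB₁ t.1 t.2
  have cP₁ := hN₂.top_projector hz₂ d₂.complement₁ d₂.half_A₁ hg₂ fun t => h_hatP₁ t.1 t.2
  have cQ₁ := hN₂.bottom_projector hz₂ d₂.complement₁ d₂.half_B₁ hg₂ fun t => h_hatQ₁ t.1 t.2
  -- The second stage uses the lag-0 covariances, for which reason the total moment error includes k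
  -- = 0.
  have hS₁ := IsClose.sampleNoiseMatrix he (hcov₁ 0 k₀.zero_le) cQ₁ cB₁
  have hS₂ := IsClose.sampleNoiseMatrix he (hcov₂ 0 k₀.zero_le) cB₁ cQ₁
  have cB₂ := hS₁.bottom_projector (hmodel.noiseMatrix_mul d₁ d₂) d₁.complement₂ d₁.half_B₂
    (hmodel.exists_hasGap_noiseMatrix hv₂ d₁ d₂) fun t => h_hatB₂ t.1 t.2
  have cQ₂ := hS₂.bottom_projector (htr.noiseMatrix_mul d₂ d₁) d₂.complement₂ d₂.half_B₂
    (htr.exists_hasGap_noiseMatrix hv₁ d₂ d₁) fun t => h_hatQ₂ t.1 t.2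
  have oA₁ : ∀ n ω, HalfOrthonormal (hatA₁ n ω) := fun n ω =>
    (h_hatA₁ n ω).neg.halfOrthonormal
  have oP₁ : ∀ n ω, HalfOrthonormal (hatP₁ n ω) := fun n ω =>
    (h_hatP₁ n ω).neg.halfOrthonormal
  have rate : ∀ {X : ℕ → Ω → ℝ},
      (fun t : ℕ × Ω => X t.1 t.2) =O[l] (fun t => e t.1 t.2) →
      IsBigOp μ X (fun n => (n : ℝ) ^ (-(1 / 2) : ℝ)) := fun {X} h =>
    hrate.of_isBigO tendsto_rate isBigOp_one X (fun n ω => by simp) h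
  refine ⟨rate (isBigO_discrepancy hr₁ (fun t => oA₁ t.1 t.2) d₁.half_A₁ cA₁),
    rate (isBigO_discrepancy hv₁ (fun t => (h_hatB₁ t.1 t.2).halfOrthonormal) d₁.half_B₁ cB₁),
    rate (isBigO_discrepancy hr₂ (fun t => oP₁ t.1 t.2) d₂.half_A₁ cP₁),
    rate (isBigO_discrepancy hv₂ (fun t => (h_hatQ₁ t.1 t.2).halfOrthonormal) d₂.half_B₁ cQ₁),
    rate (isBigO_discrepancy hr₁ (fun t => (h_hatB₂ t.1 t.2).halfOrthonormal) d₁.half_B₂ cB₂),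
    rate (isBigO_discrepancy hr₂ (fun t => (h_hatQ₂ t.1 t.2).halfOrthonormal) d₂.half_B₂ cQ₂),
    fun τ => ?_⟩
  -- the recovered factors
  have cE := IsClose.oblique he (fun t => oA₁ t.1 t.2) d₁.half_A₁ d₁.isUnit_B₂A₁ cA₁ cB₂
  have cK := (IsClose.oblique he (fun t => oP₁ t.1 t.2) d₂.half_A₁ d₂.isUnit_B₂A₁ cP₁ cQ₂).transpose
  -- The population oblique projectors remove all three noise blocks, leaving L₁F_tR₁'.
  have hsignal : ∀ t ω, A₁ * (W₁ * F t ω * G₁ᵀ) * P₁ᵀ =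
      oblique A₁ B₂ * Y t ω * (oblique P₁ Q₂)ᵀ := by
    intro t ω
    have h2 : (Matrix.fromCols R₁ R₂)ᵀ * (oblique P₁ Q₂)ᵀ = (Matrix.fromCols R₁ 0)ᵀ := by
      rw [← Matrix.transpose_mul, d₂.oblique_mul]
    have h3 : oblique A₁ B₂ * Y t ω * (oblique P₁ Q₂)ᵀ =
        oblique A₁ B₂ * Matrix.fromCols L₁ L₂ *
          Matrix.fromBlocks (F t ω) (Z₁₂ t ω) (Z₂₁ t ω) (Z₂₂ t ω) *
            ((Matrix.fromCols R₁ R₂)ᵀ * (oblique P₁ Q₂)ᵀ) := by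
      simp only [hmodel.eq, Matrix.mul_assoc]
    rw [h3, h2, d₁.oblique_mul, Matrix.fromCols_mul_fromBlocks, Matrix.transpose_fromCols,
      Matrix.fromCols_mul_fromRows, d₁.eq₁, d₂.eq₁]
    simp [Matrix.mul_assoc]
  set E₀ := oblique A₁ B₂
  set K₀ := (oblique P₁ Q₂)ᵀ
  let E : ℕ × Ω → Matrix (Fin p₁) (Fin p₁) ℝ := fun t => oblique (hatA₁ t.1 t.2) (hatB₂ t.1 t.2)
  let K' : ℕ × Ω → Matrix (Fin p₂) (Fin p₂) ℝ :=
    fun t => (oblique (hatP₁ t.1 t.2) (hatQ₂ t.1 t.2))ᵀ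
  -- Bounds the error per unit of ‖Y_t‖. The norm ‖K'‖ is replaced by ‖K' - K₀‖ + ‖K₀‖, so that only
  -- quantities controlled by e occur; ‖Y_t‖ itself is the O_p(1) factor.
  let Z : ℕ × Ω → ℝ := fun t => ‖E t - E₀‖ * (‖K' t - K₀‖ + ‖K₀‖) + ‖E₀‖ * ‖K' t - K₀‖
  have hEn : (fun t => ‖E t - E₀‖) =O[l] fun t => e t.1 t.2 := IsBigO.norm_left cE
  have hKn : (fun t => ‖K' t - K₀‖) =O[l] fun t => e t.1 t.2 := IsBigO.norm_left cK
  have hZO : Z =O[l] fun t => e t.1 t.2 := by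
    refine IsBigO.add ?_ (hKn.const_mul_left _)
    have h1 : (fun t => ‖K' t - K₀‖ + ‖K₀‖) =O[l] fun _ => (1 : ℝ) :=
      (hKn.trans (he.isBigO_one ℝ)).add (isBigO_const_const _ one_ne_zero _)
    simpa using hEn.mul h1
  refine hrate.of_isBigO tendsto_rate (hmodel.stationary.isBigOp_norm τ) (fun n ω => Z (n, ω))
    (fun n ω => ?_) hZO
  rw [mul_recoveredFactor_mul, hsignal, abs_of_nonneg (norm_nonneg _)]
  refine (abs_of_nonneg (opNorm_nonneg _)).trans_le ((opNorm_le_frobenius_norm _).trans ?_)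
  have hdec : E (n, ω) * Y (τ n) ω * K' (n, ω) - E₀ * Y (τ n) ω * K₀ =
      (E (n, ω) - E₀) * Y (τ n) ω * K' (n, ω) + E₀ * Y (τ n) ω * (K' (n, ω) - K₀) := by
    simp only [Matrix.sub_mul, Matrix.mul_sub]
    abel
  have hKle : ‖K' (n, ω)‖ ≤ ‖K' (n, ω) - K₀‖ + ‖K₀‖ := by
    simpa using norm_add_le (K' (n, ω) - K₀) K₀
  have hmul3 : ∀ (X : Matrix (Fin p₁) (Fin p₁) ℝ) (U : Matrix (Fin p₁) (Fin p₂) ℝ)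
      (X' : Matrix (Fin p₂) (Fin p₂) ℝ), ‖X * U * X'‖ ≤ ‖X‖ * ‖U‖ * ‖X'‖ := fun X U X' =>
    (Matrix.frobenius_norm_mul _ _).trans
      (mul_le_mul_of_nonneg_right (Matrix.frobenius_norm_mul _ _) (norm_nonneg _))
  calc ‖E (n, ω) * Y (τ n) ω * K' (n, ω) - E₀ * Y (τ n) ω * K₀‖
      ≤ ‖E (n, ω) - E₀‖ * ‖Y (τ n) ω‖ * ‖K' (n, ω)‖ +
        ‖E₀‖ * ‖Y (τ n) ω‖ * ‖K' (n, ω) - K₀‖ := by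
        rw [hdec]
        exact (norm_add_le _ _).trans (add_le_add (hmul3 _ _ _) (hmul3 _ _ _))
    _ ≤ ‖E (n, ω) - E₀‖ * ‖Y (τ n) ω‖ * (‖K' (n, ω) - K₀‖ + ‖K₀‖) +
        ‖E₀‖ * ‖Y (τ n) ω‖ * ‖K' (n, ω) - K₀‖ := by gcongr
    _ = Z (n, ω) * ‖Y (τ n) ω‖ := by ring
    _ ≤ ‖Z (n, ω)‖ * ‖Y (τ n) ω‖ :=
        mul_le_mul_of_nonneg_right (le_abs_self _) (norm_nonneg _)

end MatrixFactor

theorem theorem1 {Ω : Type*} [MeasurableSpace Ω] (μ : Measure Ω) [IsProbabilityMeasure μ]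
    {p₁ p₂ r₁ r₂ v₁ v₂ : ℕ} (hr₁ : 0 < r₁) (hr₂ : 0 < r₂) (hv₁ : 0 < v₁) (hv₂ : 0 < v₂)
    (k₀ : ℕ) (hk₀ : 0 < k₀)
    -- the model
    (L₁ : Matrix (Fin p₁) (Fin r₁) ℝ) (L₂ : Matrix (Fin p₁) (Fin v₁) ℝ)
    (R₁ : Matrix (Fin p₂) (Fin r₂) ℝ) (R₂ : Matrix (Fin p₂) (Fin v₂) ℝ)
    (F : ℤ → Ω → Matrix (Fin r₁) (Fin r₂) ℝ) (Z₁₂ : ℤ → Ω → Matrix (Fin r₁) (Fin v₂) ℝ)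
    (Z₂₁ : ℤ → Ω → Matrix (Fin v₁) (Fin r₂) ℝ) (Z₂₂ : ℤ → Ω → Matrix (Fin v₁) (Fin v₂) ℝ)
    (Y : ℤ → Ω → Matrix (Fin p₁) (Fin p₂) ℝ)
    (hmodel : MatrixFactor.Model μ L₁ L₂ R₁ R₂ F Z₁₂ Z₂₁ Z₂₂ Y)
    -- `M₁` has `r₁`, and `M₂` has `r₂`, non-zero eigenvalues
    (hM₁ : (MatrixFactor.lagMatrix μ Y k₀).rank = r₁)
    (hM₂ : (MatrixFactor.lagMatrix μ (fun t ω => (Y t ω).transpose) k₀).rank = r₂)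
    -- the decompositions of the loading matrices and the orthonormal complements
    (A₁ : Matrix (Fin p₁) (Fin r₁) ℝ) (A₂ : Matrix (Fin p₁) (Fin v₁) ℝ)
    (P₁ : Matrix (Fin p₂) (Fin r₂) ℝ) (P₂ : Matrix (Fin p₂) (Fin v₂) ℝ)
    (W₁ : Matrix (Fin r₁) (Fin r₁) ℝ) (W₂ : Matrix (Fin v₁) (Fin v₁) ℝ)
    (G₁ : Matrix (Fin r₂) (Fin r₂) ℝ) (G₂ : Matrix (Fin v₂) (Fin v₂) ℝ)
    (hA₁ : MatrixFactor.HalfOrthonormal A₁) (hA₂ : MatrixFactor.HalfOrthonormal A₂)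
    (hP₁ : MatrixFactor.HalfOrthonormal P₁) (hP₂ : MatrixFactor.HalfOrthonormal P₂)
    (hL₁ : L₁ = A₁ * W₁) (hL₂ : L₂ = A₂ * W₂) (hR₁ : R₁ = P₁ * G₁) (hR₂ : R₂ = P₂ * G₂)
    (B₁ : Matrix (Fin p₁) (Fin v₁) ℝ) (B₂ : Matrix (Fin p₁) (Fin r₁) ℝ)
    (Q₁ : Matrix (Fin p₂) (Fin v₂) ℝ) (Q₂ : Matrix (Fin p₂) (Fin r₂) ℝ)
    (hB₁ : MatrixFactor.HalfOrthonormal B₁) (hB₂ : MatrixFactor.HalfOrthonormal B₂)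
    (hQ₁ : MatrixFactor.HalfOrthonormal Q₁) (hQ₂ : MatrixFactor.HalfOrthonormal Q₂)
    (hBA₁ : B₁.transpose * A₁ = 0) (hBA₂ : B₂.transpose * A₂ = 0)
    (hQP₁ : Q₁.transpose * P₁ = 0) (hQP₂ : Q₂.transpose * P₂ = 0)
    -- mixing and moment conditions
    (γ : ℝ) (hγ : 2 < γ)
    (hmix : Summable fun k : ℕ =>
      MatrixFactor.mixingCoeff μ (fun t ω => ((Y t ω).vec, (F t ω).vec)) (k + 1) ^ (1 - 2 / γ))
    (C₁ C₂ : ℝ)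
    (hF : ∀ t a, Integrable (fun ω => |(F t ω).vec a| ^ (2 * γ)) μ ∧
      ∫ ω, |(F t ω).vec a| ^ (2 * γ) ∂μ < C₁)
    (hZ : ∀ t b,
      Integrable
        (fun ω => |MatrixFactor.idioVec (Z₁₂ t ω) (Z₂₁ t ω) (Z₂₂ t ω) b| ^ (2 * γ)) μ ∧
      ∫ ω, |MatrixFactor.idioVec (Z₁₂ t ω) (Z₂₁ t ω) (Z₂₂ t ω) b| ^ (2 * γ) ∂μ < C₂)
    -- the estimators from a sample of size `n`
    (hatA₁ : ℕ → Ω → Matrix (Fin p₁) (Fin r₁) ℝ) (hatB₁ : ℕ → Ω → Matrix (Fin p₁) (Fin v₁) ℝ)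
    (hatP₁ : ℕ → Ω → Matrix (Fin p₂) (Fin r₂) ℝ) (hatQ₁ : ℕ → Ω → Matrix (Fin p₂) (Fin v₂) ℝ)
    (hatB₂ : ℕ → Ω → Matrix (Fin p₁) (Fin r₁) ℝ) (hatQ₂ : ℕ → Ω → Matrix (Fin p₂) (Fin r₂) ℝ)
    (h_hatA₁ : ∀ n ω, MatrixFactor.IsTopEigenvectors
      (MatrixFactor.sampleLagMatrix (fun t => Y t ω) k₀ n) (hatA₁ n ω))
    (h_hatB₁ : ∀ n ω, MatrixFactor.IsBottomEigenvectors
      (MatrixFactor.sampleLagMatrix (fun t => Y t ω) k₀ n) (hatB₁ n ω))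
    (h_hatP₁ : ∀ n ω, MatrixFactor.IsTopEigenvectors
      (MatrixFactor.sampleLagMatrix (fun t => (Y t ω).transpose) k₀ n) (hatP₁ n ω))
    (h_hatQ₁ : ∀ n ω, MatrixFactor.IsBottomEigenvectors
      (MatrixFactor.sampleLagMatrix (fun t => (Y t ω).transpose) k₀ n) (hatQ₁ n ω))
    (h_hatB₂ : ∀ n ω, MatrixFactor.IsBottomEigenvectors
      (MatrixFactor.sampleNoiseMatrix (fun t => Y t ω) (hatQ₁ n ω) (hatB₁ n ω) n) (hatB₂ n ω))
    (h_hatQ₂ : ∀ n ω, MatrixFactor.IsBottomEigenvectors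
      (MatrixFactor.sampleNoiseMatrix (fun t => (Y t ω).transpose) (hatB₁ n ω) (hatQ₁ n ω) n)
      (hatQ₂ n ω)) :
    MatrixFactor.IsBigOp μ (fun n ω => MatrixFactor.discrepancy (hatA₁ n ω) A₁)
      (fun n => (n : ℝ) ^ (-(1 / 2) : ℝ)) ∧
    MatrixFactor.IsBigOp μ (fun n ω => MatrixFactor.discrepancy (hatB₁ n ω) B₁)
      (fun n => (n : ℝ) ^ (-(1 / 2) : ℝ)) ∧
    MatrixFactor.IsBigOp μ (fun n ω => MatrixFactor.discrepancy (hatP₁ n ω) P₁)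
      (fun n => (n : ℝ) ^ (-(1 / 2) : ℝ)) ∧
    MatrixFactor.IsBigOp μ (fun n ω => MatrixFactor.discrepancy (hatQ₁ n ω) Q₁)
      (fun n => (n : ℝ) ^ (-(1 / 2) : ℝ)) ∧
    MatrixFactor.IsBigOp μ (fun n ω => MatrixFactor.discrepancy (hatB₂ n ω) B₂)
      (fun n => (n : ℝ) ^ (-(1 / 2) : ℝ)) ∧
    MatrixFactor.IsBigOp μ (fun n ω => MatrixFactor.discrepancy (hatQ₂ n ω) Q₂)
      (fun n => (n : ℝ) ^ (-(1 / 2) : ℝ)) ∧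
    -- the time `t` may be fixed or vary with the sample size
    ∀ t : ℕ → ℤ, MatrixFactor.IsBigOp μ
      (fun n ω => MatrixFactor.opNorm
        (hatA₁ n ω * MatrixFactor.recoveredFactor (hatA₁ n ω) (hatB₂ n ω) (hatP₁ n ω) (hatQ₂ n ω)
            (Y (t n) ω) * (hatP₁ n ω).transpose
          - A₁ * (W₁ * F (t n) ω * G₁.transpose) * P₁.transpose))
      (fun n => (n : ℝ) ^ (-(1 / 2) : ℝ)) := by
  have d₁ : MatrixFactor.LoadingDecomposition L₁ A₁ L₂ A₂ W₁ W₂ B₁ B₂ :=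
    ⟨hmodel.dim₁, hmodel.rank_L, hA₁, hA₂, hB₁, hB₂, hL₁, hL₂, hBA₁, hBA₂⟩
  have d₂ : MatrixFactor.LoadingDecomposition R₁ P₁ R₂ P₂ G₁ G₂ Q₁ Q₂ :=
    ⟨hmodel.dim₂, hmodel.rank_R, hP₁, hP₂, hQ₁, hQ₂, hR₁, hR₂, hQP₁, hQP₂⟩
  exact MatrixFactor.consistency hr₁ hr₂ hv₁ hv₂ hmodel hM₁ hM₂ d₁ d₂ hγ hmix hF hZ
    h_hatA₁ h_hatB₁ h_hatP₁ h_hatQ₁ h_hatB₂ h_hatQ₂
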